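/- **Setting.** Let $M$ be a compact smooth surface with smooth boundary $\partial M$. A branched immersion of $M$ into $\mathbb{R}^n$ is a $C^1$ map $u:M\to\mathbb{R}^n$ such that every $p\in M$ (including boundary points) is either a point where $du_p$ has rank $2$, or a branch point: there are an integer $m\ge 2$, a $C^1$ coordinate $z$ of $M$ near $p$ with values in $\mathbb{C}$ and $z(p)=0$, and a rigid motion of $\mathbb{R}^n\simeq\mathbb{C}\times\mathbb{R}^{n-2}$ taking $u(p)$ to $0$, after which $u=(z^m,f(z))$ near $p$ with $f(z)=o(|z|^m)$. Integrals over $M$ are taken with respect to the area measure $dA=Ju\,d\mathcal{H}^2$, $Ju=\sqrt{\det\big((du)^*du\big)}$. Put $r_0=\max_{x,y\in u(M)}|x-y|$. For $p\in(2,\infty]$ put $C(p)=1$, $\alpha=1$ if $p=\infty$, and $C(p)=\frac{2p}{p-2}\left(\frac2\pi\right)^{1/p}$, $\alpha=1-\frac2p$ if $p<\infty$. **Statement.** For every $\epsilon\in(0,2]$ there is a $\delta=\delta(\epsilon)\in(0,1)$, depending only on $\epsilon$, such that the following holds for all $n$ and all $p\in(2,\infty]$. Let $\Gamma\subset\mathbb{R}^n$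 be a simple closed regular $C^1$ curve whose total curvature (the total variation of its unit tangent) is at most $(4-\epsilon)\pi$. Let $u:M\to\mathbb{R}^n$ be a branched immersion that is one-to-one on $\partial M$ with $u(\partial M)=\Gamma$. Suppose that there is an integrable normal vector field $H:M\to\mathbb{R}^n$ (the mean curvature vector) such that $$\int_M \operatorname{div}_M X\,dA=\int_M X\cdot H\,dA+\int_\Gamma X\cdot\nu_M\,ds$$ for every $C^1$ vector field $X$ on $\mathbb{R}^n$, where $\nu_M$ is the outward unit normal to the boundary tangent to $M$. If $H\in L^p(M)$ and $$C(p)\,\|H\|_{L^p(M)}\,r_0^{\alpha}<\delta,$$ then the interior of $M$ is embedded: the restriction of $u$ to $M\setminus\partial M$ is an immersion (so there are no interior branch points) and a homeomorphism onto its image. -/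

import Mathlib

open Set MeasureTheory Topology Manifold
open scoped ENNReal ContDiff RealInnerProductSpace

noncomputable section

namespace BranchedSurface

/-- Euclidean space `ℝⁿ`. -/
abbrev Euc (n : ℕ) : Type := EuclideanSpace ℝ (Fin n)

variable {n : ℕ} {M : Type*} [TopologicalSpace M] [ChartedSpace (EuclideanHalfSpace 2) M]

/-- The differential of `u` at `p`, in the preferred chart at `p`; that chart identifies `T_pM` with
`ℝ²`, and if `p ∈ ∂M` then `T_p∂M` is `{v | v 0 = 0}` and the inward vectors are `{v | 0 < v 0}`. -/
def du (u : M → Euc n) (p : M) : Euc 2 →L[ℝ] Euc n :=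
  mfderiv (𝓡∂ 2) 𝓘(ℝ, Euc n) u p

/-- `u` has a branch point at `p`: for some `m ≥ 2`, in a `C¹` coordinate `ζ : U → ℂ` of `M`
centred at `p` (a half-disc-like coordinate if `p ∈ ∂M`) and after a rigid motion of `ℝⁿ`, `u` has
the form `(ζ^m, f(ζ)) ∈ ℂ × ℝⁿ⁻²`, where `ζ^m` is the leading term, that is `f(ζ) = o(|ζ|^m)`.
The factor `ℂ × 0` is the range of `L`, the factor `0 × ℝⁿ⁻²` is its orthogonal complement. -/
def IsBranchPoint (u : M → Euc n) (p : M) : Prop :=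
  ∃ (m : ℕ) (U : Set M) (ζ : M → ℂ) (L : ℂ →ₗᵢ[ℝ] Euc n) (f : ℂ → Euc n),
    2 ≤ m ∧ IsOpen U ∧ p ∈ U ∧
    ContMDiffOn (𝓡∂ 2) 𝓘(ℝ, ℂ) 1 ζ U ∧ InjOn ζ U ∧
    (∀ q ∈ U, Function.Bijective (mfderiv (𝓡∂ 2) 𝓘(ℝ, ℂ) ζ q)) ∧ ζ p = 0 ∧
    (∀ z w, ⟪L z, f w⟫ = 0) ∧
    (∀ q ∈ U, u q = u p + L (ζ q ^ m) + f (ζ q)) ∧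
    (fun q => f (ζ q)) =o[𝓝 p] (fun q => ζ q ^ m)

/-- A branched immersion of the surface `M` into `ℝⁿ`: a `C¹` map which, at every point up to and
including the boundary, is an immersion or has a branch point. -/
structure IsBranchedImmersion (u : M → Euc n) : Prop where
  contMDiff : ContMDiff (𝓡∂ 2) 𝓘(ℝ, Euc n) 1 u
  immersed_or_branch : ∀ p, Function.Injective (du u p) ∨ IsBranchPoint u p

/-- The Jacobian `√det(A* A)` of a linear map `A : ℝ² → ℝⁿ`. -/
def jacobian (A : Euc 2 →L[ℝ] Euc n) : ℝ :=
  Real.sqrt (LinearMap.det ((ContinuousLinearMap.adjoint A ∘L A : Euc 2 →L[ℝ] Euc 2) :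
    Euc 2 →ₗ[ℝ] Euc 2))

/-- The Jacobian of `u` read in the chart at `p`. -/
def chartJacobian (u : M → Euc n) (p : M) (y : Euc 2) : ℝ :=
  jacobian (fderivWithin ℝ (u ∘ (extChartAt (𝓡∂ 2) p).symm) (range (𝓡∂ 2)) y)

/-- The area `Ju dℋ²` of `u` on the domain of the chart at `p`, as a measure on `M`. -/
def chartArea [MeasurableSpace M] (u : M → Euc n) (p : M) : Measure M :=
  ((volume.restrict (extChartAt (𝓡∂ 2) p).target).withDensity
    (fun y => ENNReal.ofReal (chartJacobian u p y))).map (extChartAt (𝓡∂ 2) p).symm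

/-- The area measure `Ju dℋ²` on `M` induced by `u` (area counted with multiplicity in `ℝⁿ`).
By the change of variables formula the measures `chartArea u p` agree on overlaps of charts, so
their supremum is the measure that restricts to `chartArea u p` on every chart domain. -/
def area [MeasurableSpace M] (u : M → Euc n) : Measure M :=
  iSup (fun p : M => chartArea u p)

/-- The divergence `div_M X = ∑ᵢ ⟨τᵢ, D_{τᵢ} X⟩` at `p`, with `τ₁, τ₂` an orthonormal basis of the
tangent plane `du_p(T_pM)`; it is the trace of `P ∘ DX`, with `P` the orthogonal projection to that
plane. -/
def surfaceDiv (u : M → Euc n) (X : Euc n → Euc n) (p : M) : ℝ :=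
  LinearMap.trace ℝ (Euc n)
    (((LinearMap.range (du u p).toLinearMap).starProjection ∘L fderiv ℝ X (u p) :
      Euc n →L[ℝ] Euc n) : Euc n →ₗ[ℝ] Euc n)

/-- The outward unit conormal `ν_M` at a boundary point `p` at which `u` is an immersion: the unit
vector tangent to the surface, normal to the boundary, pointing out of the surface. (At the
finitely many boundary branch points the value is irrelevant.) -/
def conormal (u : M → Euc n) (p : M) : Euc n :=
  let a := du u p (EuclideanSpace.single 0 1);
  let b := du u p (EuclideanSpace.single 1 1);
  let w := (Submodule.span ℝ {b})ᗮ.starProjection a;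
  (-‖w‖⁻¹) • w

/-- The length measure on `∂M`: one-dimensional Hausdorff measure on `Γ = u(∂M)`, transported to
`∂M` by `u`, which is one-to-one on `∂M`. -/
def boundaryLength [MeasurableSpace M] (u : M → Euc n) :
    Measure ((𝓡∂ 2).boundary M) :=
  (μH[1] : Measure (Euc n)).comap (fun p => u p)

/-- `u` has mean curvature vector `H`, an integrable normal field, and
`∫_M div_M X dA = ∫_M X · H dA + ∫_Γ X · ν_M ds` for every `C¹` vector field `X` on `ℝⁿ`. -/
structure DivergenceIdentity [MeasurableSpace M] (u : M → Euc n) (H : M → Euc n) : Prop where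
  integrable : Integrable H (area u)
  normal : ∀ᵐ p ∂(area u), ∀ v, ⟪du u p v, H p⟫ = 0
  identity : ∀ X : Euc n → Euc n, ContDiff ℝ 1 X →
    (∫ p, surfaceDiv u X p ∂(area u)) =
      (∫ p, ⟪X (u p), H p⟫ ∂(area u)) +
      (∫ p : (𝓡∂ 2).boundary M, ⟪X (u p), conormal u p⟫ ∂(boundaryLength u))

/-- `γ`, restricted to a period `[0,1]`, is a regular parametrization of a simple closed `C¹`
curve. -/
structure IsC1ClosedCurve (γ : ℝ → Euc n) : Prop where
  contDiff : ContDiff ℝ 1 γ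
  periodic : Function.Periodic γ 1
  deriv_ne_zero : ∀ t, deriv γ t ≠ 0
  injOn : InjOn γ (Ico 0 1)

/-- The total curvature of a closed `C¹` curve: the total variation of its unit tangent over one
period. (The unit tangent is continuous, so its variation is the same for chordal and for angular
distance.) -/
def totalCurvature (γ : ℝ → Euc n) : ℝ≥0∞ :=
  eVariationOn (fun t => ‖deriv γ t‖⁻¹ • deriv γ t) (Icc 0 1)

/-- The extrinsic diameter `r₀` of the surface. -/
def extrinsicDiam (u : M → Euc n) : ℝ := Metric.diam (range u)

/-- The constant `C(p)`. -/
def constC (p : ℝ≥0∞) : ℝ :=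
  if p = ⊤ then 1 else 2 * p.toReal / (p.toReal - 2) * (2 / Real.pi) ^ (1 / p.toReal)

/-- The exponent `α`. -/
def expAlpha (p : ℝ≥0∞) : ℝ :=
  if p = ⊤ then 1 else 1 - 2 / p.toReal

/-- The interior of the surface is embedded: `u` restricted to `M ∖ ∂M` is an immersion (so there
are no interior branch points) and a homeomorphism onto its image. -/
structure InteriorEmbedded (u : M → Euc n) : Prop where
  immersion : ∀ p ∈ (𝓡∂ 2).interior M, Function.Injective (du u p)
  embedding : IsEmbedding (fun p : (𝓡∂ 2).interior M => u p)

end BranchedSurface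

end

/-!
For a point `x ∈ ℝⁿ` and a height `s > 0`, insert the vector field `(y - x) / (|y - x|² + s²)` in
the divergence identity. Since the surface is two-dimensional, completing a square bounds twice the
Poisson mass `∫ s² / (|u - x|² + s²)² dA` by `(1/8) ∫ |H|²` plus a boundary flux. The flux is the
length of a regularised radial projection of `Γ` from `x`, which is at most the total curvature of
`Γ`, minus a nonnegative defect.

As `s → 0`, the Poisson mass near an interior point over `x` is at least `π`, and at least `2π` at a
branch point; near a boundary point over `x` it is at least `π/2`, and then the defect is at least
`π`, because the tangent of `Γ` has to turn through two half circles to leave `x` and return to it.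
Hence, if the total curvature plus `(1/8) ∫ |H|²` is less than `4π`, there is no room for an
interior branch point, for a double point, or for an interior point lying over `Γ`.

Finally, the divergence identity for the field `y - x` bounds the area by a multiple of `r₀²`, and
Hölder's inequality turns the smallness hypothesis on `‖H‖_p` into the smallness of `∫ |H|²`.
-/

noncomputable section

namespace BranchedSurface

section LinearAlgebra

variable {E F : Type*} [NormedAddCommGroup E] [InnerProductSpace ℝ E]
  [NormedAddCommGroup F] [InnerProductSpace ℝ F]

/-- The Gram determinant of two vectors, the squared area of the parallelogram they span. -/
def gramDet (a b : E) : ℝ := ‖a‖ ^ 2 * ‖b‖ ^ 2 - ⟪a, b⟫ ^ 2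

lemma gramDet_nonneg (a b : E) : 0 ≤ gramDet a b := by
  rw [gramDet, ← mul_pow, sub_nonneg]
  exact sq_le_sq.2 ((abs_real_inner_le_norm a b).trans (le_abs_self _))

lemma gramDet_sub_smul (a b : E) (t : ℝ) : gramDet a (b - t • a) = gramDet a b := by
  simp only [gramDet, norm_sub_sq_real, inner_sub_right, real_inner_smul_right, norm_smul,
    real_inner_self_eq_norm_sq, real_inner_comm a b, mul_pow, Real.norm_eq_abs, sq_abs]
  ring

lemma gramDet_le (a b : E) : gramDet a b ≤ ‖a‖ ^ 2 * ‖b‖ ^ 2 :=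
  sub_le_self _ (sq_nonneg _)

lemma gramDet_of_inner_eq_zero {a b : E} (h : ⟪a, b⟫ = 0) :
    gramDet a b = ‖a‖ ^ 2 * ‖b‖ ^ 2 := by
  simp [gramDet, h]

lemma gramDet_map_le (B : E →L[ℝ] F) (hB : ∀ x, ‖B x‖ ≤ ‖x‖) (a b : E) :
    gramDet (B a) (B b) ≤ gramDet a b := by
  set t := ⟪a, b⟫ / ‖a‖ ^ 2 with ht
  have horth : ⟪a, b - t • a⟫ = 0 := by
    rcases eq_or_ne a 0 with rfl | ha
    · exact inner_zero_left _
    · rw [inner_sub_right, real_inner_smul_right, real_inner_self_eq_norm_sq, ht,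
        div_mul_cancel₀ _ (by simpa using ha), sub_self]
  calc gramDet (B a) (B b) = gramDet (B a) (B (b - t • a)) := by
        rw [map_sub, map_smul, gramDet_sub_smul]
    _ ≤ ‖B a‖ ^ 2 * ‖B (b - t • a)‖ ^ 2 := gramDet_le _ _
    _ ≤ ‖a‖ ^ 2 * ‖b - t • a‖ ^ 2 := by gcongr <;> exact hB _
    _ = gramDet a b := by rw [← gramDet_of_inner_eq_zero horth, gramDet_sub_smul]

lemma det_adjoint_comp_self {n : ℕ} (A : Euc 2 →L[ℝ] Euc n) :
    LinearMap.det ((ContinuousLinearMap.adjoint A ∘L A : Euc 2 →L[ℝ] Euc 2) :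
      Euc 2 →ₗ[ℝ] Euc 2) =
      gramDet (A (EuclideanSpace.single 0 1)) (A (EuclideanSpace.single 1 1)) := by
  let b := EuclideanSpace.basisFun (Fin 2) ℝ
  have hentry (i j : Fin 2) : LinearMap.toMatrix b.toBasis b.toBasis
      ((ContinuousLinearMap.adjoint A ∘L A : Euc 2 →L[ℝ] Euc 2) : Euc 2 →ₗ[ℝ] Euc 2) i j =
      ⟪A (EuclideanSpace.single i 1), A (EuclideanSpace.single j 1)⟫ :=
    (LinearMap.toMatrixOrthonormal_apply_apply b _ i j).trans
      (by simp [b, ContinuousLinearMap.adjoint_inner_right])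
  rw [← LinearMap.det_toMatrix b.toBasis, Matrix.det_fin_two, hentry, hentry, hentry,
    hentry, gramDet, real_inner_self_eq_norm_sq, real_inner_self_eq_norm_sq,
    real_inner_comm (A (EuclideanSpace.single 0 1)), sq ⟪_, _⟫]

lemma jacobian_eq_sqrt_gramDet {n : ℕ} (A : Euc 2 →L[ℝ] Euc n) :
    jacobian A =
      √(gramDet (A (EuclideanSpace.single 0 1)) (A (EuclideanSpace.single 1 1))) := by
  rw [jacobian, det_adjoint_comp_self]

lemma det_adjoint [FiniteDimensional ℝ E] (B : E →L[ℝ] E) :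
    LinearMap.det (ContinuousLinearMap.adjoint B : E →ₗ[ℝ] E) =
      LinearMap.det (B : E →ₗ[ℝ] E) := by
  let b := stdOrthonormalBasis ℝ E
  rw [← LinearMap.det_toMatrix b.toBasis, ← LinearMap.det_toMatrix b.toBasis]
  have h : LinearMap.toMatrix b.toBasis b.toBasis
      (ContinuousLinearMap.adjoint B : E →ₗ[ℝ] E) =
      (LinearMap.toMatrix b.toBasis b.toBasis (B : E →ₗ[ℝ] E)).conjTranspose :=
    LinearMap.toMatrix_adjoint b b (B : E →ₗ[ℝ] E)
  rw [h, Matrix.det_conjTranspose, star_trivial]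

lemma jacobian_comp {n : ℕ} (A : Euc 2 →L[ℝ] Euc n) (B : Euc 2 →L[ℝ] Euc 2) :
    jacobian (A ∘L B) = jacobian A * |B.det| := by
  have h : ((ContinuousLinearMap.adjoint (A ∘L B) ∘L (A ∘L B) : Euc 2 →L[ℝ] Euc 2) :
      Euc 2 →ₗ[ℝ] Euc 2) = (ContinuousLinearMap.adjoint B : Euc 2 →ₗ[ℝ] Euc 2) ∘ₗ
      (((ContinuousLinearMap.adjoint A ∘L A : Euc 2 →L[ℝ] Euc 2) : Euc 2 →ₗ[ℝ] Euc 2) ∘ₗ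
        (B : Euc 2 →ₗ[ℝ] Euc 2)) := by
    rw [ContinuousLinearMap.adjoint_comp]; rfl
  rw [jacobian, h, LinearMap.det_comp, LinearMap.det_comp, det_adjoint, mul_comm, mul_assoc,
    Real.sqrt_mul' _ (mul_self_nonneg _), Real.sqrt_mul_self_eq_abs]
  rfl

lemma jacobian_eq_abs_det (B : Euc 2 →L[ℝ] Euc 2) : jacobian B = |B.det| := by
  have hid : jacobian (ContinuousLinearMap.id ℝ (Euc 2)) = 1 := by
    simp [jacobian_eq_sqrt_gramDet, gramDet, EuclideanSpace.inner_single_left]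
  simpa [hid] using jacobian_comp (ContinuousLinearMap.id ℝ (Euc 2)) B

lemma jacobian_ne_zero_iff {n : ℕ} (A : Euc 2 →L[ℝ] Euc n) :
    jacobian A ≠ 0 ↔ Function.Injective A := by
  rw [jacobian, Real.sqrt_ne_zero (by rw [det_adjoint_comp_self]; exact gramDet_nonneg _ _),
    ← ContinuousLinearMap.adjoint_comp_self_injective_iff, ne_eq,
    LinearMap.det_eq_zero_iff_ker_ne_bot, not_not, LinearMap.ker_eq_bot]
  rfl

lemma continuous_jacobian {n : ℕ} : Continuous (jacobian : (Euc 2 →L[ℝ] Euc n) → ℝ) := by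
  have heq : (jacobian : (Euc 2 →L[ℝ] Euc n) → ℝ) = fun A =>
      √(gramDet (A (EuclideanSpace.single 0 1)) (A (EuclideanSpace.single 1 1))) :=
    funext jacobian_eq_sqrt_gramDet
  rw [heq]
  unfold gramDet
  fun_prop

lemma abs_det_comp_le_jacobian {n : ℕ} (A : Euc 2 →L[ℝ] Euc n) (B : Euc n →L[ℝ] Euc 2)
    (hB : ∀ x, ‖B x‖ ≤ ‖x‖) : |(B ∘L A).det| ≤ jacobian A := by
  rw [← jacobian_eq_abs_det, jacobian_eq_sqrt_gramDet, jacobian_eq_sqrt_gramDet]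
  exact Real.sqrt_le_sqrt (gramDet_map_le B hB _ _)

lemma isUnit_adjoint_comp_self [FiniteDimensional ℝ E] [FiniteDimensional ℝ F] {A : E →L[ℝ] F}
    (hA : Function.Injective A) : IsUnit (ContinuousLinearMap.adjoint A ∘L A) := by
  have hinj : Function.Injective (ContinuousLinearMap.adjoint A ∘L A).toLinearMap :=
    (ContinuousLinearMap.adjoint_comp_self_injective_iff A).2 hA
  exact ContinuousLinearMap.isUnit_iff_bijective.2
    ⟨hinj, LinearMap.injective_iff_surjective.1 hinj⟩

lemma starProjection_range [FiniteDimensional ℝ E] [FiniteDimensional ℝ F] {A : E →L[ℝ] F}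
    (hA : Function.Injective A) :
    (LinearMap.range A.toLinearMap).starProjection =
      A ∘L Ring.inverse (ContinuousLinearMap.adjoint A ∘L A) ∘L ContinuousLinearMap.adjoint A := by
  ext v
  refine Submodule.eq_starProjection_of_mem_of_inner_eq_zero ⟨_, rfl⟩ ?_
  rintro _ ⟨w, rfl⟩
  have hcancel := DFunLike.congr_fun (Ring.mul_inverse_cancel _ (isUnit_adjoint_comp_self hA))
    (ContinuousLinearMap.adjoint A v)
  change ContinuousLinearMap.adjoint A (A _) = ContinuousLinearMap.adjoint A v at hcancel
  change ⟪v - A _, A w⟫ = 0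
  rw [← ContinuousLinearMap.adjoint_inner_left, map_sub]
  exact (congrArg (⟪· , w⟫) (sub_eq_zero.2 hcancel.symm)).trans (inner_zero_left _)

lemma trace_starProjection_range [FiniteDimensional ℝ E] [FiniteDimensional ℝ F] {A : E →L[ℝ] F}
    (hA : Function.Injective A) :
    LinearMap.trace ℝ F ((LinearMap.range A.toLinearMap).starProjection : F →ₗ[ℝ] F) =
      Module.finrank ℝ E := by
  have hproj : LinearMap.IsProj (LinearMap.range A.toLinearMap)
      ((LinearMap.range A.toLinearMap).starProjection : F →ₗ[ℝ] F) :=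
    ⟨fun _ => Submodule.starProjection_apply_mem _ _,
      fun _ => Submodule.starProjection_eq_self_iff.2⟩
  rw [hproj.trace, LinearMap.finrank_range_of_inj hA]

end LinearAlgebra

lemma uniformContinuous_of_periodic {X : Type*} [UniformSpace X] {f : ℝ → X} (hf : Continuous f)
    {c : ℝ} (hc : 0 < c) (h : Function.Periodic f c) : UniformContinuous f := by
  have : Fact (0 < c) := ⟨hc⟩
  have hlift : Continuous (h.lift : AddCircle c → X) := continuous_coinduced_dom.2 hf
  exact (CompactSpace.uniformContinuous_of_continuous hlift).comp
    (uniformContinuous_addMonoidHom_of_continuous (f := QuotientAddGroup.mk' _)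
      (AddCircle.continuous_mk' c))

section Curves

variable {E : Type*} [NormedAddCommGroup E] [NormedSpace ℝ E] {γ : ℝ → E}

/-- The unit tangent of a curve (`0` where the derivative vanishes). -/
def unitTangent (γ : ℝ → E) (t : ℝ) : E := ‖deriv γ t‖⁻¹ • deriv γ t

lemma norm_unitTangent {t : ℝ} (h : deriv γ t ≠ 0) : ‖unitTangent γ t‖ = 1 := by
  rw [unitTangent, norm_smul, norm_inv, norm_norm, inv_mul_cancel₀ (norm_ne_zero_iff.2 h)]

lemma norm_deriv_smul_unitTangent (γ : ℝ → E) (t : ℝ) :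
    ‖deriv γ t‖ • unitTangent γ t = deriv γ t := by
  rcases eq_or_ne (deriv γ t) 0 with h | h
  · rw [h, norm_zero, zero_smul]
  · rw [unitTangent, smul_smul, mul_inv_cancel₀ (norm_ne_zero_iff.2 h), one_smul]

lemma continuous_unitTangent (hγ : ContDiff ℝ 1 γ) (h : ∀ t, deriv γ t ≠ 0) :
    Continuous (unitTangent γ) := by
  have hc : Continuous (deriv γ) := hγ.continuous_deriv le_rfl
  exact (hc.norm.inv₀ fun t => norm_ne_zero_iff.2 (h t)).smul hc

lemma periodic_deriv {c : ℝ} (h : Function.Periodic γ c) : Function.Periodic (deriv γ) c :=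
  fun t => by rw [← deriv_comp_add_const, h.funext]

lemma periodic_unitTangent {c : ℝ} (h : Function.Periodic γ c) :
    Function.Periodic (unitTangent γ) c :=
  fun t => by rw [unitTangent, periodic_deriv h, ← unitTangent]

end Curves

section Rejection

variable {E : Type*} [NormedAddCommGroup E] [InnerProductSpace ℝ E]

/-- The component of `v` orthogonal to the unit vector `T`; as a formula it is visibly continuous
in `T`. -/
def rejection (T v : E) : E := v - ⟪T, v⟫ • T

lemma norm_rejection_sq {T : E} (hT : ‖T‖ = 1) (v : E) :
    ‖rejection T v‖ ^ 2 = ‖v‖ ^ 2 - ⟪T, v⟫ ^ 2 := by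
  rw [rejection, norm_sub_sq_real, real_inner_smul_right, norm_smul, hT, real_inner_comm,
    mul_one, Real.norm_eq_abs, sq_abs]
  ring

lemma norm_rejection_le {T : E} (hT : ‖T‖ = 1) (v : E) : ‖rejection T v‖ ≤ ‖v‖ :=
  (sq_le_sq₀ (norm_nonneg _) (norm_nonneg _)).1 <|
    (norm_rejection_sq hT v).trans_le (sub_le_self _ (sq_nonneg _))

lemma rejection_add (T v w : E) : rejection T (v + w) = rejection T v + rejection T w := by
  simp only [rejection, inner_add_right, add_smul]
  abel

lemma rejection_smul (T v : E) (c : ℝ) : rejection T (c • v) = c • rejection T v := by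
  simp only [rejection, real_inner_smul_right, smul_sub, smul_smul]

lemma rejection_unitTangent_deriv {γ : ℝ → E} {t : ℝ} (h : deriv γ t ≠ 0) :
    rejection (unitTangent γ t) (deriv γ t) = 0 := by
  rw [← norm_deriv_smul_unitTangent, rejection_smul, rejection, real_inner_self_eq_norm_sq,
    norm_unitTangent h, one_pow, one_smul, sub_self, smul_zero]

@[fun_prop]
lemma continuous_rejection {X : Type*} [TopologicalSpace X] {f g : X → E} (hf : Continuous f)
    (hg : Continuous g) : Continuous fun x => rejection (f x) (g x) := by
  unfold rejection
  fun_prop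

end Rejection

section RadialProjection

variable {E : Type*} [NormedAddCommGroup E] [InnerProductSpace ℝ E]

/-- The speed of the radial projection, to the unit sphere around `(x, -s)` in `E × ℝ`, of a unit
speed curve in `E × 0` that passes through `(x + v, 0)` with velocity `(T, 0)`. -/
def coneSpeed (s : ℝ) (T v : E) : ℝ := √(‖rejection T v‖ ^ 2 + s ^ 2) / (‖v‖ ^ 2 + s ^ 2)

/-- The angle between `(T, 0)` and `(v, s)` in `E × ℝ`. -/
def coneAngle (s : ℝ) (T v : E) : ℝ :=
  InnerProductGeometry.angle (WithLp.toLp 2 (T, (0 : ℝ))) (WithLp.toLp 2 (v, s))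

lemma coneAngle_le_add_angle (s : ℝ) (T T' v : E) :
    coneAngle s T' v ≤ coneAngle s T v + InnerProductGeometry.angle T' T := by
  have hangle : InnerProductGeometry.angle (WithLp.toLp 2 (T', (0 : ℝ)))
      (WithLp.toLp 2 (T, (0 : ℝ))) = InnerProductGeometry.angle T' T := by
    simp [InnerProductGeometry.angle, WithLp.prod_inner_apply]
  rw [← hangle, add_comm]
  exact InnerProductGeometry.angle_le_angle_add_angle _ _ _

lemma coneAngle_eq_arccos (s : ℝ) {T : E} (hT : ‖T‖ = 1) (v : E) :
    coneAngle s T v = Real.arccos (⟪T, v⟫ / √(‖v‖ ^ 2 + s ^ 2)) := by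
  simp [coneAngle, InnerProductGeometry.angle, WithLp.prod_inner_apply,
    WithLp.prod_norm_eq_of_L2, hT]

/-- The derivative of `coneAngle s T v` when `v` moves with velocity `w`. -/
def coneAngleDeriv (s : ℝ) (T v w : E) : ℝ :=
  -(⟪T, w⟫ * (‖v‖ ^ 2 + s ^ 2) - ⟪T, v⟫ * ⟪v, w⟫) /
    (√(‖rejection T v‖ ^ 2 + s ^ 2) * (‖v‖ ^ 2 + s ^ 2))

lemma hasDerivAt_coneAngle {s : ℝ} (hs : 0 < s) {T : E} (hT : ‖T‖ = 1) {v : ℝ → E} {w : E}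
    {t : ℝ} (hv : HasDerivAt v w t) :
    HasDerivAt (fun τ => coneAngle s T (v τ)) (coneAngleDeriv s T (v t) w) t := by
  simp only [coneAngle_eq_arccos s hT]
  have hd : 0 < ‖v t‖ ^ 2 + s ^ 2 := by positivity
  have hS : 0 < ‖rejection T (v t)‖ ^ 2 + s ^ 2 := by positivity
  have hsin : 1 - (⟪T, v t⟫ / √(‖v t‖ ^ 2 + s ^ 2)) ^ 2 =
      (‖rejection T (v t)‖ ^ 2 + s ^ 2) / (‖v t‖ ^ 2 + s ^ 2) := by
    rw [div_pow, Real.sq_sqrt hd.le, norm_rejection_sq hT]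
    field_simp
    ring
  have hcos : |⟪T, v t⟫ / √(‖v t‖ ^ 2 + s ^ 2)| < 1 := by
    rw [← sq_lt_one_iff_abs_lt_one]
    linarith [div_pos hS hd]
  have hnorm : HasDerivAt (fun τ => ‖v τ‖ ^ 2 + s ^ 2) (2 * ⟪v t, w⟫) t :=
    hv.norm_sq.add_const (s ^ 2)
  have hinner : HasDerivAt (fun τ => ⟪T, v τ⟫) ⟪T, w⟫ t := by
    simpa using (hasDerivAt_const t T).inner ℝ hv
  have hquot := hinner.div (hnorm.sqrt hd.ne') (Real.sqrt_pos.2 hd).ne'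
  refine ((Real.hasDerivAt_arccos (abs_lt.1 hcos).1.ne' (abs_lt.1 hcos).2.ne).comp t
    hquot).congr_deriv ?_
  rw [hsin, Real.sqrt_div hS.le, coneAngleDeriv]
  have hD := Real.sqrt_pos.2 hd
  have hDsq := Real.sq_sqrt hd.le
  set D := √(‖v t‖ ^ 2 + s ^ 2)
  rw [← hDsq]
  field_simp

lemma coneAngleDeriv_smul {s : ℝ} (hs : 0 < s) {T : E} (hT : ‖T‖ = 1) (v : E) (c : ℝ) :
    coneAngleDeriv s T v (c • T) = -(coneSpeed s T v * c) := by
  have hS : 0 < ‖rejection T v‖ ^ 2 + s ^ 2 := by positivity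
  have hnum : ⟪T, c • T⟫ * (‖v‖ ^ 2 + s ^ 2) - ⟪T, v⟫ * ⟪v, c • T⟫ =
      c * √(‖rejection T v‖ ^ 2 + s ^ 2) ^ 2 := by
    rw [Real.sq_sqrt hS.le, norm_rejection_sq hT, real_inner_smul_right, real_inner_smul_right,
      real_inner_self_eq_norm_sq, hT, real_inner_comm v T]
    ring
  have := Real.sqrt_pos.2 hS
  rw [coneAngleDeriv, coneSpeed, hnum]
  field_simp

lemma norm_sub_eq_two_mul_sin_half_angle {T T' : E} (hT : ‖T‖ = 1) (hT' : ‖T'‖ = 1) :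
    ‖T' - T‖ = 2 * Real.sin (InnerProductGeometry.angle T' T / 2) := by
  set θ := InnerProductGeometry.angle T' T with hθ
  have hsin : 0 ≤ Real.sin (θ / 2) := Real.sin_nonneg_of_nonneg_of_le_pi
    (by linarith [InnerProductGeometry.angle_nonneg T' T])
    (by linarith [InnerProductGeometry.angle_nonneg T' T, InnerProductGeometry.angle_le_pi T' T])
  have hcosine : ‖T' - T‖ ^ 2 = 2 - 2 * Real.cos θ := by
    rw [norm_sub_sq_real, hT, hT', hθ, InnerProductGeometry.cos_angle, hT, hT']
    ring
  rw [show θ = 2 * (θ / 2) by ring, Real.cos_two_mul] at hcosine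
  refine (sq_eq_sq₀ (norm_nonneg _) (by positivity)).1 ?_
  linarith [Real.sin_sq_add_cos_sq (θ / 2)]

lemma exists_one_sub_mul_angle_le_norm_sub {η : ℝ} (hη : 0 < η) :
    ∃ δ > 0, ∀ T T' : E, ‖T‖ = 1 → ‖T'‖ = 1 → ‖T' - T‖ < δ →
      (1 - η) * InnerProductGeometry.angle T' T ≤ ‖T' - T‖ := by
  have hsinc : ∀ᶠ θ : ℝ in 𝓝 0, 1 - η ≤ Real.sinc (θ / 2) := by
    have : Filter.Tendsto (fun θ : ℝ => Real.sinc (θ / 2)) (𝓝 0) (𝓝 (Real.sinc (0 / 2))) :=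
      (Real.continuous_sinc.comp (continuous_id.div_const 2)).tendsto 0
    rw [zero_div, Real.sinc_zero] at this
    exact this.eventually_const_le (by linarith)
  obtain ⟨ρ, hρ, hsinc⟩ := Metric.eventually_nhds_iff.1 hsinc
  refine ⟨2 / Real.pi * ρ, by positivity, fun T T' hT hT' hclose => ?_⟩
  set θ := InnerProductGeometry.angle T' T
  have hθ : 0 ≤ θ := InnerProductGeometry.angle_nonneg _ _
  have hchord := norm_sub_eq_two_mul_sin_half_angle hT hT'
  have hjordan : 2 / Real.pi * θ ≤ ‖T' - T‖ := by
    have := Real.mul_le_sin (x := θ / 2) (by positivity)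
      (by linarith [InnerProductGeometry.angle_le_pi T' T])
    rw [hchord]
    linarith
  have hθρ : θ < ρ := lt_of_mul_lt_mul_left (hjordan.trans_lt hclose) (by positivity)
  rcases hθ.eq_or_lt with h0 | h0
  · rw [← h0, mul_zero]
    exact norm_nonneg _
  · have := hsinc (y := θ) (by rwa [Real.dist_0_eq_abs, abs_of_nonneg hθ])
    rw [Real.sinc_of_ne_zero (by positivity), le_div_iff₀ (by positivity)] at this
    rw [hchord]
    linarith

variable {γ : ℝ → E}

lemma continuous_coneSpeed_mul (hγ : ContDiff ℝ 1 γ) (h : ∀ t, deriv γ t ≠ 0) {s : ℝ}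
    (hs : 0 < s) (x : E) :
    Continuous fun t => coneSpeed s (unitTangent γ t) (γ t - x) * ‖deriv γ t‖ := by
  have hT := continuous_unitTangent hγ h
  have hd : Continuous (deriv γ) := hγ.continuous_deriv le_rfl
  have hc := hγ.continuous
  unfold coneSpeed
  exact (Continuous.div (by fun_prop) (by fun_prop) fun t => by positivity).mul hd.norm

lemma continuous_coneAngleDeriv (hγ : ContDiff ℝ 1 γ) (h : ∀ t, deriv γ t ≠ 0) {s : ℝ}
    (hs : 0 < s) (x : E) : Continuous fun z : ℝ × ℝ =>
      coneAngleDeriv s (unitTangent γ z.1) (γ z.2 - x) (deriv γ z.2) := by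
  have hT := continuous_unitTangent hγ h
  have : Continuous (deriv γ) := hγ.continuous_deriv le_rfl
  have hc := hγ.continuous
  unfold coneAngleDeriv
  exact Continuous.div (by fun_prop) (by fun_prop) fun z => by positivity

lemma integral_coneSpeed_le_coneAngle_sub (hγ : ContDiff ℝ 1 γ) (h : ∀ t, deriv γ t ≠ 0) {s : ℝ}
    (hs : 0 < s) (x : E) {a b η : ℝ} (hab : a ≤ b)
    (hη : ∀ t ∈ Icc a b, coneAngleDeriv s (unitTangent γ a) (γ t - x) (deriv γ t) ≤
      coneAngleDeriv s (unitTangent γ t) (γ t - x) (deriv γ t) + η) :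
    ∫ t in a..b, coneSpeed s (unitTangent γ t) (γ t - x) * ‖deriv γ t‖ ≤
      coneAngle s (unitTangent γ a) (γ a - x) - coneAngle s (unitTangent γ b) (γ b - x) +
        InnerProductGeometry.angle (unitTangent γ b) (unitTangent γ a) + η * (b - a) := by
  have hK := continuous_coneSpeed_mul hγ h hs x
  have hk : Continuous fun t => coneAngleDeriv s (unitTangent γ a) (γ t - x) (deriv γ t) :=
    (continuous_coneAngleDeriv hγ h hs x).comp (by fun_prop : Continuous fun t : ℝ => (a, t))
  have hftc : ∫ t in a..b, coneAngleDeriv s (unitTangent γ a) (γ t - x) (deriv γ t) =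
      coneAngle s (unitTangent γ a) (γ b - x) - coneAngle s (unitTangent γ a) (γ a - x) :=
    intervalIntegral.integral_eq_sub_of_hasDerivAt
      (fun t _ => hasDerivAt_coneAngle hs (norm_unitTangent (h a))
        ((hγ.differentiable one_ne_zero t).hasDerivAt.sub_const x))
      (hk.intervalIntegrable _ _)
  have hmono : ∫ t in a..b, coneAngleDeriv s (unitTangent γ a) (γ t - x) (deriv γ t) ≤
      ∫ t in a..b, (η - coneSpeed s (unitTangent γ t) (γ t - x) * ‖deriv γ t‖) := by
    refine intervalIntegral.integral_mono_on hab (hk.intervalIntegrable _ _)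
      ((continuous_const.sub hK).intervalIntegrable _ _) fun t ht => ?_
    have hdiag := coneAngleDeriv_smul hs (norm_unitTangent (h t)) (γ t - x) ‖deriv γ t‖
    rw [norm_deriv_smul_unitTangent] at hdiag
    linarith [hη t ht]
  rw [intervalIntegral.integral_sub (continuous_const.intervalIntegrable _ _)
    (hK.intervalIntegrable _ _), intervalIntegral.integral_const, smul_eq_mul, hftc] at hmono
  linarith [coneAngle_le_add_angle s (unitTangent γ a) (unitTangent γ b) (γ b - x)]

lemma exists_one_sub_mul_integral_coneSpeed_le (hγ : ContDiff ℝ 1 γ) (h : ∀ t, deriv γ t ≠ 0)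
    {s : ℝ} (hs : 0 < s) (x : E) {η : ℝ} (hη : 0 < η) (hη1 : η < 1) :
    ∃ δ > 0, ∀ a ∈ Icc (0 : ℝ) 1, ∀ b ∈ Icc (0 : ℝ) 1, a ≤ b → b - a < δ →
      (1 - η) * ∫ t in a..b, coneSpeed s (unitTangent γ t) (γ t - x) * ‖deriv γ t‖ ≤
        (1 - η) * (coneAngle s (unitTangent γ a) (γ a - x) -
          coneAngle s (unitTangent γ b) (γ b - x) + η * (b - a)) +
        ‖unitTangent γ b - unitTangent γ a‖ := by
  obtain ⟨δ₁, hδ₁, hangle⟩ := exists_one_sub_mul_angle_le_norm_sub (E := E) hη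
  obtain ⟨δ₂, hδ₂, hT⟩ := Metric.uniformContinuousOn_iff.1
    ((isCompact_Icc (a := (0 : ℝ)) (b := 1)).uniformContinuousOn_of_continuous
      (continuous_unitTangent hγ h).continuousOn) δ₁ hδ₁
  obtain ⟨δ₃, hδ₃, hk⟩ := Metric.uniformContinuousOn_iff.1
    (((isCompact_Icc (a := (0 : ℝ)) (b := 1)).prod
      (isCompact_Icc (a := (0 : ℝ)) (b := 1))).uniformContinuousOn_of_continuous
        (continuous_coneAngleDeriv hγ h hs x).continuousOn) η hη
  refine ⟨min δ₂ δ₃, lt_min hδ₂ hδ₃, fun a ha b hb hab hlt => ?_⟩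
  have hosc := integral_coneSpeed_le_coneAngle_sub hγ h hs x (η := η) hab fun t ht => by
    have ht1 : t ∈ Icc (0 : ℝ) 1 := ⟨ha.1.trans ht.1, ht.2.trans hb.2⟩
    have hdist : dist ((a, t) : ℝ × ℝ) (t, t) < δ₃ := by
      rw [Prod.dist_eq, dist_self, max_eq_left dist_nonneg, dist_comm, Real.dist_eq,
        abs_of_nonneg (sub_nonneg.2 ht.1)]
      linarith [ht.2, min_le_right δ₂ δ₃]
    linarith [(abs_lt.1 (hk (a, t) ⟨ha, ht1⟩ (t, t) ⟨ht1, ht1⟩ hdist)).2]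
  have hclose : ‖unitTangent γ b - unitTangent γ a‖ < δ₁ := by
    rw [← dist_eq_norm]
    refine hT b hb a ha ?_
    rw [Real.dist_eq, abs_of_nonneg (sub_nonneg.2 hab)]
    exact hlt.trans_le (min_le_left _ _)
  have hscaled := mul_le_mul_of_nonneg_left hosc (sub_nonneg.2 hη1.le)
  linarith [hangle _ _ (norm_unitTangent (h a)) (norm_unitTangent (h b)) hclose]

lemma sum_norm_sub_le_of_eVariationOn_le {F : Type*} [SeminormedAddCommGroup F] {f : ℝ → F}
    {V : NNReal} (hV : eVariationOn f (Icc 0 1) ≤ V) (N : ℕ) :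
    ∑ i ∈ Finset.range N, ‖f ((i + 1 : ℕ) / N) - f (i / N)‖ ≤ V := by
  have hsum := (eVariationOn.sum_le_of_monotoneOn_Iic (f := f) (s := Icc (0 : ℝ) 1) (n := N)
    (u := fun i : ℕ => (i : ℝ) / N) (fun i _ j _ hij => by dsimp only; gcongr)
    (fun i hi => ⟨by positivity, div_le_one_of_le₀ (by exact_mod_cast hi) (by positivity)⟩)).trans
      hV
  simp_rw [edist_eq_enorm_sub, ← ofReal_norm] at hsum
  rwa [← ENNReal.ofReal_sum_of_nonneg fun i _ => norm_nonneg _, ENNReal.ofReal_le_coe] at hsum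

lemma one_sub_mul_integral_coneSpeed_sub_le (hγ : ContDiff ℝ 1 γ) (h : ∀ t, deriv γ t ≠ 0)
    (hper : Function.Periodic γ 1) {V : NNReal}
    (hV : eVariationOn (unitTangent γ) (Icc 0 1) ≤ V) {s : ℝ} (hs : 0 < s) (x : E) {η : ℝ}
    (hη : 0 < η) (hη1 : η < 1) :
    (1 - η) * ((∫ t in (0 : ℝ)..1, coneSpeed s (unitTangent γ t) (γ t - x) * ‖deriv γ t‖) - η) ≤
      V := by
  obtain ⟨δ, hδ, hshort⟩ := exists_one_sub_mul_integral_coneSpeed_le hγ h hs x hη hη1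
  obtain ⟨N, hN⟩ := exists_nat_one_div_lt hδ
  rw [← Nat.cast_succ] at hN
  set M := N.succ
  have hM : (0 : ℝ) < M := by positivity
  have hstep (i : ℕ) : ((i + 1 : ℕ) : ℝ) / M - i / M = 1 / M := by push_cast; ring
  have hmem (i : ℕ) (hi : i ≤ M) : (i : ℝ) / M ∈ Icc (0 : ℝ) 1 :=
    ⟨by positivity, (div_le_one hM).2 (by exact_mod_cast hi)⟩
  have hsum := Finset.sum_le_sum fun i (hi : i ∈ Finset.range M) =>
    hshort _ (hmem i (Finset.mem_range.1 hi).le) _ (hmem (i + 1) (Finset.mem_range.1 hi))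
      (by rw [← sub_nonneg, hstep]; positivity) ((hstep i).trans_lt hN)
  have htele := Finset.sum_range_sub' (fun i : ℕ =>
    coneAngle s (unitTangent γ (i / M)) (γ (i / M) - x)) M
  have hclosed : coneAngle s (unitTangent γ 1) (γ 1 - x) =
      coneAngle s (unitTangent γ 0) (γ 0 - x) := by
    rw [← zero_add (1 : ℝ), hper, periodic_unitTangent hper]
  simp only [Nat.cast_zero, zero_div, div_self hM.ne', hclosed, sub_self] at htele
  rw [← Finset.mul_sum, Finset.sum_add_distrib, ← Finset.mul_sum, Finset.sum_add_distrib, htele,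
    intervalIntegral.sum_integral_adjacent_intervals (a := fun i : ℕ => (i : ℝ) / M)
      (fun i _ => (continuous_coneSpeed_mul hγ h hs x).intervalIntegrable _ _)] at hsum
  simp only [hstep, Nat.cast_zero, zero_div, div_self hM.ne', Finset.sum_const, Finset.card_range,
    nsmul_eq_mul, mul_one_div, mul_div_cancel₀ _ hM.ne', zero_add] at hsum
  linarith [sum_norm_sub_le_of_eVariationOn_le hV M]

-- The angle `coneAngle` from the tangent to the ray decreases at the speed of the projection while
-- the tangent is frozen, and jumps by at most the turning of the tangent; over a period it returns.
theorem integral_coneSpeed_le (hγ : ContDiff ℝ 1 γ) (h : ∀ t, deriv γ t ≠ 0)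
    (hper : Function.Periodic γ 1) {V : NNReal}
    (hV : eVariationOn (unitTangent γ) (Icc 0 1) ≤ V) {s : ℝ} (hs : 0 < s) (x : E) :
    ∫ t in (0 : ℝ)..1, coneSpeed s (unitTangent γ t) (γ t - x) * ‖deriv γ t‖ ≤ V := by
  set L := ∫ t in (0 : ℝ)..1, coneSpeed s (unitTangent γ t) (γ t - x) * ‖deriv γ t‖
  have hlim : Filter.Tendsto (fun η : ℝ => (1 - η) * (L - η)) (𝓝[>] 0) (𝓝 ((1 - 0) * (L - 0))) :=
    tendsto_nhdsWithin_of_tendsto_nhds (Continuous.tendsto (by fun_prop) 0)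
  rw [sub_zero, one_mul, sub_zero] at hlim
  refine le_of_tendsto hlim ?_
  filter_upwards [Ioo_mem_nhdsGT one_pos] with η hη
  exact one_sub_mul_integral_coneSpeed_sub_le hγ h hper hV hs x hη.1 hη.2

end RadialProjection

section Rescaling

variable {E : Type*} [NormedAddCommGroup E] [NormedSpace ℝ E] [MeasurableSpace E] [BorelSpace E]
  [FiniteDimensional ℝ E] (μ : Measure E) [μ.IsAddHaarMeasure]

lemma lintegral_eq_mul_lintegral_rescale (f : E → ℝ≥0∞) (y₀ : E) {c : ℝ} (hc : 0 < c) :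
    ∫⁻ y, f y ∂μ = ENNReal.ofReal (c ^ Module.finrank ℝ E) * ∫⁻ w, f (y₀ + c • w) ∂μ := by
  have hmap := (measurableEmbedding_const_smul₀ (α := E) hc.ne').lintegral_map (μ := μ)
    (fun y => f (y₀ + y))
  rw [Measure.map_addHaar_smul μ hc.ne', lintegral_smul_measure, lintegral_add_left_eq_self,
    abs_of_pos (by positivity)] at hmap
  rw [← hmap, smul_eq_mul, ← mul_assoc, ← ENNReal.ofReal_mul (by positivity),
    mul_inv_cancel₀ (by positivity), ENNReal.ofReal_one, one_mul]

lemma lintegral_le_liminf_of_rescaled (y₀ : E) {f : ℝ → E → ℝ≥0∞} (hf : ∀ s, Measurable (f s))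
    {c : ℝ → ℝ} (hc : ∀ s, 0 < s → 0 < c s) {G : E → ℝ≥0∞}
    (hG : ∀ᵐ w ∂μ, G w ≤ Filter.liminf (fun s =>
      ENNReal.ofReal (c s ^ Module.finrank ℝ E) * f s (y₀ + c s • w)) (𝓝[>] (0 : ℝ))) :
    ∫⁻ w, G w ∂μ ≤ Filter.liminf (fun s => ∫⁻ y, f s y ∂μ) (𝓝[>] (0 : ℝ)) := by
  have hmeas (s : ℝ) : Measurable fun w => f s (y₀ + c s • w) := (hf s).comp (by fun_prop)
  refine (lintegral_mono_ae hG).trans ((lintegral_liminf_le fun s => (hmeas s).const_mul _).trans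
    (Filter.liminf_le_liminf ?_))
  filter_upwards [self_mem_nhdsWithin] with s hs
  rw [lintegral_eq_mul_lintegral_rescale μ (f s) y₀ (hc s hs), lintegral_const_mul _ (hmeas s)]

end Rescaling

section CurveLength

variable {E : Type*} [NormedAddCommGroup E] [NormedSpace ℝ E] [MeasurableSpace E] [BorelSpace E]
  {γ : ℝ → E} {S : Set ℝ}

lemma hausdorffMeasure_image_le_of_norm_deriv_sub_le (hγ : Differentiable ℝ γ) {J : Set ℝ}
    (hJ : Convex ℝ J) (hSJ : S ⊆ J) (hS : MeasurableSet S) {v : E} {η : NNReal}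
    (hv : ∀ t ∈ J, ‖deriv γ t - v‖ ≤ η) :
    μH[1] (γ '' S) ≤ ∫⁻ t in S, (‖deriv γ t‖ₑ + 2 * η) := by
  have hlip : LipschitzOnWith (‖v‖₊ + η) γ J := by
    refine hJ.lipschitzOnWith_of_nnnorm_deriv_le (fun t _ => hγ t) fun t ht => ?_
    rw [← NNReal.coe_le_coe, NNReal.coe_add, coe_nnnorm, coe_nnnorm]
    linarith [norm_sub_norm_le (deriv γ t) v, hv t ht]
  have himage := (hlip.mono hSJ).hausdorffMeasure_image_le (d := 1) zero_le_one
  rw [hausdorffMeasure_real, ENNReal.rpow_one, ← setLIntegral_const] at himage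
  refine himage.trans (setLIntegral_mono' hS fun t ht => ?_)
  suffices h : ‖v‖₊ + η ≤ ‖deriv γ t‖₊ + 2 * η by
    rw [enorm_eq_nnnorm]
    exact_mod_cast h
  rw [← NNReal.coe_le_coe]
  push_cast
  linarith [norm_sub_norm_le v (deriv γ t), norm_sub_rev v (deriv γ t), hv t (hSJ ht)]

lemma hausdorffMeasure_image_le_lintegral_add (hγ : Differentiable ℝ γ)
    (hγ' : UniformContinuous (deriv γ)) (hS : MeasurableSet S) {η : NNReal} (hη : 0 < η) :
    μH[1] (γ '' S) ≤ ∫⁻ t in S, (‖deriv γ t‖ₑ + 2 * η) := by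
  obtain ⟨δ, hδ, hosc⟩ := Metric.uniformContinuous_iff.1 hγ' η hη
  let piece (k : ℤ) : Set ℝ := S ∩ (fun t => ⌊t / δ⌋) ⁻¹' {k}
  have hpiece (k : ℤ) : MeasurableSet (piece k) :=
    hS.inter ((Int.measurable_floor.comp (measurable_id.div_const δ)) (measurableSet_singleton k))
  have hcover : S = ⋃ k, piece k := by
    ext t; simp only [piece, mem_iUnion, mem_inter_iff, mem_preimage, mem_singleton_iff,
      exists_and_left, exists_eq', and_true]
  have hdisj : Pairwise (Function.onFun Disjoint piece) := fun j k hjk =>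
    disjoint_left.2 fun t hj hk => hjk (hj.2.symm.trans hk.2)
  have hsub (k : ℤ) : piece k ⊆ Ico (k * δ) ((k + 1) * δ) := by
    rintro t ⟨-, ht⟩
    obtain ⟨hl, hr⟩ := Int.floor_eq_iff.1 ht
    exact ⟨(le_div_iff₀ hδ).1 hl, (div_lt_iff₀ hδ).1 hr⟩
  rw [hcover, image_iUnion, lintegral_iUnion hpiece hdisj]
  refine (measure_iUnion_le _).trans (ENNReal.tsum_le_tsum fun k => ?_)
  refine hausdorffMeasure_image_le_of_norm_deriv_sub_le hγ (convex_Ico _ _) (hsub k) (hpiece k)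
    (v := deriv γ (k * δ)) fun t ht => ?_
  rw [← dist_eq_norm]
  refine (hosc ?_).le
  rw [Real.dist_eq, abs_of_nonneg (sub_nonneg.2 ht.1)]
  linarith [ht.2]

lemma hausdorffMeasure_image_le_lintegral_deriv (hγ : Differentiable ℝ γ)
    (hγ' : UniformContinuous (deriv γ)) (hS : MeasurableSet S) (hS' : volume S ≠ ⊤) :
    μH[1] (γ '' S) ≤ ∫⁻ t in S, ‖deriv γ t‖ₑ := by
  have hlim : Filter.Tendsto (fun η : NNReal => (∫⁻ t in S, ‖deriv γ t‖ₑ) + 2 * η * volume S)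
      (𝓝[>] 0) (𝓝 ((∫⁻ t in S, ‖deriv γ t‖ₑ) + 2 * (0 : NNReal) * volume S)) := by
    refine tendsto_const_nhds.add (ENNReal.Tendsto.mul_const (ENNReal.Tendsto.const_mul ?_ ?_) ?_)
    · exact (ENNReal.continuous_coe.tendsto 0).mono_left nhdsWithin_le_nhds
    · exact Or.inr ENNReal.ofNat_ne_top
    · exact Or.inr hS'
  rw [ENNReal.coe_zero, mul_zero, zero_mul, add_zero] at hlim
  refine ge_of_tendsto hlim ?_
  filter_upwards [self_mem_nhdsWithin] with η hη
  rw [← setLIntegral_const, ← lintegral_add_right _ measurable_const]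
  exact hausdorffMeasure_image_le_lintegral_add hγ hγ' hS hη

lemma lintegral_range_le_lintegral_deriv (hγ : ContDiff ℝ 1 γ) (hper : Function.Periodic γ 1)
    (g : E → ℝ≥0∞) :
    ∫⁻ y in range γ, g y ∂μH[1] ≤ ∫⁻ t in Ico (0 : ℝ) 1, ‖deriv γ t‖ₑ * g (γ t) := by
  have hγm : Measurable γ := hγ.continuous.measurable
  have hdc : Continuous (deriv γ) := hγ.continuous_deriv_one
  set ρ : Measure ℝ := (volume.restrict (Ico (0 : ℝ) 1)).withDensity fun t => ‖deriv γ t‖ₑ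
  have hle : (μH[1] : Measure E).restrict (range γ) ≤ ρ.map γ := by
    refine Measure.le_iff.2 fun A hA => ?_
    have hsub : A ∩ range γ ⊆ γ '' (γ ⁻¹' A ∩ Ico 0 1) := by
      rintro _ ⟨hyA, τ, rfl⟩
      obtain ⟨t, ht, hτ⟩ := hper.exists_mem_Ico₀ one_pos τ
      rw [hτ] at hyA ⊢
      exact ⟨t, ⟨hyA, ht⟩, rfl⟩
    rw [Measure.restrict_apply hA, Measure.map_apply hγm hA, withDensity_apply _ (hγm hA),
      Measure.restrict_restrict (hγm hA)]
    refine (measure_mono hsub).trans (hausdorffMeasure_image_le_lintegral_deriv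
      (hγ.differentiable one_ne_zero) ?_ ((hγm hA).inter measurableSet_Ico)
      (measure_ne_top_of_subset inter_subset_right measure_Ico_lt_top.ne))
    exact uniformContinuous_of_periodic hdc one_pos (periodic_deriv hper)
  exact (lintegral_mono' hle le_rfl).trans ((lintegral_map_le g γ).trans
    (lintegral_withDensity_le_lintegral_mul _ hdc.measurable.enorm _))

end CurveLength

section ClosedCurve

variable {n : ℕ} {γ : ℝ → Euc n}

lemma IsC1ClosedCurve.hasDerivAt (hγ : IsC1ClosedCurve γ) (t : ℝ) :
    HasDerivAt γ (deriv γ t) t :=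
  (hγ.contDiff.differentiable one_ne_zero t).hasDerivAt

lemma IsC1ClosedCurve.eq_of_abs_sub_lt_one (hγ : IsC1ClosedCurve γ) {t₀ t : ℝ} (h : |t - t₀| < 1)
    (he : γ t = γ t₀) : t = t₀ := by
  rw [abs_lt] at h
  have hinj (a : ℝ) : InjOn γ (Ico a (a + 1)) := fun b hb c hc hbc => by
    have hfract : Int.fract b = Int.fract c := hγ.injOn ⟨Int.fract_nonneg b, Int.fract_lt_one b⟩
      ⟨Int.fract_nonneg c, Int.fract_lt_one c⟩ (by
        have hp (x : ℝ) : γ (Int.fract x) = γ x := by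
          simpa only [mul_one, Int.fract] using hγ.periodic.sub_int_mul_eq (x := x) ⌊x⌋
        rw [hp, hp, hbc])
    obtain ⟨k, hk⟩ := Int.fract_eq_fract.1 hfract
    have hk0 : k = 0 := Int.abs_lt_one_iff.1 (by
      rw [← Int.cast_lt (R := ℝ), Int.cast_abs, ← hk, Int.cast_one, abs_lt]
      constructor <;> linarith [hb.1, hb.2, hc.1, hc.2])
    rw [hk0, Int.cast_zero] at hk
    linarith
  rcases le_total t t₀ with hle | hle
  · exact hinj t ⟨le_rfl, by linarith⟩ ⟨hle, by linarith⟩ he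
  · exact hinj t₀ ⟨hle, by linarith⟩ ⟨le_rfl, by linarith⟩ he

lemma IsC1ClosedCurve.exists_forall_le_norm_sub (hγ : IsC1ClosedCurve γ) (t₀ : ℝ) {ρ : ℝ}
    (hρ : 0 < ρ) :
    ∃ r > 0, ∀ t ∈ Icc (t₀ - 1 / 2) (t₀ + 1 / 2), ρ ≤ |t - t₀| → r ≤ ‖γ t - γ t₀‖ := by
  set K : Set ℝ := Icc (t₀ - 1 / 2) (t₀ + 1 / 2) ∩ {t | ρ ≤ |t - t₀|}
  have hK : IsCompact K := isCompact_Icc.inter_right (isClosed_le continuous_const (by fun_prop))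
  rcases K.eq_empty_or_nonempty with hempty | hne
  · exact ⟨1, one_pos, fun t ht htρ => ((hempty ▸ ⟨ht, htρ⟩ : t ∈ (∅ : Set ℝ))).elim⟩
  obtain ⟨t₁, ⟨ht₁, ht₁ρ⟩, hmin⟩ := hK.exists_isMinOn hne
    (hγ.contDiff.continuous.sub continuous_const).norm.continuousOn
  refine ⟨‖γ t₁ - γ t₀‖, norm_pos_iff.2 (sub_ne_zero.2 fun he => ?_),
    fun t ht htρ => hmin ⟨ht, htρ⟩⟩
  have ht₁₀ := hγ.eq_of_abs_sub_lt_one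
    (abs_lt.2 ⟨by linarith [ht₁.1], by linarith [ht₁.2]⟩) he
  rw [mem_ofPred_eq, ht₁₀, sub_self, abs_zero] at ht₁ρ
  exact hρ.not_ge ht₁ρ

lemma IsC1ClosedCurve.exists_forall_norm_sub_lt (hγ : IsC1ClosedCurve γ) (t₀ : ℝ) {ρ : ℝ}
    (hρ : 0 < ρ) :
    ∃ r > 0, ∀ y ∈ range γ, ‖y - γ t₀‖ < r → ∃ t, |t - t₀| < ρ ∧ γ t = y := by
  obtain ⟨r, hr, hfar⟩ := hγ.exists_forall_le_norm_sub t₀ hρ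
  refine ⟨r, hr, ?_⟩
  rintro _ ⟨τ, rfl⟩ hτ
  obtain ⟨t, ht, hτt⟩ := hγ.periodic.exists_mem_Ico one_pos τ (t₀ - 1 / 2)
  refine ⟨t, not_le.1 fun htρ => ?_, hτt.symm⟩
  rw [hτt] at hτ
  exact hτ.not_ge (hfar t ⟨ht.1, by linarith [ht.2]⟩ htρ)

-- The inverse of `γ` is continuous, so nearness in the trace is nearness in the parameter.
lemma IsC1ClosedCurve.rejection_sub_isLittleO (hγ : IsC1ClosedCurve γ) (t₀ : ℝ) :
    (fun y => rejection (unitTangent γ t₀) (y - γ t₀)) =o[𝓝[range γ] γ t₀]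
      fun y => y - γ t₀ := by
  set T := unitTangent γ t₀
  set v := deriv γ t₀
  have hv : 0 < ‖v‖ := norm_pos_iff.2 (hγ.deriv_ne_zero t₀)
  have hlittle := hasDerivAt_iff_isLittleO.1 (hγ.hasDerivAt t₀)
  refine Asymptotics.isLittleO_iff.2 fun η hη => ?_
  obtain ⟨ρ, hρ, hrem⟩ := Metric.eventually_nhds_iff.1 <|
    (hlittle.def (half_pos hv)).and (hlittle.def (by positivity : 0 < η * (‖v‖ / 2)))
  obtain ⟨r, hr, hnear⟩ := hγ.exists_forall_norm_sub_lt t₀ hρ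
  filter_upwards [self_mem_nhdsWithin, mem_nhdsWithin_of_mem_nhds (Metric.ball_mem_nhds _ hr)]
    with y hy hyr
  obtain ⟨t, ht, rfl⟩ := hnear y hy (by rwa [← dist_eq_norm])
  set w := γ t - γ t₀ - (t - t₀) • v
  obtain ⟨hw, hw'⟩ : ‖w‖ ≤ ‖v‖ / 2 * |t - t₀| ∧ ‖w‖ ≤ η * (‖v‖ / 2) * |t - t₀| := hrem ht
  have hsplit : γ t - γ t₀ = (t - t₀) • v + w := (add_sub_cancel _ _).symm
  have hchord : ‖v‖ / 2 * |t - t₀| ≤ ‖γ t - γ t₀‖ := by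
    have := norm_sub_le_norm_add ((t - t₀) • v) w
    rw [← hsplit, norm_smul, Real.norm_eq_abs] at this
    linarith
  calc ‖rejection T (γ t - γ t₀)‖ = ‖rejection T w‖ := by
        rw [hsplit, rejection_add, rejection_smul,
          rejection_unitTangent_deriv (hγ.deriv_ne_zero t₀), smul_zero, zero_add]
    _ ≤ ‖w‖ := norm_rejection_le (norm_unitTangent (hγ.deriv_ne_zero t₀)) w
    _ ≤ η * (‖v‖ / 2 * |t - t₀|) := by rwa [← mul_assoc]
    _ ≤ η * ‖γ t - γ t₀‖ := by gcongr

lemma IsC1ClosedCurve.rejection_eq_zero_of_hasDerivAt (hγ : IsC1ClosedCurve γ) {c : ℝ → Euc n}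
    {b : Euc n} {τ t₀ : ℝ} (hc : HasDerivAt c b τ) (hmem : ∀ᶠ t in 𝓝 τ, c t ∈ range γ)
    (h0 : c τ = γ t₀) : rejection (unitTangent γ t₀) b = 0 := by
  set T := unitTangent γ t₀
  have hnear : Filter.Tendsto c (𝓝 τ) (𝓝[range γ] γ t₀) :=
    tendsto_nhdsWithin_iff.2 ⟨h0 ▸ hc.continuousAt, hmem⟩
  have hzero : HasDerivAt (fun t => rejection T (c t - γ t₀)) 0 τ := by
    have hsmall := (hγ.rejection_sub_isLittleO t₀).comp_tendsto hnear
    rw [hasDerivAt_iff_isLittleO]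
    simpa only [Function.comp_def, h0, sub_self, rejection, inner_zero_right, zero_smul, sub_zero,
      smul_zero] using hsmall.trans_isBigO (h0 ▸ hc.differentiableAt.isBigO_sub)
  have hrej : HasDerivAt (fun t => rejection T (c t - γ t₀)) (rejection T b) τ := by
    have hsub := hc.sub_const (γ t₀)
    have hinner := (hasDerivAt_const τ T).inner ℝ hsub
    rw [inner_zero_left, add_zero] at hinner
    exact hsub.sub (hinner.smul_const T)
  exact hrej.unique hzero

end ClosedCurve

section BoundaryDefect

variable {E : Type*} [NormedAddCommGroup E] [InnerProductSpace ℝ E] {γ : ℝ → E}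

/-- The normalised normal component `|v^⊥| / (|v|² + s²)` of `v`, where `⊥` denotes the part
orthogonal to `T`. It bounds the flux of the radial field through a boundary with tangent `T`. -/
def fluxSpeed (s : ℝ) (T v : E) : ℝ := ‖rejection T v‖ / (‖v‖ ^ 2 + s ^ 2)

lemma fluxSpeed_nonneg (s : ℝ) (T v : E) : 0 ≤ fluxSpeed s T v := by
  unfold fluxSpeed
  positivity

lemma fluxSpeed_le_coneSpeed (s : ℝ) (T v : E) : fluxSpeed s T v ≤ coneSpeed s T v :=
  div_le_div_of_nonneg_right (Real.le_sqrt_of_sq_le (le_add_of_nonneg_right (sq_nonneg s)))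
    (by positivity)

lemma continuous_fluxSpeed_mul (hγ : ContDiff ℝ 1 γ) (h : ∀ t, deriv γ t ≠ 0) {s : ℝ}
    (hs : 0 < s) (x : E) :
    Continuous fun t => fluxSpeed s (unitTangent γ t) (γ t - x) * ‖deriv γ t‖ := by
  have hT := continuous_unitTangent hγ h
  have hd : Continuous (deriv γ) := hγ.continuous_deriv_one
  have hc := hγ.continuous
  unfold fluxSpeed
  exact (Continuous.div (by fun_prop) (by fun_prop) fun t => by positivity).mul hd.norm

/-- The excess of the length density of the radial projection of `γ` over the flux density. As
`s → 0` it concentrates at the parameters `t` with `γ t = x`. -/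
def coneDefect (γ : ℝ → E) (s : ℝ) (x : E) (t : ℝ) : ℝ :=
  coneSpeed s (unitTangent γ t) (γ t - x) * ‖deriv γ t‖ -
    fluxSpeed s (unitTangent γ t) (γ t - x) * ‖deriv γ t‖

lemma coneDefect_nonneg (γ : ℝ → E) (s : ℝ) (x : E) (t : ℝ) : 0 ≤ coneDefect γ s x t :=
  sub_nonneg.2 (mul_le_mul_of_nonneg_right (fluxSpeed_le_coneSpeed s _ _) (norm_nonneg _))

lemma integral_coneDefect_nonneg (γ : ℝ → E) (s : ℝ) (x : E) :
    0 ≤ ∫ t in (0 : ℝ)..1, coneDefect γ s x t :=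
  intervalIntegral.integral_nonneg zero_le_one fun t _ => coneDefect_nonneg γ s x t

lemma periodic_coneDefect {c : ℝ} (h : Function.Periodic γ c) (s : ℝ) (x : E) :
    Function.Periodic (coneDefect γ s x) c := fun t => by
  simp only [coneDefect, h t, periodic_unitTangent h t, periodic_deriv h t]

lemma continuous_coneDefect (hγ : ContDiff ℝ 1 γ) (h : ∀ t, deriv γ t ≠ 0) {s : ℝ} (hs : 0 < s)
    (x : E) : Continuous (coneDefect γ s x) :=
  (continuous_coneSpeed_mul hγ h hs x).sub (continuous_fluxSpeed_mul hγ h hs x)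

lemma integral_fluxSpeed_le (hγ : ContDiff ℝ 1 γ) (h : ∀ t, deriv γ t ≠ 0)
    (hper : Function.Periodic γ 1) {V : NNReal}
    (hV : eVariationOn (unitTangent γ) (Icc 0 1) ≤ V) {s : ℝ} (hs : 0 < s) (x : E) :
    ∫ t in (0 : ℝ)..1, fluxSpeed s (unitTangent γ t) (γ t - x) * ‖deriv γ t‖ ≤
      V - ∫ t in (0 : ℝ)..1, coneDefect γ s x t := by
  have hsplit := intervalIntegral.integral_sub (μ := volume)
    ((continuous_coneSpeed_mul hγ h hs x).intervalIntegrable 0 1)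
    ((continuous_fluxSpeed_mul hγ h hs x).intervalIntegrable 0 1)
  unfold coneDefect
  linarith [integral_coneSpeed_le hγ h hper hV hs x]

lemma coneSpeed_smul {s : ℝ} (hs : 0 < s) (T q : E) :
    s * coneSpeed s T (s • q) = coneSpeed 1 T q := by
  have hroot : √(‖s • rejection T q‖ ^ 2 + s ^ 2) = s * √(‖rejection T q‖ ^ 2 + 1 ^ 2) := by
    rw [norm_smul, Real.norm_of_nonneg hs.le, ← Real.sqrt_sq hs.le, ← Real.sqrt_mul (sq_nonneg _),
      Real.sqrt_sq hs.le]
    congr 1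
    ring
  have : 0 < ‖q‖ ^ 2 + 1 := by positivity
  rw [coneSpeed, coneSpeed, rejection_smul, hroot, norm_smul, Real.norm_of_nonneg hs.le]
  field_simp

lemma fluxSpeed_smul {s : ℝ} (hs : 0 < s) (T q : E) :
    s * fluxSpeed s T (s • q) = fluxSpeed 1 T q := by
  have : 0 < ‖q‖ ^ 2 + 1 := by positivity
  rw [fluxSpeed, fluxSpeed, rejection_smul, norm_smul, norm_smul, Real.norm_of_nonneg hs.le]
  field_simp

lemma tendsto_add_mul_nhdsGT (t₀ τ : ℝ) :
    Filter.Tendsto (fun s : ℝ => t₀ + s * τ) (𝓝[>] 0) (𝓝 t₀) := by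
  have hcont : Continuous fun s : ℝ => t₀ + s * τ := by fun_prop
  simpa only [zero_mul, add_zero] using (hcont.tendsto 0).mono_left nhdsWithin_le_nhds

lemma tendsto_inv_smul_sub (hγ : Differentiable ℝ γ) (t₀ τ : ℝ) :
    Filter.Tendsto (fun s : ℝ => s⁻¹ • (γ (t₀ + s * τ) - γ t₀)) (𝓝[>] 0)
      (𝓝 (τ • deriv γ t₀)) := by
  have hline : HasDerivAt (fun s : ℝ => t₀ + s * τ) τ 0 := by
    simpa only [id_eq, one_mul] using ((hasDerivAt_id (0 : ℝ)).mul_const τ).const_add t₀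
  have hderiv : HasDerivAt (fun s : ℝ => γ (t₀ + s * τ)) (τ • deriv γ t₀) 0 := by
    refine HasDerivAt.scomp (0 : ℝ) ?_ hline
    simpa only [zero_mul, add_zero] using (hγ t₀).hasDerivAt
  have hslope := hasDerivAt_iff_tendsto_slope_zero.1 hderiv
  simp only [zero_add, zero_mul, add_zero] at hslope
  exact hslope.mono_left (nhdsWithin_mono _ fun s hs => ne_of_gt hs)

lemma tendsto_mul_coneDefect (hγ : ContDiff ℝ 1 γ) (h : ∀ t, deriv γ t ≠ 0) (t₀ τ : ℝ) :
    Filter.Tendsto (fun s => s * coneDefect γ s (γ t₀) (t₀ + s * τ)) (𝓝[>] 0)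
      (𝓝 (‖deriv γ t₀‖ / ((τ * ‖deriv γ t₀‖) ^ 2 + 1))) := by
  have hline := tendsto_add_mul_nhdsGT t₀ τ
  have hT := ((continuous_unitTangent hγ h).tendsto t₀).comp hline
  have hd := ((hγ.continuous_deriv_one).tendsto t₀).comp hline
  have hq := tendsto_inv_smul_sub (hγ.differentiable one_ne_zero) t₀ τ
  have hcont : Continuous fun z : E × E × E =>
      (coneSpeed 1 z.1 z.2.1 - fluxSpeed 1 z.1 z.2.1) * ‖z.2.2‖ := by
    unfold coneSpeed fluxSpeed
    refine Continuous.mul (Continuous.sub ?_ ?_) (by fun_prop) <;>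
      exact Continuous.div (by fun_prop) (by fun_prop) fun z => by positivity
  have hlim := (hcont.tendsto _).comp (hT.prodMk_nhds (hq.prodMk_nhds hd))
  have hvalue : (coneSpeed 1 (unitTangent γ t₀) (τ • deriv γ t₀) -
      fluxSpeed 1 (unitTangent γ t₀) (τ • deriv γ t₀)) * ‖deriv γ t₀‖ =
      ‖deriv γ t₀‖ / ((τ * ‖deriv γ t₀‖) ^ 2 + 1) := by
    rw [coneSpeed, fluxSpeed, rejection_smul, rejection_unitTangent_deriv (h t₀), smul_zero,
      norm_zero, norm_smul, Real.norm_eq_abs, mul_pow, sq_abs, zero_pow two_ne_zero, zero_add,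
      one_pow, Real.sqrt_one, zero_div, sub_zero, mul_pow]
    ring
  rw [hvalue] at hlim
  refine hlim.congr' ?_
  filter_upwards [self_mem_nhdsWithin] with s hs
  have hs0 : s ≠ 0 := (mem_Ioi.1 hs).ne'
  simp only [Function.comp_apply, ← coneSpeed_smul hs, ← fluxSpeed_smul hs, smul_smul,
    mul_inv_cancel₀ hs0, one_smul, coneDefect]
  ring

lemma lintegral_div_sq_mul_add_one {a : ℝ} (ha : 0 < a) :
    ∫⁻ τ : ℝ, ENNReal.ofReal (a / ((τ * a) ^ 2 + 1)) = ENNReal.ofReal Real.pi := by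
  have hpi : ∫⁻ τ : ℝ, ENNReal.ofReal (1 + τ ^ 2)⁻¹ = ENNReal.ofReal Real.pi := by
    rw [← ofReal_integral_eq_lintegral_ofReal integrable_inv_one_add_sq
      (Filter.Eventually.of_forall fun τ => by positivity), integral_univ_inv_one_add_sq]
  rw [← hpi, lintegral_eq_mul_lintegral_rescale volume
      (fun τ : ℝ => ENNReal.ofReal (1 + τ ^ 2)⁻¹) 0 ha, ← lintegral_const_mul _ (by fun_prop)]
  refine lintegral_congr fun τ => ?_
  rw [← ENNReal.ofReal_mul (by positivity), Module.finrank_self, pow_one, zero_add, smul_eq_mul,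
    div_eq_mul_inv, mul_comm τ, add_comm 1]

lemma ofReal_pi_le_liminf_lintegral_coneDefect (hγ : ContDiff ℝ 1 γ) (h : ∀ t, deriv γ t ≠ 0)
    (t₀ : ℝ) :
    ENNReal.ofReal Real.pi ≤ Filter.liminf (fun s => ∫⁻ t in Ioc (t₀ - 1 / 2) (t₀ - 1 / 2 + 1),
      ENNReal.ofReal (coneDefect γ s (γ t₀) t)) (𝓝[>] 0) := by
  have hmeas (s : ℝ) : Measurable (coneDefect γ s (γ t₀)) := by
    have hT := continuous_unitTangent hγ h
    have : Continuous (deriv γ) := hγ.continuous_deriv_one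
    have hc := hγ.continuous
    unfold coneDefect coneSpeed fluxSpeed
    refine (Measurable.mul (Measurable.div ?_ ?_) ?_).sub
      (Measurable.mul (Measurable.div ?_ ?_) ?_) <;> exact Continuous.measurable (by fun_prop)
  simp_rw [← lintegral_indicator measurableSet_Ioc]
  rw [← lintegral_div_sq_mul_add_one (norm_pos_iff.2 (h t₀))]
  refine lintegral_le_liminf_of_rescaled volume t₀ (c := fun s => s)
    (fun s => (hmeas s).ennreal_ofReal.indicator measurableSet_Ioc) (fun s hs => hs)
    (Filter.Eventually.of_forall fun τ => ?_)
  rw [← ((ENNReal.continuous_ofReal.tendsto _).comp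
    (tendsto_mul_coneDefect hγ h t₀ τ)).liminf_eq]
  refine (Filter.liminf_congr ?_).le
  have hmem : ∀ᶠ s in 𝓝[>] (0 : ℝ), t₀ + s * τ ∈ Ioc (t₀ - 1 / 2) (t₀ - 1 / 2 + 1) :=
    (tendsto_add_mul_nhdsGT t₀ τ).eventually (Ioc_mem_nhds (by linarith) (by linarith))
  filter_upwards [self_mem_nhdsWithin, hmem] with s hs hsτ
  rw [smul_eq_mul, indicator_of_mem hsτ, Module.finrank_self, pow_one,
    ← ENNReal.ofReal_mul (le_of_lt hs), Function.comp_apply]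

lemma eventually_le_integral_coneDefect (hγ : ContDiff ℝ 1 γ) (h : ∀ t, deriv γ t ≠ 0)
    (hper : Function.Periodic γ 1) (t₀ : ℝ) {c : ℝ} (hc : c < Real.pi) :
    ∀ᶠ s in 𝓝[>] (0 : ℝ), c ≤ ∫ t in (0 : ℝ)..1, coneDefect γ s (γ t₀) t := by
  have hlt := ((ENNReal.ofReal_lt_ofReal_iff Real.pi_pos).2 hc).trans_le
    (ofReal_pi_le_liminf_lintegral_coneDefect hγ h t₀)
  filter_upwards [Filter.eventually_lt_of_lt_liminf hlt, self_mem_nhdsWithin] with s hs hs0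
  have hcont := continuous_coneDefect hγ h hs0 (γ t₀)
  rw [← ofReal_integral_eq_lintegral_ofReal hcont.integrableOn_Ioc
    (Filter.Eventually.of_forall (coneDefect_nonneg γ s _)),
    ← intervalIntegral.integral_of_le (by linarith),
    ← (periodic_coneDefect hper s _).intervalIntegral_add_eq 0, zero_add] at hs
  exact (ENNReal.ofReal_le_ofReal_iff (integral_coneDefect_nonneg γ s _)).1 hs.le

end BoundaryDefect

section ModelDensity

/-- The area density of `z ↦ z ^ (k + 1)` at `|z| = r`, weighted by `(|z ^ (k + 1)|² + 1)⁻²`. -/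
def modelDensity (k : ℕ) (r : ℝ) : ℝ :=
  (k + 1) ^ 2 * r ^ (2 * k) / (r ^ (2 * k + 2) + 1) ^ 2

lemma modelDensity_nonneg (k : ℕ) (r : ℝ) : 0 ≤ modelDensity k r := by
  have hsq : r ^ (2 * k) = (r ^ k) ^ 2 := by ring
  rw [modelDensity, hsq]
  positivity

lemma hasDerivAt_modelDensity_antideriv (k : ℕ) {y : ℝ} (hy : 0 ≤ y) :
    HasDerivAt (fun y : ℝ => -((k + 1 : ℝ) / 2) * (y ^ (2 * k + 2) + 1)⁻¹)
      (y * modelDensity k y) y := by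
  have hpos : 0 < y ^ (2 * k + 2) + 1 := by positivity
  refine ((((hasDerivAt_pow (2 * k + 2) y).add_const 1).inv hpos.ne').const_mul
    (-((k + 1 : ℝ) / 2))).congr_deriv ?_
  unfold modelDensity
  simp only [Nat.add_succ_sub_one]
  push_cast
  field_simp
  ring

lemma tendsto_modelDensity_antideriv (k : ℕ) :
    Filter.Tendsto (fun y : ℝ => -((k + 1 : ℝ) / 2) * (y ^ (2 * k + 2) + 1)⁻¹) Filter.atTop
      (𝓝 0) := by
  have hpow : Filter.Tendsto (fun y : ℝ => y ^ (2 * k + 2) + 1) Filter.atTop Filter.atTop :=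
    Filter.tendsto_atTop_add_const_right _ _ (Filter.tendsto_pow_atTop (by omega))
  have hlim := hpow.inv_tendsto_atTop.const_mul (-((k + 1 : ℝ) / 2))
  rwa [mul_zero] at hlim

lemma integrableOn_Ioi_mul_modelDensity (k : ℕ) :
    IntegrableOn (fun y => y * modelDensity k y) (Ioi 0) :=
  integrableOn_Ioi_deriv_of_nonneg' (fun _ hy => hasDerivAt_modelDensity_antideriv k hy)
    (fun y hy => mul_nonneg (le_of_lt hy) (modelDensity_nonneg k y))
    (tendsto_modelDensity_antideriv k)

lemma integral_Ioi_mul_modelDensity (k : ℕ) :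
    ∫ y in Ioi (0 : ℝ), y * modelDensity k y = (k + 1) / 2 := by
  rw [integral_Ioi_of_hasDerivAt_of_nonneg' (fun _ hy => hasDerivAt_modelDensity_antideriv k hy)
    (fun y hy => mul_nonneg (le_of_lt hy) (modelDensity_nonneg k y))
    (tendsto_modelDensity_antideriv k), zero_pow (by omega)]
  ring

lemma lintegral_modelDensity (k : ℕ) :
    ∫⁻ v : Euc 2, ENNReal.ofReal (modelDensity k ‖v‖) = ENNReal.ofReal ((k + 1) * Real.pi) := by
  have hint : Integrable fun v : Euc 2 => modelDensity k ‖v‖ := by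
    rw [integrable_fun_norm_addHaar (volume : Measure (Euc 2)) (f := modelDensity k)]
    simpa only [finrank_euclideanSpace_fin, Nat.add_one_sub_one, pow_one, smul_eq_mul] using
      integrableOn_Ioi_mul_modelDensity k
  have hball : (volume : Measure (Euc 2)).real (Metric.ball 0 1) = Real.pi := by
    simp [Measure.real, EuclideanSpace.volume_ball_fin_two, Real.pi_nonneg]
  rw [← ofReal_integral_eq_lintegral_ofReal hint
    (Filter.Eventually.of_forall fun v => modelDensity_nonneg k _),
    integral_fun_norm_addHaar (volume : Measure (Euc 2)) (modelDensity k), hball]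
  simp only [finrank_euclideanSpace_fin, Nat.add_one_sub_one, pow_one, smul_eq_mul, nsmul_eq_mul,
    integral_Ioi_mul_modelDensity]
  congr 1
  push_cast
  ring

lemma lintegral_modelDensity_comp (k : ℕ) (A : Euc 2 →L[ℝ] Euc 2) (hA : A.det ≠ 0) :
    ∫⁻ w : Euc 2, ENNReal.ofReal (modelDensity k ‖A w‖ * |A.det|) =
      ENNReal.ofReal ((k + 1) * Real.pi) := by
  have hinj : Function.Injective A :=
    (jacobian_ne_zero_iff A).1 (by rw [jacobian_eq_abs_det]; exact abs_ne_zero.2 hA)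
  have hsurj : Function.Surjective A := LinearMap.injective_iff_surjective.1 hinj
  have hchange := lintegral_image_eq_lintegral_abs_det_fderiv_mul (volume : Measure (Euc 2))
    MeasurableSet.univ (f := A) (f' := fun _ => A) (fun x _ => A.hasFDerivAt.hasFDerivWithinAt)
    hinj.injOn (fun v => ENNReal.ofReal (modelDensity k ‖v‖))
  rw [image_univ, hsurj.range_eq, Measure.restrict_univ, lintegral_modelDensity] at hchange
  rw [hchange]
  exact lintegral_congr fun w => by rw [mul_comm, ENNReal.ofReal_mul (abs_nonneg _)]

end ModelDensity

section HalfSpace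

variable {E : Type*} [NormedAddCommGroup E] [NormedSpace ℝ E] [MeasurableSpace E] [BorelSpace E]
  [FiniteDimensional ℝ E] (μ : Measure E) [μ.IsAddHaarMeasure]

lemma ae_apply_ne_zero {ℓ : E →L[ℝ] ℝ} (hℓ : ℓ ≠ 0) : ∀ᵐ w ∂μ, ℓ w ≠ 0 := by
  have hker : LinearMap.ker ℓ.toLinearMap ≠ ⊤ := fun h =>
    hℓ (ContinuousLinearMap.coe_injective (LinearMap.ker_eq_top.1 h))
  simpa only [ae_iff, not_not] using! Measure.addHaar_submodule μ _ hker

lemma lintegral_eq_two_mul_setLIntegral_of_even {ℓ : E →L[ℝ] ℝ} (hℓ : ℓ ≠ 0) {G : E → ℝ≥0∞}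
    (heven : ∀ w, G (-w) = G w) : ∫⁻ w, G w ∂μ = 2 * ∫⁻ w in {w | 0 < ℓ w}, G w ∂μ := by
  have hpos : MeasurableSet {w | 0 < ℓ w} := measurableSet_lt measurable_const ℓ.measurable
  have hneg : MeasurableSet {w | ℓ w < 0} := measurableSet_lt ℓ.measurable measurable_const
  have hcompl : ({w | 0 < ℓ w}ᶜ : Set E) =ᵐ[μ] {w | ℓ w < 0} := by
    filter_upwards [ae_apply_ne_zero μ hℓ] with w hw
    exact propext ⟨fun h => lt_of_le_of_ne (not_lt.1 h) hw, fun h => not_lt.2 (le_of_lt h)⟩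
  have hreflect : ∫⁻ w in {w | ℓ w < 0}, G w ∂μ = ∫⁻ w in {w | 0 < ℓ w}, G w ∂μ := by
    rw [← lintegral_indicator hpos, ← lintegral_indicator hneg, ← lintegral_neg_eq_self]
    refine lintegral_congr fun w => ?_
    simp only [indicator, mem_ofPred_eq, map_neg, neg_lt_zero, heven]
  rw [← lintegral_add_compl G hpos, setLIntegral_congr hcompl, hreflect, two_mul]

end HalfSpace

section Charts

lemma measurableSet_inter_preimage {X Y : Type*} [TopologicalSpace X] [MeasurableSpace X]
    [BorelSpace X] [TopologicalSpace Y] [MeasurableSpace Y] [BorelSpace Y] {f : X → Y} {t : Set X}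
    (hf : ContinuousOn f t) (ht : MeasurableSet t) {S : Set Y} (hS : MeasurableSet S) :
    MeasurableSet (t ∩ f ⁻¹' S) := by
  rw [← Subtype.image_preimage_coe]
  exact ht.subtype_image ((continuousOn_iff_continuous_domRestrict.1 hf).measurable hS)

variable {n : ℕ} {M : Type*} [TopologicalSpace M] [ChartedSpace (EuclideanHalfSpace 2) M]

/-- The derivative of `u` read in the chart at `p`. -/
def chartDeriv (u : M → Euc n) (p : M) (y : Euc 2) : Euc 2 →L[ℝ] Euc n :=
  fderivWithin ℝ (u ∘ (extChartAt (𝓡∂ 2) p).symm) (range (𝓡∂ 2)) y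

/-- The derivative of the inverse of the chart at `p`, read in the preferred charts of `M`. -/
def symmDeriv (p : M) (y : Euc 2) : Euc 2 →L[ℝ] Euc 2 :=
  mfderivWithin 𝓘(ℝ, Euc 2) (𝓡∂ 2) (extChartAt (𝓡∂ 2) p).symm (range (𝓡∂ 2)) y

lemma mem_range_half_iff {y : Euc 2} : y ∈ range (𝓡∂ 2) ↔ 0 ≤ y 0 := by
  rw [range_modelWithCornersEuclideanHalfSpace, mem_ofPred_eq]

lemma measurableSet_extChartAt_target (p : M) : MeasurableSet (extChartAt (𝓡∂ 2) p).target := by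
  rw [extChartAt_target]
  exact ((chartAt _ p).open_target.preimage (𝓡∂ 2).continuous_symm).measurableSet.inter
    (𝓡∂ 2).isClosed_range.measurableSet

lemma measurableSet_target_inter_preimage [MeasurableSpace M] [BorelSpace M] (p : M) {S : Set M}
    (hS : MeasurableSet S) :
    MeasurableSet ((extChartAt (𝓡∂ 2) p).target ∩ (extChartAt (𝓡∂ 2) p).symm ⁻¹' S) :=
  measurableSet_inter_preimage (continuousOn_extChartAt_symm p)
    (measurableSet_extChartAt_target p) hS

lemma aemeasurable_extChartAt_symm [MeasurableSpace M] [BorelSpace M] (p : M) :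
    AEMeasurable (extChartAt (𝓡∂ 2) p).symm (volume.restrict (extChartAt (𝓡∂ 2) p).target) :=
  (continuousOn_extChartAt_symm p).aemeasurable (measurableSet_extChartAt_target p)

variable [IsManifold (𝓡∂ 2) 1 M]

lemma contDiffWithinAt_comp_symm {F : Type*} [NormedAddCommGroup F] [NormedSpace ℝ F]
    {u : M → F} {p : M} {y : Euc 2} (hy : y ∈ (extChartAt (𝓡∂ 2) p).target)
    (hu : ContMDiffAt (𝓡∂ 2) 𝓘(ℝ, F) 1 u ((extChartAt (𝓡∂ 2) p).symm y)) :
    ContDiffWithinAt ℝ 1 (u ∘ (extChartAt (𝓡∂ 2) p).symm) (range (𝓡∂ 2)) y :=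
  contMDiffWithinAt_iff_contDiffWithinAt.1
    (hu.comp_contMDiffWithinAt y (contMDiffWithinAt_extChartAt_symm_range p hy))

lemma fderivWithin_comp_symm {F : Type*} [NormedAddCommGroup F] [NormedSpace ℝ F]
    {u : M → F} {p : M} {y : Euc 2} (hy : y ∈ (extChartAt (𝓡∂ 2) p).target)
    (hu : MDifferentiableAt (𝓡∂ 2) 𝓘(ℝ, F) u ((extChartAt (𝓡∂ 2) p).symm y)) :
    fderivWithin ℝ (u ∘ (extChartAt (𝓡∂ 2) p).symm) (range (𝓡∂ 2)) y =
      (mfderiv (𝓡∂ 2) 𝓘(ℝ, F) u ((extChartAt (𝓡∂ 2) p).symm y) : Euc 2 →L[ℝ] F) ∘L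
        symmDeriv p y := by
  rw [← mfderivWithin_eq_fderivWithin]
  exact mfderiv_comp_mfderivWithin y hu (mdifferentiableWithinAt_extChartAt_symm hy)
    ((𝓡∂ 2).uniqueDiffOn.uniqueMDiffOn y (extChartAt_target_subset_range p hy))

lemma symmDeriv_bijective {p : M} {y : Euc 2} (hy : y ∈ (extChartAt (𝓡∂ 2) p).target) :
    Function.Bijective (symmDeriv p y) := by
  have hinv := isInvertible_mfderivWithin_extChartAt_symm (I := 𝓡∂ 2) hy
  exact hinv.bijective

lemma continuousWithinAt_fderivWithin_comp_symm {F : Type*} [NormedAddCommGroup F]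
    [NormedSpace ℝ F] {u : M → F} {p : M} {y : Euc 2} (hy : y ∈ (extChartAt (𝓡∂ 2) p).target)
    (hu : ContMDiffAt (𝓡∂ 2) 𝓘(ℝ, F) 1 u ((extChartAt (𝓡∂ 2) p).symm y)) :
    ContinuousWithinAt (fun y => fderivWithin ℝ (u ∘ (extChartAt (𝓡∂ 2) p).symm)
      (range (𝓡∂ 2)) y) (range (𝓡∂ 2)) y :=
  ((contDiffWithinAt_comp_symm hy hu).fderivWithin_right (m := 0) (𝓡∂ 2).uniqueDiffOn
    (zero_add _).le (extChartAt_target_subset_range p hy)).continuousWithinAt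

variable {u : M → Euc n} (hu : ContMDiff (𝓡∂ 2) 𝓘(ℝ, Euc n) 1 u) {p : M} {y : Euc 2}
include hu

lemma chartDeriv_eq (hy : y ∈ (extChartAt (𝓡∂ 2) p).target) :
    chartDeriv u p y = du u ((extChartAt (𝓡∂ 2) p).symm y) ∘L symmDeriv p y :=
  fderivWithin_comp_symm hy ((hu.mdifferentiable one_ne_zero) _)

lemma chartDeriv_injective_iff (hy : y ∈ (extChartAt (𝓡∂ 2) p).target) :
    Function.Injective (chartDeriv u p y) ↔
      Function.Injective (du u ((extChartAt (𝓡∂ 2) p).symm y)) := by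
  rw [chartDeriv_eq hu hy, ContinuousLinearMap.coe_comp]
  exact Function.Injective.of_comp_iff' _ (symmDeriv_bijective hy)

lemma range_chartDeriv (hy : y ∈ (extChartAt (𝓡∂ 2) p).target) :
    LinearMap.range (chartDeriv u p y).toLinearMap =
      LinearMap.range (du u ((extChartAt (𝓡∂ 2) p).symm y)).toLinearMap := by
  rw [chartDeriv_eq hu hy]
  exact LinearMap.range_comp_of_range_eq_top _
    (LinearMap.range_eq_top.2 (symmDeriv_bijective hy).2)

lemma continuousWithinAt_chartDeriv (hy : y ∈ (extChartAt (𝓡∂ 2) p).target) :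
    ContinuousWithinAt (chartDeriv u p) (range (𝓡∂ 2)) y :=
  continuousWithinAt_fderivWithin_comp_symm hy (hu _)

lemma continuousAt_chartDeriv_comp (p : M) :
    ContinuousAt (fun q => chartDeriv u p (extChartAt (𝓡∂ 2) p q)) p :=
  (continuousWithinAt_chartDeriv hu (mem_extChartAt_target (I := 𝓡∂ 2) p)).tendsto.comp
    (tendsto_nhdsWithin_iff.2 ⟨continuousAt_extChartAt p, .of_forall fun _ => mem_range_self _⟩)

lemma continuousWithinAt_chartJacobian (hy : y ∈ (extChartAt (𝓡∂ 2) p).target) :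
    ContinuousWithinAt (chartJacobian u p) (range (𝓡∂ 2)) y :=
  continuous_jacobian.continuousAt.comp_continuousWithinAt (continuousWithinAt_chartDeriv hu hy)

lemma aemeasurable_chartJacobian (p : M) :
    AEMeasurable (fun y => ENNReal.ofReal (chartJacobian u p y))
      (volume.restrict (extChartAt (𝓡∂ 2) p).target) := by
  have hcont : ContinuousOn (chartJacobian u p) (extChartAt (𝓡∂ 2) p).target := fun _ hy =>
    (continuousWithinAt_chartJacobian hu hy).mono (extChartAt_target_subset_range p)
  exact (hcont.aemeasurable (measurableSet_extChartAt_target p)).ennreal_ofReal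

lemma chartDeriv_eq_comp_fderivWithin_transition {q : M}
    (hy : y ∈ (extChartAt (𝓡∂ 2) p).target)
    (hyq : (extChartAt (𝓡∂ 2) p).symm y ∈ (extChartAt (𝓡∂ 2) q).source) :
    chartDeriv u p y =
      chartDeriv u q (extChartAt (𝓡∂ 2) q ((extChartAt (𝓡∂ 2) p).symm y)) ∘L
        fderivWithin ℝ (extChartAt (𝓡∂ 2) q ∘ (extChartAt (𝓡∂ 2) p).symm) (range (𝓡∂ 2)) y := by
  set x := (extChartAt (𝓡∂ 2) p).symm y
  have hchart : MDifferentiableAt (𝓡∂ 2) 𝓘(ℝ, Euc 2) (extChartAt (𝓡∂ 2) q) x :=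
    mdifferentiableAt_extChartAt (by rwa [← extChartAt_source (𝓡∂ 2)])
  let B : Euc 2 →L[ℝ] Euc 2 := mfderiv (𝓡∂ 2) 𝓘(ℝ, Euc 2) (extChartAt (𝓡∂ 2) q) x
  have hB : symmDeriv q (extChartAt (𝓡∂ 2) q x) ∘L B = ContinuousLinearMap.id ℝ (Euc 2) :=
    mfderivWithin_extChartAt_symm_comp_mfderiv_extChartAt' (I := 𝓡∂ 2) hyq
  have htransition : fderivWithin ℝ (extChartAt (𝓡∂ 2) q ∘ (extChartAt (𝓡∂ 2) p).symm)
      (range (𝓡∂ 2)) y = B ∘L symmDeriv p y := fderivWithin_comp_symm hy hchart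
  rw [chartDeriv_eq hu hy, chartDeriv_eq hu ((extChartAt (𝓡∂ 2) q).map_source hyq),
    (extChartAt (𝓡∂ 2) q).left_inv hyq, htransition, ContinuousLinearMap.comp_assoc,
    ← ContinuousLinearMap.comp_assoc _ B, hB, ContinuousLinearMap.id_comp]

lemma setLIntegral_chartArea [MeasurableSpace M] [BorelSpace M] (p : M) {g : M → ℝ≥0∞}
    (hg : Measurable g) {S : Set M} (hS : MeasurableSet S) :
    ∫⁻ q in S, g q ∂(chartArea u p) =
      ∫⁻ y in (extChartAt (𝓡∂ 2) p).target ∩ (extChartAt (𝓡∂ 2) p).symm ⁻¹' S,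
        ENNReal.ofReal (chartJacobian u p y) * g ((extChartAt (𝓡∂ 2) p).symm y) := by
  have hJ := aemeasurable_chartJacobian hu p
  have hφ := aemeasurable_extChartAt_symm p
  have hφJ := hφ.mono_ac (withDensity_absolutelyContinuous _
    fun y => ENNReal.ofReal (chartJacobian u p y))
  have hle : volume.restrict ((extChartAt (𝓡∂ 2) p).symm ⁻¹' S ∩
      (extChartAt (𝓡∂ 2) p).target) ≤ volume.restrict (extChartAt (𝓡∂ 2) p).target :=
    Measure.restrict_mono_set _ inter_subset_right
  have hgφ : AEMeasurable (fun y => g ((extChartAt (𝓡∂ 2) p).symm y))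
      (volume.restrict ((extChartAt (𝓡∂ 2) p).symm ⁻¹' S ∩ (extChartAt (𝓡∂ 2) p).target)) :=
    hg.comp_aemeasurable (hφ.mono_measure hle)
  rw [chartArea, Measure.restrict_map_of_aemeasurable hφJ hS, restrict_withDensity',
    Measure.restrict_restrict' (measurableSet_extChartAt_target p),
    lintegral_map' hg.aemeasurable,
    lintegral_withDensity_eq_lintegral_mul₀ (hJ.mono_measure hle) hgφ, inter_comm]
  · rfl
  · exact (hφ.mono_measure hle).mono_ac (withDensity_absolutelyContinuous _ _)

end Charts

section Area

variable {n : ℕ} {M : Type*} [TopologicalSpace M] [ChartedSpace (EuclideanHalfSpace 2) M]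

/-- The set of points at which `u` is an immersion. -/
def immersedSet (u : M → Euc n) : Set M := {q | Function.Injective (du u q)}

lemma chartArea_le_area [MeasurableSpace M] (u : M → Euc n) (p : M) : chartArea u p ≤ area u :=
  le_iSup (chartArea u) p

variable [IsManifold (𝓡∂ 2) 1 M] {u : M → Euc n} (hu : ContMDiff (𝓡∂ 2) 𝓘(ℝ, Euc n) 1 u)
include hu

lemma isOpen_immersedSet : IsOpen (immersedSet u) := by
  refine isOpen_iff_mem_nhds.2 fun p hp => ?_
  have hiff {q : M} (hq : q ∈ (extChartAt (𝓡∂ 2) p).source) :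
      jacobian (chartDeriv u p (extChartAt (𝓡∂ 2) p q)) ≠ 0 ↔ q ∈ immersedSet u := by
    rw [jacobian_ne_zero_iff, chartDeriv_injective_iff hu ((extChartAt (𝓡∂ 2) p).map_source hq),
      (extChartAt (𝓡∂ 2) p).left_inv hq, immersedSet, mem_ofPred_eq]
  have hcont : ContinuousAt (fun q => jacobian (chartDeriv u p (extChartAt (𝓡∂ 2) p q))) p :=
    continuous_jacobian.continuousAt.comp (continuousAt_chartDeriv_comp hu p)
  filter_upwards [hcont.eventually_ne ((hiff (mem_extChartAt_source p)).2 hp),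
    extChartAt_source_mem_nhds (I := 𝓡∂ 2) p] with q hne hq
  exact (hiff hq).1 hne

lemma continuousOn_starProjection_range_du :
    ContinuousOn (fun q => (LinearMap.range (du u q).toLinearMap).starProjection)
      (immersedSet u) := by
  intro p hp
  let A : M → Euc 2 →L[ℝ] Euc n := fun q => chartDeriv u p (extChartAt (𝓡∂ 2) p q)
  have hA : ContinuousAt A p := continuousAt_chartDeriv_comp hu p
  have hinj {q : M} (hq : q ∈ (extChartAt (𝓡∂ 2) p).source) (hqu : q ∈ immersedSet u) :
      Function.Injective (A q) := by
    rwa [chartDeriv_injective_iff hu ((extChartAt (𝓡∂ 2) p).map_source hq),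
      (extChartAt (𝓡∂ 2) p).left_inv hq]
  have hproj : (fun q => (LinearMap.range (du u q).toLinearMap).starProjection) =ᶠ[𝓝 p] fun q =>
      A q ∘L Ring.inverse ((A q).adjoint ∘L A q) ∘L (A q).adjoint := by
    filter_upwards [extChartAt_source_mem_nhds (I := 𝓡∂ 2) p,
      (isOpen_immersedSet hu).mem_nhds hp] with q hq hqu
    have hrange := range_chartDeriv hu ((extChartAt (𝓡∂ 2) p).map_source hq)
    rw [(extChartAt (𝓡∂ 2) p).left_inv hq] at hrange
    simp only [← hrange, ← starProjection_range (hinj hq hqu), A]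
  have hadj : ContinuousAt (fun q => (A q).adjoint) p :=
    ContinuousLinearMap.adjoint.continuous.continuousAt.comp hA
  have hinv : ContinuousAt (fun q => Ring.inverse ((A q).adjoint ∘L A q)) p := by
    obtain ⟨x, hx⟩ := isUnit_adjoint_comp_self (hinj (mem_extChartAt_source p) hp)
    have hx' := NormedRing.inverse_continuousAt x
    rw [hx] at hx'
    exact hx'.comp (f := fun q => (A q).adjoint ∘L A q) (hadj.clm_comp hA)
  exact ((hA.clm_comp (hinv.clm_comp hadj)).congr hproj.symm).continuousWithinAt

variable [MeasurableSpace M] [BorelSpace M]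

lemma chartArea_apply (p : M) {S : Set M} (hS : MeasurableSet S) :
    chartArea u p S = ∫⁻ y in (extChartAt (𝓡∂ 2) p).target ∩ (extChartAt (𝓡∂ 2) p).symm ⁻¹' S,
      ENNReal.ofReal (chartJacobian u p y) := by
  simpa only [lintegral_one, Measure.restrict_apply_univ, mul_one] using
    setLIntegral_chartArea hu p (g := fun _ => 1) measurable_const hS

lemma chartArea_compl_source (p : M) : chartArea u p (extChartAt (𝓡∂ 2) p).sourceᶜ = 0 := by
  have hempty : (extChartAt (𝓡∂ 2) p).target ∩
      (extChartAt (𝓡∂ 2) p).symm ⁻¹' (extChartAt (𝓡∂ 2) p).sourceᶜ = ∅ :=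
    disjoint_iff_inter_eq_empty.1
      (disjoint_left.2 fun _ hy hy' => hy' ((extChartAt (𝓡∂ 2) p).map_target hy))
  rw [chartArea_apply hu p (isOpen_extChartAt_source p).measurableSet.compl, hempty,
    setLIntegral_empty]

lemma chartArea_eq_of_subset (p q : M) {S : Set M} (hS : MeasurableSet S)
    (hp : S ⊆ (extChartAt (𝓡∂ 2) p).source) (hq : S ⊆ (extChartAt (𝓡∂ 2) q).source) :
    chartArea u p S = chartArea u q S := by
  rw [chartArea_apply hu p hS, chartArea_apply hu q hS]
  set e := extChartAt (𝓡∂ 2) p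
  set e' := extChartAt (𝓡∂ 2) q
  set T := e.target ∩ e.symm ⁻¹' S
  have hTm : MeasurableSet T := measurableSet_target_inter_preimage p hS
  have himage : (e' ∘ e.symm) '' T = e'.target ∩ e'.symm ⁻¹' S := by
    rw [← e'.image_eq_target_inter_inv_preimage hq, image_comp,
      show T = e '' S from (e.image_eq_target_inter_inv_preimage hp).symm,
      e.symm_image_image_of_subset_source hp]
  have hinj : InjOn (e' ∘ e.symm) T :=
    (e'.injOn.mono hq).comp (e.symm.injOn.mono inter_subset_left) fun _ hy => hy.2
  have hderiv : ∀ y ∈ T, HasFDerivWithinAt (e' ∘ e.symm)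
      (fderivWithin ℝ (e' ∘ e.symm) (range (𝓡∂ 2)) y) T y := fun y hy => by
    have hchart : ContMDiffAt (𝓡∂ 2) 𝓘(ℝ, Euc 2) 1 e' (e.symm y) :=
      contMDiffAt_extChartAt' (by rw [← extChartAt_source (𝓡∂ 2)]; exact hq hy.2)
    exact ((contDiffWithinAt_comp_symm hy.1 hchart).differentiableWithinAt
      one_ne_zero).hasFDerivWithinAt.mono fun z hz => extChartAt_target_subset_range p hz.1
  rw [← himage, lintegral_image_eq_lintegral_abs_det_fderiv_mul volume hTm hderiv hinj]
  refine setLIntegral_congr_fun hTm fun y hy => ?_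
  change ENNReal.ofReal (jacobian (chartDeriv u p y)) =
    ENNReal.ofReal _ * ENNReal.ofReal (jacobian (chartDeriv u q (e' (e.symm y))))
  rw [← ENNReal.ofReal_mul (abs_nonneg _),
    chartDeriv_eq_comp_fderivWithin_transition hu hy.1 (hq hy.2), jacobian_comp, mul_comm]

lemma chartArea_apply_le (p q : M) {S : Set M} (hS : MeasurableSet S)
    (hq : S ⊆ (extChartAt (𝓡∂ 2) q).source) : chartArea u p S ≤ chartArea u q S := by
  set s := (extChartAt (𝓡∂ 2) p).source
  have hs : MeasurableSet s := (isOpen_extChartAt_source p).measurableSet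
  calc chartArea u p S
      = chartArea u p (S ∩ s) := (measure_inter_conull (chartArea_compl_source hu p)).symm
    _ = chartArea u q (S ∩ s) := chartArea_eq_of_subset hu p q (hS.inter hs) inter_subset_right
        (inter_subset_left.trans hq)
    _ ≤ chartArea u q S := measure_mono inter_subset_left

lemma exists_isOpen_chartArea_lt_top (p : M) :
    ∃ W : Set M, IsOpen W ∧ p ∈ W ∧ W ⊆ (extChartAt (𝓡∂ 2) p).source ∧
      chartArea u p W < ⊤ := by
  set e := extChartAt (𝓡∂ 2) p
  set C := chartJacobian u p (e p) + 1
  have hbound : ∀ᶠ y in 𝓝[range (𝓡∂ 2)] (e p), chartJacobian u p y < C :=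
    (continuousWithinAt_chartJacobian hu
      (mem_extChartAt_target (I := 𝓡∂ 2) p)).eventually_lt_const (lt_add_one _)
  obtain ⟨V, hV, hpV, hVC⟩ := mem_nhdsWithin.1 hbound
  have hW : IsOpen (e.source ∩ e ⁻¹' (V ∩ Metric.ball (e p) 1)) :=
    isOpen_extChartAt_preimage' p (hV.inter Metric.isOpen_ball)
  refine ⟨_, hW, ⟨mem_extChartAt_source p, hpV, Metric.mem_ball_self one_pos⟩,
    inter_subset_left, ?_⟩
  rw [chartArea_apply hu p hW.measurableSet]
  set T := e.target ∩ e.symm ⁻¹' (e.source ∩ e ⁻¹' (V ∩ Metric.ball (e p) 1))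
  have hT {y : Euc 2} (hy : y ∈ T) : y ∈ V ∩ Metric.ball (e p) 1 := by
    simpa only [mem_preimage, e.right_inv hy.1] using hy.2.2
  calc ∫⁻ y in T, ENNReal.ofReal (chartJacobian u p y)
      ≤ ∫⁻ _ in T, ENNReal.ofReal C := setLIntegral_mono measurable_const fun y hy =>
        ENNReal.ofReal_le_ofReal
          (hVC ⟨(hT hy).1, extChartAt_target_subset_range p hy.1⟩).le
    _ = ENNReal.ofReal C * volume T := setLIntegral_const _ _
    _ < ⊤ := ENNReal.mul_lt_top ENNReal.ofReal_lt_top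
        ((measure_mono fun y hy => (hT hy).2).trans_lt measure_ball_lt_top)

variable [CompactSpace M]

lemma exists_area_le :
    ∃ (F : Finset M) (W : M → Set M), (∀ p, chartArea u p (W p) < ⊤) ∧
      area u ≤ ∑ p ∈ F, (chartArea u p).restrict (W p) := by
  choose W hWo hpW hWs hWlt using exists_isOpen_chartArea_lt_top hu
  obtain ⟨F, -, hF⟩ := isCompact_univ.elim_nhds_subcover W fun p _ => (hWo p).mem_nhds (hpW p)
  refine ⟨F, W, hWlt, iSup_le fun p => Measure.le_iff.2 fun S hS => ?_⟩
  have hcover : S = ⋃ q ∈ F, S ∩ W q := by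
    rw [← inter_iUnion₂, univ_subset_iff.1 hF, inter_univ]
  calc chartArea u p S
      ≤ ∑ q ∈ F, chartArea u p (S ∩ W q) := by
        conv_lhs => rw [hcover]
        exact measure_biUnion_finset_le _ _
    _ ≤ ∑ q ∈ F, chartArea u q (S ∩ W q) := Finset.sum_le_sum fun q _ =>
        chartArea_apply_le hu p q (hS.inter (hWo q).measurableSet)
          (inter_subset_right.trans (hWs q))
    _ = (∑ q ∈ F, (chartArea u q).restrict (W q)) S := by
        simp only [Measure.finsetSum_apply, Measure.restrict_apply hS]

lemma isFiniteMeasure_area : IsFiniteMeasure (area u) := by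
  obtain ⟨F, W, hW, hle⟩ := exists_area_le hu
  refine ⟨(hle univ).trans_lt ?_⟩
  rw [Measure.finsetSum_apply]
  exact ENNReal.sum_lt_top.2 fun p _ => by rw [Measure.restrict_apply_univ]; exact hW p

lemma area_eq_zero {N : Set M} (hN : ∀ p, chartArea u p N = 0) : area u N = 0 := by
  obtain ⟨F, W, -, hle⟩ := exists_area_le hu
  refine le_antisymm ((hle N).trans ?_) bot_le
  rw [Measure.finsetSum_apply]
  exact (Finset.sum_eq_zero fun p _ =>
    Measure.absolutelyContinuous_of_le Measure.restrict_le_self (hN p)).le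

lemma area_compl_immersedSet : area u (immersedSet u)ᶜ = 0 := by
  have hm : MeasurableSet (immersedSet u)ᶜ := (isOpen_immersedSet hu).measurableSet.compl
  refine area_eq_zero hu fun p => ?_
  rw [chartArea_apply hu p hm]
  refine setLIntegral_eq_zero (measurableSet_target_inter_preimage p hm) fun y hy => ?_
  have hJ : jacobian (chartDeriv u p y) = 0 := by
    rw [← not_ne_iff, jacobian_ne_zero_iff, chartDeriv_injective_iff hu hy.1]
    exact hy.2
  exact ENNReal.ofReal_eq_zero.2 hJ.le

lemma integrable_surfaceDiv {X : Euc n → Euc n} (hX : ContDiff ℝ 1 X) :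
    Integrable (surfaceDiv u X) (area u) := by
  have := isFiniteMeasure_area hu
  let tr : (Euc n →L[ℝ] Euc n) →L[ℝ] ℝ :=
    LinearMap.toContinuousLinearMap (LinearMap.trace ℝ (Euc n) ∘ₗ ContinuousLinearMap.coeLM ℝ)
  have hDX : Continuous fun q => fderiv ℝ X (u q) :=
    (hX.continuous_fderiv one_ne_zero).comp hu.continuous
  have hcont : ContinuousOn (surfaceDiv u X) (immersedSet u) :=
    tr.continuous.comp_continuousOn
      ((continuousOn_starProjection_range_du hu).clm_comp hDX.continuousOn)
  obtain ⟨C, hC⟩ := isCompact_univ.exists_bound_of_continuousOn hDX.continuousOn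
  refine Integrable.of_bound (C := ‖tr‖ * C) ?_ (.of_forall fun q => ?_)
  · rw [← Measure.restrict_eq_self_of_ae_mem (mem_ae_iff.2 (area_compl_immersedSet hu))]
    exact (hcont.aemeasurable (isOpen_immersedSet hu).measurableSet).aestronglyMeasurable
  · have hproj : ‖(LinearMap.range (du u q).toLinearMap).starProjection ∘L fderiv ℝ X (u q)‖ ≤ C :=
      (ContinuousLinearMap.opNorm_comp_le _ _).trans ((mul_le_of_le_one_left (norm_nonneg _)
        (Submodule.starProjection_norm_le _)).trans (hC q (mem_univ q)))
    exact (tr.le_opNorm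
      ((LinearMap.range (du u q).toLinearMap).starProjection ∘L fderiv ℝ X (u q))).trans
        (mul_le_mul_of_nonneg_left hproj (norm_nonneg tr))

end Area

section RadialField

variable {n : ℕ} {s : ℝ} (hs : 0 < s) (x : Euc n)

/-- A smoothing at scale `s` of the radial field `(y - x) / |y - x|²`. -/
def radialField (s : ℝ) (x y : Euc n) : Euc n := (‖y - x‖ ^ 2 + s ^ 2)⁻¹ • (y - x)

/-- The Poisson kernel of `ℝ² × (0, ∞)`, up to its constant factor, at height `s` above `x`,
extended to `ℝⁿ` and evaluated along `u`. -/
def poissonDensity {M : Type*} (u : M → Euc n) (s : ℝ) (x : Euc n) (q : M) : ℝ :=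
  s ^ 2 / (‖u q - x‖ ^ 2 + s ^ 2) ^ 2

lemma poissonDensity_nonneg {M : Type*} (u : M → Euc n) (s : ℝ) (x : Euc n) (q : M) :
    0 ≤ poissonDensity u s x q := by
  unfold poissonDensity; positivity

include hs

lemma norm_radialField_le (y : Euc n) : ‖radialField s x y‖ ≤ 1 / s := by
  have hd : 0 < ‖y - x‖ ^ 2 + s ^ 2 := by positivity
  rw [radialField, norm_smul, Real.norm_of_nonneg (by positivity), inv_mul_eq_div,
    div_le_div_iff₀ hd hs]
  nlinarith [sq_nonneg (‖y - x‖ - s), sq_nonneg ‖y - x‖]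

lemma continuous_poissonDensity {M : Type*} [TopologicalSpace M] {u : M → Euc n}
    (hu : Continuous u) : Continuous (poissonDensity u s x) := by
  unfold poissonDensity
  exact Continuous.div (by fun_prop) (by fun_prop) fun q => by positivity

lemma contDiff_radialField : ContDiff ℝ 1 (radialField s x) := by
  have hsub : ContDiff ℝ 1 fun y : Euc n => y - x := contDiff_id.sub contDiff_const
  exact (((hsub.norm_sq ℝ).add contDiff_const).inv fun y => by positivity).smul hsub

lemma hasFDerivAt_radialField (y : Euc n) :
    HasFDerivAt (radialField s x)
      ((‖y - x‖ ^ 2 + s ^ 2)⁻¹ • ContinuousLinearMap.id ℝ (Euc n) +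
        (innerSL ℝ (y - x)).smulRight ((-(2 / (‖y - x‖ ^ 2 + s ^ 2) ^ 2)) • (y - x))) y := by
  have hsub : HasFDerivAt (fun y : Euc n => y - x) (ContinuousLinearMap.id ℝ (Euc n)) y :=
    (hasFDerivAt_id y).sub_const x
  have hne : ‖y - x‖ ^ 2 + s ^ 2 ≠ 0 := by positivity
  have hinv := (hasDerivAt_inv hne).comp_hasFDerivAt y (hsub.norm_sq.add_const (s ^ 2))
  refine (hinv.smul hsub).congr_fderiv (ContinuousLinearMap.ext fun v => ?_)
  simp only [Function.comp_apply, map_sub, ContinuousLinearMap.comp_id, neg_smul, add_apply,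
    smul_apply, ContinuousLinearMap.id_apply, ContinuousLinearMap.smulRight_apply, neg_apply,
    sub_apply, coe_innerSL_apply, nsmul_eq_mul, Nat.cast_ofNat, smul_eq_mul, smul_neg, smul_smul,
    add_right_inj, neg_inj]
  congr 1
  field_simp

end RadialField

section BulkInequality

variable {n : ℕ} {M : Type*} [TopologicalSpace M] [ChartedSpace (EuclideanHalfSpace 2) M]
  {u : M → Euc n} {s : ℝ} (hs : 0 < s) (x : Euc n)
include hs

lemma surfaceDiv_radialField {q : M} (hq : q ∈ immersedSet u) :
    surfaceDiv u (radialField s x) q = 2 * poissonDensity u s x q +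
      2 * (‖(LinearMap.range (du u q).toLinearMap)ᗮ.starProjection (u q - x)‖ /
        (‖u q - x‖ ^ 2 + s ^ 2)) ^ 2 := by
  set w := u q - x with hw
  set V := LinearMap.range (du u q).toLinearMap
  have : 0 < ‖w‖ ^ 2 + s ^ 2 := by positivity
  have hcomp : ((V.starProjection ∘L fderiv ℝ (radialField s x) (u q) : Euc n →L[ℝ] Euc n) :
      Euc n →ₗ[ℝ] Euc n) = (‖w‖ ^ 2 + s ^ 2)⁻¹ • (V.starProjection : Euc n →ₗ[ℝ] Euc n) +
      ((innerSL ℝ w : Euc n →L[ℝ] ℝ) : Euc n →ₗ[ℝ] ℝ).smulRight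
        ((-(2 / (‖w‖ ^ 2 + s ^ 2) ^ 2)) • V.starProjection w) := by
    rw [(hasFDerivAt_radialField hs x (u q)).fderiv]
    refine LinearMap.ext fun v => ?_
    simp [w]
  have htrace : LinearMap.trace ℝ (Euc n) (V.starProjection : Euc n →ₗ[ℝ] Euc n) = 2 := by
    rw [trace_starProjection_range hq, finrank_euclideanSpace_fin, Nat.cast_ofNat]
  have hinner : ⟪w, V.starProjection w⟫ = ‖w‖ ^ 2 - ‖Vᗮ.starProjection w‖ ^ 2 := by
    have horth := V.starProjection_inner_eq_zero w (V.starProjection w)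
      (V.starProjection_apply_mem w)
    rw [inner_sub_left, sub_eq_zero, real_inner_self_eq_norm_sq] at horth
    rw [horth, V.norm_sq_eq_add_norm_sq_starProjection w, add_sub_cancel_right]
  rw [surfaceDiv, hcomp, map_add, map_smul, htrace, LinearMap.trace_smulRight, map_smul,
    ContinuousLinearMap.coe_coe, innerSL_apply_apply, hinner, poissonDensity, ← hw, smul_eq_mul,
    smul_eq_mul]
  field_simp
  ring

lemma two_mul_poissonDensity_le {H : M → Euc n} {q : M} (hq : q ∈ immersedSet u)
    (hH : ∀ v, ⟪du u q v, H q⟫ = 0) :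
    2 * poissonDensity u s x q ≤ surfaceDiv u (radialField s x) q -
      ⟪radialField s x (u q), H q⟫ + 1 / 8 * ‖H q‖ ^ 2 := by
  set V := LinearMap.range (du u q).toLinearMap
  set a := ‖Vᗮ.starProjection (u q - x)‖ / (‖u q - x‖ ^ 2 + s ^ 2)
  have hHV : H q ∈ Vᗮ := by
    rintro _ ⟨v, rfl⟩
    exact hH v
  have hinner : ⟪u q - x, H q⟫ = ⟪Vᗮ.starProjection (u q - x), H q⟫ := by
    rw [Submodule.starProjection_orthogonal_val, inner_sub_left (u q - x),
      Submodule.inner_right_of_mem_orthogonal (V.starProjection_apply_mem _) hHV, sub_zero]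
  have hcauchy : ⟪radialField s x (u q), H q⟫ ≤ a * ‖H q‖ := by
    rw [radialField, real_inner_smul_left, hinner, inv_mul_eq_div, div_mul_eq_mul_div]
    gcongr
    exact real_inner_le_norm _ _
  rw [surfaceDiv_radialField hs x hq]
  nlinarith [sq_nonneg (4 * a - ‖H q‖)]

variable [IsManifold (𝓡∂ 2) 1 M] [MeasurableSpace M] [BorelSpace M] [CompactSpace M]
  (hu : ContMDiff (𝓡∂ 2) 𝓘(ℝ, Euc n) 1 u)
include hu

lemma integrable_poissonDensity : Integrable (poissonDensity u s x) (area u) := by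
  have := isFiniteMeasure_area hu
  have hcont := continuous_poissonDensity hs x hu.continuous
  obtain ⟨C, hC⟩ := isCompact_univ.exists_bound_of_continuousOn hcont.continuousOn
  exact Integrable.of_bound hcont.measurable.aestronglyMeasurable C
    (.of_forall fun q => hC q (mem_univ q))

lemma two_mul_integral_poissonDensity_le {H : M → Euc n} (hdiv : DivergenceIdentity u H)
    (hH2 : MemLp H 2 (area u)) :
    2 * ∫ q, poissonDensity u s x q ∂(area u) ≤ 1 / 8 * (∫ q, ‖H q‖ ^ 2 ∂(area u)) +
      ∫ p : (𝓡∂ 2).boundary M, ⟪radialField s x (u p), conormal u p⟫ ∂(boundaryLength u) := by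
  have hX := contDiff_radialField hs x
  have hsurf := integrable_surfaceDiv hu hX
  have hsq : Integrable (fun q => ‖H q‖ ^ 2) (area u) := hH2.integrable_norm_pow two_ne_zero
  have hXH : Integrable (fun q => ⟪radialField s x (u q), H q⟫) (area u) :=
    (hdiv.integrable.norm.const_mul (1 / s)).mono'
      ((hX.continuous.comp hu.continuous).measurable.aestronglyMeasurable.inner
        hdiv.integrable.aestronglyMeasurable)
      (.of_forall fun q => (norm_inner_le_norm _ _).trans
        (mul_le_mul_of_nonneg_right (norm_radialField_le hs x _) (norm_nonneg _)))
  have hsub : Integrable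
      (fun q => surfaceDiv u (radialField s x) q - ⟪radialField s x (u q), H q⟫) (area u) :=
    hsurf.sub hXH
  calc 2 * ∫ q, poissonDensity u s x q ∂(area u)
      = ∫ q, 2 * poissonDensity u s x q ∂(area u) := (integral_const_mul _ _).symm
    _ ≤ ∫ q, (surfaceDiv u (radialField s x) q - ⟪radialField s x (u q), H q⟫ +
          1 / 8 * ‖H q‖ ^ 2) ∂(area u) := by
        refine integral_mono_ae ((integrable_poissonDensity hs x hu).const_mul 2)
          (hsub.add (hsq.const_mul _)) ?_
        filter_upwards [mem_ae_iff.2 (area_compl_immersedSet hu), hdiv.normal] with q hq hH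
        exact two_mul_poissonDensity_le hs x hq hH
    _ = _ := by
        rw [integral_add hsub (hsq.const_mul (1 / 8)), integral_sub hsurf hXH,
          integral_const_mul, hdiv.identity _ hX]
        ring

end BulkInequality

section BranchPoints

variable {n : ℕ} {M : Type*} [TopologicalSpace M] [ChartedSpace (EuclideanHalfSpace 2) M]
  {u : M → Euc n}

lemma du_eq_chartDeriv (hu : ContMDiff (𝓡∂ 2) 𝓘(ℝ, Euc n) 1 u) (p : M) :
    du u p = chartDeriv u p (extChartAt (𝓡∂ 2) p p) := by
  have hder : HasFDerivWithinAt (u ∘ (extChartAt (𝓡∂ 2) p).symm) (du u p) (range (𝓡∂ 2))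
      (extChartAt (𝓡∂ 2) p p) := (hu.mdifferentiable one_ne_zero p).hasMFDerivAt.2
  exact (hder.fderivWithin ((𝓡∂ 2).uniqueDiffOn _ (mem_range_self _))).symm

lemma tendsto_extChartAt_symm (p : M) :
    Filter.Tendsto (extChartAt (𝓡∂ 2) p).symm (𝓝[range (𝓡∂ 2)] (extChartAt (𝓡∂ 2) p p)) (𝓝 p) := by
  have hcont := (continuousAt_extChartAt_symm (I := 𝓡∂ 2) p).tendsto
  rw [extChartAt_to_inv] at hcont
  exact hcont.mono_left nhdsWithin_le_nhds

/-- The normal form `u = u p + L (ζ ^ (k + 1)) + o(|ζ| ^ (k + 1))` of `u` near `p`, in a coordinate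
`ζ` centred at `p`. A branch point of multiplicity `k + 1` has such a form with `1 ≤ k`, a point at
which `u` is an immersion has one with `k = 0`. -/
structure HasLocalForm (u : M → Euc n) (p : M) (k : ℕ) (L : ℂ →ₗᵢ[ℝ] Euc n) (ζ : M → ℂ) :
    Prop where
  contMDiffAt : ContMDiffAt (𝓡∂ 2) 𝓘(ℝ, ℂ) 1 ζ p
  apply_eq_zero : ζ p = 0
  injective_mfderiv : Function.Injective (mfderiv (𝓡∂ 2) 𝓘(ℝ, ℂ) ζ p)
  adjoint_apply :
    ∀ᶠ q in 𝓝 p, ContinuousLinearMap.adjoint L.toContinuousLinearMap (u q - u p) = ζ q ^ (k + 1)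
  isLittleO : (fun q => u q - u p - L (ζ q ^ (k + 1))) =o[𝓝 p] fun q => ζ q ^ (k + 1)

lemma IsBranchPoint.exists_hasLocalForm {p : M} (h : IsBranchPoint u p) :
    ∃ k L ζ, 1 ≤ k ∧ HasLocalForm u p k L ζ := by
  obtain ⟨m, U, ζ, L, f, hm, hU, hpU, hζ, -, hbij, hζp, horth, hform, hf⟩ := h
  obtain ⟨k, rfl⟩ : ∃ k, m = k + 1 := ⟨m - 1, by omega⟩
  have hUp : U ∈ 𝓝 p := hU.mem_nhds hpU
  refine ⟨k, L, ζ, by omega, hζ.contMDiffAt hUp, hζp, (hbij p hpU).1, ?_, hf.congr' ?_ .rfl⟩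
  · filter_upwards [hUp] with q hq
    refine ext_inner_left ℝ fun z => ?_
    rw [hform q hq, ContinuousLinearMap.adjoint_inner_right, add_sub_right_comm,
      add_sub_cancel_left, inner_add_right, LinearIsometry.coe_toContinuousLinearMap, horth,
      add_zero, L.inner_map_map]
  · filter_upwards [hUp] with q hq
    rw [hform q hq, add_assoc, add_sub_cancel_left, add_sub_cancel_left]

lemma exists_linearIsometry_range_le {D : Euc 2 →L[ℝ] Euc n} (hD : Function.Injective D) :
    ∃ L : ℂ →ₗᵢ[ℝ] Euc n, ∀ v, D v ∈ range L := by
  set V := LinearMap.range D.toLinearMap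
  have hfin : Module.finrank ℝ V = 2 :=
    (LinearMap.finrank_range_of_inj hD).trans finrank_euclideanSpace_fin
  let I : ℂ ≃ₗᵢ[ℝ] V :=
    Complex.isometryOfOrthonormal ((stdOrthonormalBasis ℝ V).reindex (finCongr hfin))
  refine ⟨V.subtypeₗᵢ.comp I.toLinearIsometry, fun v => ⟨I.symm ⟨D v, v, rfl⟩, ?_⟩⟩
  simp

lemma adjoint_apply_self (L : ℂ →ₗᵢ[ℝ] Euc n) (z : ℂ) :
    ContinuousLinearMap.adjoint L.toContinuousLinearMap (L z) = z :=
  ext_inner_left ℝ fun w => by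
    rw [ContinuousLinearMap.adjoint_inner_right, LinearIsometry.coe_toContinuousLinearMap,
      L.inner_map_map]

lemma isLittleO_sub_linearIsometry_of_hasFDerivWithinAt {f : Euc 2 → Euc n} {s : Set (Euc 2)}
    {y₀ : Euc 2} {D : Euc 2 →L[ℝ] Euc n} (hD : Function.Injective D)
    (hf : HasFDerivWithinAt f D s y₀) {L : ℂ →ₗᵢ[ℝ] Euc n} {B : Euc n →L[ℝ] ℂ}
    (hLB : ∀ v, L (B (D v)) = D v) :
    (fun y => f y - f y₀ - L (B (f y - f y₀))) =o[𝓝[s] y₀] fun y => B (f y - f y₀) := by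
  have hequiv : Asymptotics.IsEquivalent (𝓝[s] y₀) (fun y => f y - f y₀) fun y => D (y - y₀) :=
    hf.isEquivalent_sub
      (D.toLinearMap.isClosedEmbedding_of_injective (LinearMap.ker_eq_bot.2 hD)).isInducing
  have hproj : Asymptotics.IsEquivalent (𝓝[s] y₀) (fun y => L (B (f y - f y₀)))
      fun y => D (y - y₀) := by
    refine (((L.toContinuousLinearMap ∘L B).isBigO_comp _ _).trans_isLittleO
      hequiv.isLittleO).congr_left fun y => ?_
    rw [Pi.sub_apply, map_sub]
    exact congrArg (_ - ·) (hLB _)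
  exact (hequiv.trans hproj.symm).isLittleO.trans_isBigO
    (.of_bound 1 (.of_forall fun y => by rw [L.norm_map, one_mul]))

lemma exists_hasLocalForm_zero (hu : ContMDiff (𝓡∂ 2) 𝓘(ℝ, Euc n) 1 u) {p : M}
    (hinj : Function.Injective (du u p)) : ∃ L ζ, HasLocalForm u p 0 L ζ := by
  set e := extChartAt (𝓡∂ 2) p
  set D := du u p
  obtain ⟨L, hL⟩ := exists_linearIsometry_range_le hinj
  set B := ContinuousLinearMap.adjoint L.toContinuousLinearMap
  have hLB : ∀ v, L (B (D v)) = D v := fun v => by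
    obtain ⟨z, hz⟩ := hL v
    rw [← hz, adjoint_apply_self]
  have hBinj : Function.Injective (B ∘L D) := fun v w hvw => hinj <| by
    rw [← hLB v, ← hLB w]
    exact congrArg L hvw
  have hζ : ContMDiff (𝓡∂ 2) 𝓘(ℝ, ℂ) 1 fun q => B (u q - u p) :=
    (B.contDiff.comp (contDiff_id.sub contDiff_const)).contMDiff.comp hu
  have hder : HasFDerivWithinAt (u ∘ e.symm) D (range (𝓡∂ 2)) (e p) :=
    (hu.mdifferentiable one_ne_zero p).hasMFDerivAt.2
  have hmfderiv : mfderiv (𝓡∂ 2) 𝓘(ℝ, ℂ) (fun q => B (u q - u p)) p = B ∘L D :=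
    HasMFDerivAt.mfderiv ⟨hζ.continuous.continuousAt,
      B.hasFDerivAt.comp_hasFDerivWithinAt _ (hder.sub_const (u p))⟩
  refine ⟨L, fun q => B (u q - u p), hζ.contMDiffAt, by simp only [sub_self, map_zero], ?_,
    .of_forall fun q => by rw [zero_add, pow_one], ?_⟩
  · rw [hmfderiv]
    exact hBinj
  rw [← map_extChartAt_symm_nhdsWithin_range (I := 𝓡∂ 2) p, Asymptotics.isLittleO_map]
  simpa only [Function.comp_def, e, extChartAt_to_inv, zero_add, pow_one] using
    isLittleO_sub_linearIsometry_of_hasFDerivWithinAt hinj hder hLB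

lemma IsBranchedImmersion.exists_hasLocalForm (h : IsBranchedImmersion u) (p : M) :
    ∃ k L ζ, HasLocalForm u p k L ζ ∧ (¬ Function.Injective (du u p) → 1 ≤ k) := by
  rcases h.immersed_or_branch p with hinj | hbranch
  · obtain ⟨L, ζ, hform⟩ := exists_hasLocalForm_zero h.contMDiff hinj
    exact ⟨0, L, ζ, hform, fun hninj => absurd hinj hninj⟩
  · obtain ⟨k, L, ζ, hk, hform⟩ := hbranch.exists_hasLocalForm
    exact ⟨k, L, ζ, hform, fun _ => hk⟩

namespace HasLocalForm

variable {p : M} {k : ℕ} {L : ℂ →ₗᵢ[ℝ] Euc n} {ζ : M → ℂ}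
  (h : HasLocalForm u p k L ζ)
include h

lemma isEquivalent_norm :
    Asymptotics.IsEquivalent (𝓝 p) (fun q => ‖u q - u p‖) fun q => ‖ζ q‖ ^ (k + 1) := by
  have hlittle : (fun q => u q - u p - L (ζ q ^ (k + 1))) =o[𝓝 p] fun q => ‖ζ q‖ ^ (k + 1) :=
    h.isLittleO.norm_right.congr_right fun q => norm_pow _ _
  refine Asymptotics.IsBigO.trans_isLittleO (.of_norm_le fun q => ?_) hlittle.norm_left
  rw [Pi.sub_apply, ← norm_pow, ← L.norm_map]
  exact abs_norm_sub_norm_le _ _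

variable [IsManifold (𝓡∂ 2) 1 M]

lemma hasFDerivWithinAt :
    HasFDerivWithinAt (ζ ∘ (extChartAt (𝓡∂ 2) p).symm)
      (fderivWithin ℝ (ζ ∘ (extChartAt (𝓡∂ 2) p).symm) (range (𝓡∂ 2)) (extChartAt (𝓡∂ 2) p p))
      (range (𝓡∂ 2)) (extChartAt (𝓡∂ 2) p p) :=
  ((contDiffWithinAt_comp_symm (mem_extChartAt_target p) (by
    simpa only [extChartAt_to_inv] using h.contMDiffAt)).differentiableWithinAt
      one_ne_zero).hasFDerivWithinAt

lemma du_eq_zero (hu : ContMDiff (𝓡∂ 2) 𝓘(ℝ, Euc n) 1 u) (hk : 1 ≤ k) : du u p = 0 := by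
  set e := extChartAt (𝓡∂ 2) p
  have hζ : (fun y => ζ (e.symm y)) =O[𝓝[range (𝓡∂ 2)] (e p)] fun y => y - e p := by
    refine h.hasFDerivWithinAt.isBigO_sub.congr_left fun y => ?_
    simp only [Function.comp_apply, e, extChartAt_to_inv, h.apply_eq_zero, sub_zero]
  have hbig : (fun y => u (e.symm y) - u p) =O[𝓝[range (𝓡∂ 2)] (e p)]
      fun y => ‖y - e p‖ ^ (k + 1) :=
    (h.isEquivalent_norm.isBigO.of_norm_left.comp_tendsto (tendsto_extChartAt_symm p)).trans
      (hζ.norm_norm.pow (k + 1))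
  have hder : HasFDerivWithinAt (u ∘ e.symm) (0 : Euc 2 →L[ℝ] Euc n) (range (𝓡∂ 2)) (e p) :=
    (hasFDerivWithinAt_sub_const_iff (u p)).1
      (hbig.hasFDerivWithinAt (mem_range_self _) (Nat.lt_add_of_pos_left hk))
  rw [du_eq_chartDeriv hu]
  exact hder.fderivWithin ((𝓡∂ 2).uniqueDiffOn _ (mem_range_self _))

end HasLocalForm

end BranchPoints

section Boundary

variable {n : ℕ} {M : Type*} [TopologicalSpace M] [ChartedSpace (EuclideanHalfSpace 2) M]
  {u : M → Euc n} {γ : ℝ → Euc n} {p : M}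

lemma extChartAt_pos_of_isInteriorPoint (hp : (𝓡∂ 2).IsInteriorPoint p) :
    0 < (extChartAt (𝓡∂ 2) p p) 0 := by
  rw [ModelWithCorners.isInteriorPoint_iff] at hp
  have hmem := interior_mono (extChartAt_target_subset_range p) hp
  rwa [interior_range_modelWithCornersEuclideanHalfSpace] at hmem

lemma extChartAt_eq_zero_of_isBoundaryPoint (hp : (𝓡∂ 2).IsBoundaryPoint p) :
    (extChartAt (𝓡∂ 2) p p) 0 = 0 := by
  have hmem : extChartAt (𝓡∂ 2) p p ∈ frontier (range (𝓡∂ 2)) := hp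
  rw [frontier_range_modelWithCornersEuclideanHalfSpace] at hmem
  exact hmem.symm

lemma norm_conormal_le (u : M → Euc n) (p : M) : ‖conormal u p‖ ≤ 1 := by
  rw [conormal, norm_smul, norm_neg, norm_inv, norm_norm]
  exact inv_mul_le_one

lemma inner_du_conormal (u : M → Euc n) (p : M) :
    ⟪du u p (EuclideanSpace.single 1 1), conormal u p⟫ = 0 := by
  rw [conormal, real_inner_smul_right, Submodule.mem_orthogonal_singleton_iff_inner_right.1
    (Submodule.starProjection_apply_mem _ _), mul_zero]

section C1Manifold

variable [IsManifold (𝓡∂ 2) 1 M]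

lemma isBoundaryPoint_extChartAt_symm {y : Euc 2} (hy : y ∈ (extChartAt (𝓡∂ 2) p).target)
    (h0 : y 0 = 0) : (𝓡∂ 2).IsBoundaryPoint ((extChartAt (𝓡∂ 2) p).symm y) := by
  have hs := (extChartAt (𝓡∂ 2) p).map_target hy
  rw [extChartAt_source] at hs
  rw [ModelWithCorners.isBoundaryPoint_iff_not_isInteriorPoint,
    (𝓡∂ 2).isInteriorPoint_iff_of_mem_atlas one_ne_zero (chart_mem_atlas _ p) hs]
  intro hint
  have hmem : extChartAt (𝓡∂ 2) p ((extChartAt (𝓡∂ 2) p).symm y) ∈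
      interior (extChartAt (𝓡∂ 2) p).target := hint
  rw [(extChartAt (𝓡∂ 2) p).right_inv hy] at hmem
  have hpos := interior_mono (extChartAt_target_subset_range p) hmem
  rw [interior_range_modelWithCornersEuclideanHalfSpace] at hpos
  exact hpos.ne' h0

lemma rejection_du_eq_zero (hu : ContMDiff (𝓡∂ 2) 𝓘(ℝ, Euc n) 1 u) (hγ : IsC1ClosedCurve γ)
    (himg : u '' ((𝓡∂ 2).boundary M) = range γ) (hp : (𝓡∂ 2).IsBoundaryPoint p) {t : ℝ}
    (ht : γ t = u p) :
    rejection (unitTangent γ t) (du u p (EuclideanSpace.single 1 1)) = 0 := by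
  set e := extChartAt (𝓡∂ 2) p
  have h0 : (e p) 0 = 0 := extChartAt_eq_zero_of_isBoundaryPoint hp
  let ℓ : ℝ → Euc 2 := fun τ => e p + τ • EuclideanSpace.single 1 1
  have hℓ0 : ∀ τ, (ℓ τ) 0 = 0 := fun τ => by simp [ℓ, h0]
  have hℓr : ∀ τ, ℓ τ ∈ range (𝓡∂ 2) := fun τ => mem_range_half_iff.2 (hℓ0 τ).ge
  have hℓz : ℓ 0 = e p := by simp only [ℓ, zero_smul, add_zero]
  have hℓd : HasDerivAt ℓ (EuclideanSpace.single 1 1) 0 :=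
    (((hasDerivAt_id (0 : ℝ)).smul_const _).const_add (e p)).congr_deriv (one_smul _ _)
  have hℓt : Filter.Tendsto ℓ (𝓝 0) (𝓝[range (𝓡∂ 2)] (e p)) :=
    tendsto_nhdsWithin_iff.2 ⟨hℓz ▸ hℓd.continuousAt.tendsto, .of_forall hℓr⟩
  have hder : HasFDerivWithinAt (u ∘ e.symm) (chartDeriv u p (e p)) (range (𝓡∂ 2)) (ℓ 0) := by
    rw [hℓz]
    exact ((contDiffWithinAt_comp_symm (mem_extChartAt_target p) (hu _)).differentiableWithinAt
      one_ne_zero).hasFDerivWithinAt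
  rw [du_eq_chartDeriv hu]
  refine hγ.rejection_eq_zero_of_hasDerivAt (hder.comp_hasDerivAt 0 hℓd (.of_forall hℓr)) ?_ ?_
  · filter_upwards [hℓt.eventually (extChartAt_target_mem_nhdsWithin p)] with τ hτ
    rw [← himg]
    exact ⟨_, isBoundaryPoint_extChartAt_symm hτ (hℓ0 τ), rfl⟩
  · rw [Function.comp, Function.comp, hℓz, extChartAt_to_inv, ht]

lemma inner_unitTangent_conormal (hu : IsBranchedImmersion u) (hγ : IsC1ClosedCurve γ)
    (himg : u '' ((𝓡∂ 2).boundary M) = range γ) (hp : (𝓡∂ 2).IsBoundaryPoint p) {t : ℝ}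
    (ht : γ t = u p) : ⟪unitTangent γ t, conormal u p⟫ = 0 := by
  rcases hu.immersed_or_branch p with hinj | hbranch
  · set b := du u p (EuclideanSpace.single 1 1) with hb
    have hbT : b = ⟪unitTangent γ t, b⟫ • unitTangent γ t :=
      sub_eq_zero.1 (rejection_du_eq_zero hu.contMDiff hγ himg hp ht)
    have hTb : ⟪unitTangent γ t, b⟫ ≠ 0 := by
      intro hzero
      rw [hzero, zero_smul, hb, ← map_zero (du u p)] at hbT
      simpa using hinj hbT
    have hbν : ⟪b, conormal u p⟫ = 0 := inner_du_conormal u p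
    rw [hbT, real_inner_smul_left] at hbν
    exact (mul_eq_zero.1 hbν).resolve_left hTb
  · obtain ⟨k, L, ζ, hk, hform⟩ := hbranch.exists_hasLocalForm
    simp [conormal, hform.du_eq_zero hu.contMDiff hk]

lemma abs_inner_radialField_conormal_le (hu : IsBranchedImmersion u) (hγ : IsC1ClosedCurve γ)
    (himg : u '' ((𝓡∂ 2).boundary M) = range γ) (hp : (𝓡∂ 2).IsBoundaryPoint p) {t : ℝ}
    (ht : γ t = u p) (s : ℝ) (x : Euc n) :
    |⟪radialField s x (u p), conormal u p⟫| ≤ fluxSpeed s (unitTangent γ t) (γ t - x) := by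
  have hrej : ⟪u p - x, conormal u p⟫ =
      ⟪rejection (unitTangent γ t) (u p - x), conormal u p⟫ := by
    rw [rejection, inner_sub_left (u p - x), real_inner_smul_left,
      inner_unitTangent_conormal hu hγ himg hp ht, mul_zero, sub_zero]
  rw [radialField, real_inner_smul_left, hrej, abs_mul, abs_of_nonneg (by positivity), fluxSpeed,
    ht, inv_mul_eq_div]
  gcongr
  exact (abs_real_inner_le_norm _ _).trans
    (mul_le_of_le_one_right (norm_nonneg _) (norm_conormal_le u p))

variable [CompactSpace M] [MeasurableSpace M] [BorelSpace M]

lemma lintegral_boundaryLength_le (hu : Continuous u) (hγ : IsC1ClosedCurve γ)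
    (hinj : InjOn u ((𝓡∂ 2).boundary M)) (himg : u '' ((𝓡∂ 2).boundary M) = range γ)
    {f : (𝓡∂ 2).boundary M → ℝ≥0∞} {φ : ℝ → ℝ≥0∞}
    (hfφ : ∀ (p : (𝓡∂ 2).boundary M) t, γ t = u p → f p ≤ φ t) :
    ∫⁻ p, f p ∂(boundaryLength u) ≤ ∫⁻ t in Ico (0 : ℝ) 1, ‖deriv γ t‖ₑ * φ t := by
  have hclosed : IsClosed ((𝓡∂ 2).boundary M) := (𝓡∂ 2).isClosed_boundary (n := 1) one_ne_zero
  have : CompactSpace ((𝓡∂ 2).boundary M) := isCompact_iff_compactSpace.1 hclosed.isCompact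
  let ub : (𝓡∂ 2).boundary M → Euc n := fun p => u p
  have hub : MeasurableEmbedding ub :=
    ((hu.comp continuous_subtype_val).isClosedEmbedding hinj.injective).measurableEmbedding
  have hrange : range ub = range γ := by rw [← himg, image_eq_range]
  let param := Function.invFunOn γ (Ico 0 1)
  have hparam : ∀ p : (𝓡∂ 2).boundary M, γ (param (ub p)) = u p := fun p => by
    obtain ⟨τ, hτ⟩ : u p ∈ range γ := himg ▸ mem_image_of_mem u p.2
    obtain ⟨t, ht, hτt⟩ := hγ.periodic.exists_mem_Ico₀ one_pos τ
    exact Function.invFunOn_eq ⟨t, ht, hτt ▸ hτ⟩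
  calc ∫⁻ p, f p ∂(boundaryLength u)
      ≤ ∫⁻ p, φ (param (ub p)) ∂(boundaryLength u) := lintegral_mono fun p => hfφ p _ (hparam p)
    _ = ∫⁻ y in range γ, φ (param y) ∂μH[1] := by
        rw [← hub.lintegral_map fun y => φ (param y), boundaryLength, hub.map_comap, hrange]
    _ ≤ ∫⁻ t in Ico (0 : ℝ) 1, ‖deriv γ t‖ₑ * φ (param (γ t)) :=
        lintegral_range_le_lintegral_deriv hγ.contDiff hγ.periodic fun y => φ (param y)
    _ = ∫⁻ t in Ico (0 : ℝ) 1, ‖deriv γ t‖ₑ * φ t :=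
        setLIntegral_congr_fun measurableSet_Ico fun t ht => by
          simp only [param, hγ.injOn.leftInvOn_invFunOn ht]

lemma integral_inner_radialField_conormal_le (hu : IsBranchedImmersion u)
    (hγ : IsC1ClosedCurve γ) (hinj : InjOn u ((𝓡∂ 2).boundary M))
    (himg : u '' ((𝓡∂ 2).boundary M) = range γ) {s : ℝ} (hs : 0 < s) (x : Euc n) :
    ∫ p : (𝓡∂ 2).boundary M, ⟪radialField s x (u p), conormal u p⟫ ∂(boundaryLength u) ≤
      ∫ t in (0 : ℝ)..1, fluxSpeed s (unitTangent γ t) (γ t - x) * ‖deriv γ t‖ := by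
  have hcont := continuous_fluxSpeed_mul hγ.contDiff hγ.deriv_ne_zero hs x
  have hnonneg : ∀ t, 0 ≤ fluxSpeed s (unitTangent γ t) (γ t - x) * ‖deriv γ t‖ := fun t =>
    mul_nonneg (fluxSpeed_nonneg _ _ _) (norm_nonneg _)
  have hflux : ∫⁻ t in Ico (0 : ℝ) 1,
        ‖deriv γ t‖ₑ * ENNReal.ofReal (fluxSpeed s (unitTangent γ t) (γ t - x)) =
      ENNReal.ofReal
        (∫ t in (0 : ℝ)..1, fluxSpeed s (unitTangent γ t) (γ t - x) * ‖deriv γ t‖) := by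
    rw [intervalIntegral.integral_of_le zero_le_one, ofReal_integral_eq_lintegral_ofReal
      hcont.integrableOn_Ioc (.of_forall hnonneg), setLIntegral_congr Ico_ae_eq_Ioc]
    refine lintegral_congr fun t => ?_
    rw [mul_comm, ENNReal.ofReal_mul (fluxSpeed_nonneg _ _ _), ofReal_norm]
  refine (Real.le_norm_self _).trans ((norm_integral_le_lintegral_norm _).trans ?_)
  refine ENNReal.toReal_le_of_le_ofReal
    (intervalIntegral.integral_nonneg zero_le_one fun t _ => hnonneg t) (hflux ▸ ?_)
  exact lintegral_boundaryLength_le hu.contMDiff.continuous hγ hinj himg fun p t ht =>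
    ENNReal.ofReal_le_ofReal (abs_inner_radialField_conormal_le hu hγ himg p.2 ht s x)

end C1Manifold

end Boundary

section LocalModel

/-- The standard identification of `ℂ` with the Euclidean plane. -/
def complexIso : ℂ ≃ₗᵢ[ℝ] Euc 2 := Complex.orthonormalBasisOneI.repr

lemma det_complexIso_comp_smul (c : ℂ) (G : Euc 2 →L[ℝ] ℂ) :
    ((complexIso : ℂ →L[ℝ] Euc 2) ∘L (c • G)).det =
      ‖c‖ ^ 2 * ((complexIso : ℂ →L[ℝ] Euc 2) ∘L G).det := by
  set J := complexIso.toLinearEquiv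
  have hconj : ((complexIso : ℂ →L[ℝ] Euc 2) ∘L (c • G)).toLinearMap =
      (J.toLinearMap ∘ₗ Algebra.lmul ℝ ℂ c ∘ₗ J.symm.toLinearMap) ∘ₗ
        ((complexIso : ℂ →L[ℝ] Euc 2) ∘L G).toLinearMap := by
    ext v : 1
    simp [J]
  rw [ContinuousLinearMap.det, hconj, LinearMap.det_comp, LinearMap.det_conj, ← Algebra.norm_apply,
    Algebra.norm_complex_apply, Complex.normSq_eq_norm_sq, ContinuousLinearMap.det]

variable {n : ℕ} {M : Type*} [TopologicalSpace M] [ChartedSpace (EuclideanHalfSpace 2) M]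

/-- The derivative of a complex coordinate `ζ` read in the chart at `p`, as a map of the plane. -/
def coordDeriv (ζ : M → ℂ) (p : M) (y : Euc 2) : Euc 2 →L[ℝ] Euc 2 :=
  (complexIso : ℂ →L[ℝ] Euc 2) ∘L
    fderivWithin ℝ (ζ ∘ (extChartAt (𝓡∂ 2) p).symm) (range (𝓡∂ 2)) y

/-- The vector `w` points from `p` into the chart at `p`: no condition at an interior point, and
`0 ≤ w 0` at a boundary point. -/
def IsInward (p : M) (w : Euc 2) : Prop :=
  ∀ᶠ c in 𝓝[>] (0 : ℝ), extChartAt (𝓡∂ 2) p p + c • w ∈ range (𝓡∂ 2)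

variable {p : M} {w : Euc 2}

lemma IsInward.tendsto_add_smul (hw : IsInward p w) :
    Filter.Tendsto (fun c : ℝ => extChartAt (𝓡∂ 2) p p + c • w) (𝓝[>] 0)
      (𝓝[range (𝓡∂ 2)] (extChartAt (𝓡∂ 2) p p)) :=
  tendsto_nhdsWithin_iff.2 ⟨(Continuous.tendsto' (by fun_prop) _ _ (by simp)).mono_left
    nhdsWithin_le_nhds, hw⟩

namespace HasLocalForm

variable [IsManifold (𝓡∂ 2) 1 M] {u : M → Euc n} {k : ℕ} {L : ℂ →ₗᵢ[ℝ] Euc n} {ζ : M → ℂ}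
  (h : HasLocalForm u p k L ζ)
include h

lemma injective_coordDeriv : Function.Injective (coordDeriv ζ p (extChartAt (𝓡∂ 2) p p)) := by
  have hζ : MDifferentiableAt (𝓡∂ 2) 𝓘(ℝ, ℂ) ζ
      ((extChartAt (𝓡∂ 2) p).symm (extChartAt (𝓡∂ 2) p p)) := by
    simpa only [extChartAt_to_inv] using h.contMDiffAt.mdifferentiableAt one_ne_zero
  rw [coordDeriv, fderivWithin_comp_symm (mem_extChartAt_target p) hζ, extChartAt_to_inv]
  exact complexIso.injective.comp
    (h.injective_mfderiv.comp (symmDeriv_bijective (mem_extChartAt_target p)).1)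

lemma det_coordDeriv_ne_zero : (coordDeriv ζ p (extChartAt (𝓡∂ 2) p p)).det ≠ 0 := by
  rw [← abs_ne_zero, ← jacobian_eq_abs_det, jacobian_ne_zero_iff]
  exact h.injective_coordDeriv

lemma eventually_adjoint_comp_chartDeriv (hu : ContMDiff (𝓡∂ 2) 𝓘(ℝ, Euc n) 1 u) :
    ∀ᶠ y in 𝓝[range (𝓡∂ 2)] (extChartAt (𝓡∂ 2) p p),
      ContinuousLinearMap.adjoint L.toContinuousLinearMap ∘L chartDeriv u p y =
        ((k + 1 : ℕ) * ζ ((extChartAt (𝓡∂ 2) p).symm y) ^ k : ℂ) •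
          fderivWithin ℝ (ζ ∘ (extChartAt (𝓡∂ 2) p).symm) (range (𝓡∂ 2)) y := by
  set e := extChartAt (𝓡∂ 2) p
  set B := ContinuousLinearMap.adjoint L.toContinuousLinearMap
  have hsymm := tendsto_extChartAt_symm p
  filter_upwards [self_mem_nhdsWithin, extChartAt_target_mem_nhdsWithin p,
    hsymm.eventually ((contMDiffAt_iff_contMDiffAt_nhds (by simp)).1 h.contMDiffAt),
    eventually_eventually_nhdsWithin.2 (hsymm.eventually h.adjoint_apply)] with y hyr hyt hζ hform
  have hu' : HasFDerivWithinAt (fun y => B ((u ∘ e.symm) y - u p)) (B ∘L chartDeriv u p y)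
      (range (𝓡∂ 2)) y :=
    B.hasFDerivAt.comp_hasFDerivWithinAt y
      (((contDiffWithinAt_comp_symm hyt (hu _)).differentiableWithinAt
        one_ne_zero).hasFDerivWithinAt.sub_const (u p))
  have hζ' : HasFDerivWithinAt (ζ ∘ e.symm) (fderivWithin ℝ (ζ ∘ e.symm) (range (𝓡∂ 2)) y)
      (range (𝓡∂ 2)) y :=
    ((contDiffWithinAt_comp_symm hyt hζ).differentiableWithinAt one_ne_zero).hasFDerivWithinAt
  refine ((𝓡∂ 2).uniqueDiffOn y hyr).eq
    (hu'.congr_of_eventuallyEq (hform.mono fun z hz => hz.symm) (hform.self_of_nhdsWithin hyr).symm)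
    ((hζ'.pow (k + 1)).congr_fderiv ?_)
  ext v
  simp

lemma eventually_le_chartJacobian (hu : ContMDiff (𝓡∂ 2) 𝓘(ℝ, Euc n) 1 u) :
    ∀ᶠ y in 𝓝[range (𝓡∂ 2)] (extChartAt (𝓡∂ 2) p p),
      ((k + 1) * ‖ζ ((extChartAt (𝓡∂ 2) p).symm y)‖ ^ k) ^ 2 * |(coordDeriv ζ p y).det| ≤
        chartJacobian u p y := by
  set B := ContinuousLinearMap.adjoint L.toContinuousLinearMap
  have hB : ‖B‖ ≤ 1 := by
    rw [LinearIsometryEquiv.norm_map]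
    exact L.norm_toContinuousLinearMap_le
  filter_upwards [h.eventually_adjoint_comp_chartDeriv hu] with y hy
  calc _ = |((complexIso : ℂ →L[ℝ] Euc 2) ∘L (B ∘L chartDeriv u p y)).det| := by
        rw [hy, det_complexIso_comp_smul, coordDeriv, abs_mul, abs_sq, norm_mul, norm_pow,
          Complex.norm_natCast, Nat.cast_succ]
    _ ≤ chartJacobian u p y := by
        rw [← ContinuousLinearMap.comp_assoc]
        exact abs_det_comp_le_jacobian _ _ fun x =>
          (complexIso.norm_map (B x)).trans_le (B.le_of_opNorm_le_of_le hB le_rfl |>.trans_eq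
            (one_mul _))

lemma tendsto_norm_div (hw : IsInward p w) :
    Filter.Tendsto (fun c : ℝ => ‖ζ ((extChartAt (𝓡∂ 2) p).symm (extChartAt (𝓡∂ 2) p p + c • w))‖ /
      c) (𝓝[>] 0) (𝓝 ‖coordDeriv ζ p (extChartAt (𝓡∂ 2) p p) w‖) := by
  have hcw : Filter.Tendsto (fun c : ℝ => c • w) (𝓝[>] 0) (𝓝 0) :=
    (Continuous.tendsto' (by fun_prop) 0 0 (zero_smul ℝ w)).mono_left nhdsWithin_le_nhds
  have hcancel : Filter.Tendsto (fun c : ℝ => c⁻¹ • c • w) (𝓝[>] 0) (𝓝 w) :=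
    tendsto_const_nhds.congr' <| by
      filter_upwards [self_mem_nhdsWithin] with c hc
      rw [inv_smul_smul₀ (ne_of_gt hc)]
  have hlim := (h.hasFDerivWithinAt.lim hcw hw hcancel).norm
  rw [coordDeriv, ContinuousLinearMap.comp_apply]
  refine (complexIso.norm_map _).symm ▸ hlim.congr' ?_
  filter_upwards [self_mem_nhdsWithin] with c hc
  rw [Function.comp_apply, Function.comp_apply, extChartAt_to_inv, h.apply_eq_zero, sub_zero,
    norm_smul, norm_inv, Real.norm_of_nonneg (le_of_lt hc), inv_mul_eq_div]

lemma tendsto_jacobian_bound_div (hw : IsInward p w) :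
    Filter.Tendsto (fun c : ℝ =>
      ((k + 1) * ‖ζ ((extChartAt (𝓡∂ 2) p).symm (extChartAt (𝓡∂ 2) p p + c • w))‖ ^ k) ^ 2 *
        |(coordDeriv ζ p (extChartAt (𝓡∂ 2) p p + c • w)).det| / c ^ (2 * k)) (𝓝[>] 0)
      (𝓝 ((k + 1) ^ 2 * ‖coordDeriv ζ p (extChartAt (𝓡∂ 2) p p) w‖ ^ (2 * k) *
        |(coordDeriv ζ p (extChartAt (𝓡∂ 2) p p)).det|)) := by
  have hcont : ContinuousWithinAt (fun y => |(coordDeriv ζ p y).det|) (range (𝓡∂ 2))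
      (extChartAt (𝓡∂ 2) p p) := by
    have hfderiv := continuousWithinAt_fderivWithin_comp_symm (mem_extChartAt_target p)
      ((extChartAt_to_inv (I := 𝓡∂ 2) p).symm ▸ h.contMDiffAt)
    refine (ContinuousLinearMap.continuous_det.comp
      (by fun_prop : Continuous fun G => (complexIso : ℂ →L[ℝ] Euc 2) ∘L G)).abs.continuousAt
      |>.comp_continuousWithinAt hfderiv
  refine ((((h.tendsto_norm_div hw).pow (2 * k)).const_mul ((k + 1 : ℝ) ^ 2)).mul
    (hcont.tendsto.comp hw.tendsto_add_smul)).congr fun c => ?_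
  rw [Function.comp_apply]
  ring

lemma tendsto_norm_sub_div (hw : IsInward p w) :
    Filter.Tendsto (fun c : ℝ => ‖u ((extChartAt (𝓡∂ 2) p).symm (extChartAt (𝓡∂ 2) p p + c • w)) -
      u p‖ / c ^ (k + 1)) (𝓝[>] 0)
      (𝓝 (‖coordDeriv ζ p (extChartAt (𝓡∂ 2) p p) w‖ ^ (k + 1))) :=
  ((h.isEquivalent_norm.comp_tendsto
    ((tendsto_extChartAt_symm p).comp hw.tendsto_add_smul)).div .refl).symm.tendsto_nhds
      (((h.tendsto_norm_div hw).pow (k + 1)).congr fun _ => div_pow _ _ _)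

end HasLocalForm

end LocalModel

section LocalDensity

variable {n : ℕ} {M : Type*} [TopologicalSpace M] [ChartedSpace (EuclideanHalfSpace 2) M]
  {u : M → Euc n} {p : M} {V : Set M}

/-- The density at `y` of the Poisson integral over `V` at height `s` above `u p`, in the chart at
`p`; it vanishes outside the part of the chart that parametrises `V`. -/
def chartPoisson (u : M → Euc n) (p : M) (V : Set M) (s : ℝ) : Euc 2 → ℝ≥0∞ :=
  indicator ((extChartAt (𝓡∂ 2) p).target ∩ (extChartAt (𝓡∂ 2) p).symm ⁻¹' V) fun y =>
    ENNReal.ofReal (chartJacobian u p y) *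
      ENNReal.ofReal (poissonDensity u s (u p) ((extChartAt (𝓡∂ 2) p).symm y))

lemma tendsto_rpow_inv_nhdsGT {m : ℕ} (hm : m ≠ 0) :
    Filter.Tendsto (fun s : ℝ => s ^ ((m : ℝ)⁻¹)) (𝓝[>] 0) (𝓝[>] 0) := by
  have hinv : 0 < (m : ℝ)⁻¹ := by positivity
  refine tendsto_nhdsWithin_iff.2 ⟨?_, ?_⟩
  · have hlim := (Real.continuousAt_rpow_const 0 ((m : ℝ)⁻¹) (Or.inr hinv.le)).tendsto
    rw [Real.zero_rpow hinv.ne'] at hlim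
    exact hlim.mono_left nhdsWithin_le_nhds
  · filter_upwards [self_mem_nhdsWithin] with s hs using Real.rpow_pos_of_pos hs _

lemma isInward_of_isInteriorPoint (hp : (𝓡∂ 2).IsInteriorPoint p) (w : Euc 2) : IsInward p w := by
  have hlim : Filter.Tendsto (fun c : ℝ => (extChartAt (𝓡∂ 2) p p + c • w) 0) (𝓝[>] 0)
      (𝓝 ((extChartAt (𝓡∂ 2) p p) 0)) :=
    (Continuous.tendsto' (by fun_prop) 0 _ (by rw [zero_smul, add_zero])).mono_left
      nhdsWithin_le_nhds
  exact (hlim.eventually_const_lt (extChartAt_pos_of_isInteriorPoint hp)).mono fun _ hc =>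
    mem_range_half_iff.2 hc.le

lemma isInward_of_isBoundaryPoint (hp : (𝓡∂ 2).IsBoundaryPoint p) {w : Euc 2} (hw : 0 < w 0) :
    IsInward p w := by
  filter_upwards [self_mem_nhdsWithin] with c hc
  rw [mem_range_half_iff, PiLp.add_apply, PiLp.smul_apply, extChartAt_eq_zero_of_isBoundaryPoint hp,
    smul_eq_mul, zero_add]
  exact mul_nonneg (le_of_lt hc) hw.le

variable [IsManifold (𝓡∂ 2) 1 M] [MeasurableSpace M] [BorelSpace M]

section

variable (hu : ContMDiff (𝓡∂ 2) 𝓘(ℝ, Euc n) 1 u)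
include hu

lemma measurable_chartPoisson (p : M) (hV : MeasurableSet V) (s : ℝ) :
    Measurable (chartPoisson u p V s) := by
  set e := extChartAt (𝓡∂ 2) p
  set T := e.target ∩ e.symm ⁻¹' V
  have hJ : ContinuousOn (chartJacobian u p) T := fun _ hy =>
    ((continuousWithinAt_chartJacobian hu hy.1).mono (extChartAt_target_subset_range p)).mono
      inter_subset_left
  have hsymm : ContinuousOn e.symm T := (continuousOn_extChartAt_symm p).mono inter_subset_left
  have hnorm : ContinuousOn (fun y => ‖u (e.symm y) - u p‖) T :=
    ((hu.continuous.comp_continuousOn hsymm).sub continuousOn_const).norm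
  have hon : T.domRestrict (chartPoisson u p V s) = fun y : T =>
      ENNReal.ofReal (chartJacobian u p y) *
        ENNReal.ofReal (poissonDensity u s (u p) (e.symm y)) :=
    funext fun y => by rw [domRestrict_apply, chartPoisson, indicator_of_mem y.2]
  have hoff : Tᶜ.domRestrict (chartPoisson u p V s) = 0 :=
    funext fun y => by rw [domRestrict_apply, chartPoisson, indicator_of_notMem y.2, Pi.zero_apply]
  refine measurable_of_restrict_of_restrict_compl (measurableSet_target_inter_preimage p hV) ?_ ?_
  · rw [hon]
    exact (continuousOn_iff_continuous_domRestrict.1 hJ).measurable.ennreal_ofReal.mul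
      (((((continuousOn_iff_continuous_domRestrict.1 hnorm).measurable.pow_const 2).add_const
        _).pow_const 2).const_div _).ennreal_ofReal
  · rw [hoff]
    exact measurable_zero

lemma lintegral_chartPoisson_le (p : M) (hV : MeasurableSet V) {s : ℝ} (hs : 0 < s) :
    ∫⁻ y, chartPoisson u p V s y ≤
      ∫⁻ q in V, ENNReal.ofReal (poissonDensity u s (u p) q) ∂(area u) := by
  have hmeas : Measurable fun q => ENNReal.ofReal (poissonDensity u s (u p) q) :=
    (continuous_poissonDensity hs (u p) hu.continuous).measurable.ennreal_ofReal
  unfold chartPoisson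
  rw [lintegral_indicator (measurableSet_target_inter_preimage p hV),
    ← setLIntegral_chartArea hu p hmeas hV]
  exact lintegral_mono' (Measure.restrict_mono le_rfl (chartArea_le_area u p)) le_rfl

end

namespace HasLocalForm

variable {k : ℕ} {L : ℂ →ₗᵢ[ℝ] Euc n} {ζ : M → ℂ} {w : Euc 2} (h : HasLocalForm u p k L ζ)
include h

omit [MeasurableSpace M] [BorelSpace M] in
lemma tendsto_modelDensity (hw : IsInward p w) :
    Filter.Tendsto (fun c : ℝ =>
      ((k + 1) * ‖ζ ((extChartAt (𝓡∂ 2) p).symm (extChartAt (𝓡∂ 2) p p + c • w))‖ ^ k) ^ 2 *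
        |(coordDeriv ζ p (extChartAt (𝓡∂ 2) p p + c • w)).det| / c ^ (2 * k) /
      ((‖u ((extChartAt (𝓡∂ 2) p).symm (extChartAt (𝓡∂ 2) p p + c • w)) - u p‖ /
        c ^ (k + 1)) ^ 2 + 1) ^ 2) (𝓝[>] 0)
      (𝓝 (modelDensity k ‖coordDeriv ζ p (extChartAt (𝓡∂ 2) p p) w‖ *
        |(coordDeriv ζ p (extChartAt (𝓡∂ 2) p p)).det|)) := by
  set r := ‖coordDeriv ζ p (extChartAt (𝓡∂ 2) p p) w‖
  have hdensity (d : ℝ) : modelDensity k r * d =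
      (k + 1) ^ 2 * r ^ (2 * k) * d / ((r ^ (k + 1)) ^ 2 + 1) ^ 2 := by
    rw [modelDensity]
    ring
  rw [hdensity]
  exact (h.tendsto_jacobian_bound_div hw).div
    ((((h.tendsto_norm_sub_div hw).pow 2).add_const 1).pow 2) (by positivity)

omit [MeasurableSpace M] [BorelSpace M] in
lemma eventually_le_chartPoisson (hu : ContMDiff (𝓡∂ 2) 𝓘(ℝ, Euc n) 1 u) (hV : V ∈ 𝓝 p)
    (hw : IsInward p w) : ∀ᶠ c in 𝓝[>] (0 : ℝ), ENNReal.ofReal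
      (((k + 1) * ‖ζ ((extChartAt (𝓡∂ 2) p).symm (extChartAt (𝓡∂ 2) p p + c • w))‖ ^ k) ^ 2 *
        |(coordDeriv ζ p (extChartAt (𝓡∂ 2) p p + c • w)).det| / c ^ (2 * k) /
      ((‖u ((extChartAt (𝓡∂ 2) p).symm (extChartAt (𝓡∂ 2) p p + c • w)) - u p‖ /
        c ^ (k + 1)) ^ 2 + 1) ^ 2) ≤
      ENNReal.ofReal (c ^ 2) *
        chartPoisson u p V (c ^ (k + 1)) (extChartAt (𝓡∂ 2) p p + c • w) := by
  have hpatch : ∀ᶠ y in 𝓝[range (𝓡∂ 2)] (extChartAt (𝓡∂ 2) p p),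
      y ∈ (extChartAt (𝓡∂ 2) p).target ∩ (extChartAt (𝓡∂ 2) p).symm ⁻¹' V :=
    Filter.inter_mem (extChartAt_target_mem_nhdsWithin p) (tendsto_extChartAt_symm p hV)
  filter_upwards [self_mem_nhdsWithin, hw.tendsto_add_smul.eventually hpatch,
    hw.tendsto_add_smul.eventually (h.eventually_le_chartJacobian hu)] with c hc hmem hle
  have : 0 < c := hc
  rw [chartPoisson, indicator_of_mem hmem,
    ← ENNReal.ofReal_mul' (poissonDensity_nonneg _ _ _ _), ← ENNReal.ofReal_mul (sq_nonneg c)]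
  set y := extChartAt (𝓡∂ 2) p p + c • w
  set j := ((k + 1) * ‖ζ ((extChartAt (𝓡∂ 2) p).symm y)‖ ^ k) ^ 2 * |(coordDeriv ζ p y).det|
  have hscale : j / c ^ (2 * k) /
      ((‖u ((extChartAt (𝓡∂ 2) p).symm y) - u p‖ / c ^ (k + 1)) ^ 2 + 1) ^ 2 =
      c ^ 2 * (j * poissonDensity u (c ^ (k + 1)) (u p) ((extChartAt (𝓡∂ 2) p).symm y)) := by
    rw [poissonDensity]
    field_simp
    ring
  rw [hscale]
  gcongr
  exact poissonDensity_nonneg _ _ _ _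

omit [MeasurableSpace M] [BorelSpace M] in
lemma ofReal_modelDensity_le_liminf (hu : ContMDiff (𝓡∂ 2) 𝓘(ℝ, Euc n) 1 u) (hV : V ∈ 𝓝 p)
    (hw : IsInward p w) :
    ENNReal.ofReal (modelDensity k ‖coordDeriv ζ p (extChartAt (𝓡∂ 2) p p) w‖ *
        |(coordDeriv ζ p (extChartAt (𝓡∂ 2) p p)).det|) ≤
      Filter.liminf (fun s : ℝ => ENNReal.ofReal ((s ^ (((k + 1 : ℕ) : ℝ)⁻¹)) ^ 2) *
        chartPoisson u p V s (extChartAt (𝓡∂ 2) p p + s ^ (((k + 1 : ℕ) : ℝ)⁻¹) • w))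
        (𝓝[>] 0) := by
  have hroot := tendsto_rpow_inv_nhdsGT k.succ_ne_zero
  rw [← ((ENNReal.continuous_ofReal.tendsto _).comp
    ((h.tendsto_modelDensity hw).comp hroot)).liminf_eq]
  refine Filter.liminf_le_liminf ?_
  filter_upwards [self_mem_nhdsWithin, hroot.eventually (h.eventually_le_chartPoisson hu hV hw)]
    with s hs hle
  simpa only [Function.comp_apply, Real.rpow_inv_natCast_pow (le_of_lt hs) k.succ_ne_zero] using hle

-- The rescaling `y = e p + s ^ (1 / (k + 1)) • w` turns `u` into the model map
-- `w ↦ (A w) ^ (k + 1)` seen from unit height.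
lemma setLIntegral_modelDensity_le_liminf (hu : ContMDiff (𝓡∂ 2) 𝓘(ℝ, Euc n) 1 u) (hV : IsOpen V)
    (hpV : p ∈ V) {Ω : Set (Euc 2)} (hΩ : MeasurableSet Ω) (hinward : ∀ w ∈ Ω, IsInward p w) :
    ∫⁻ w in Ω, ENNReal.ofReal (modelDensity k ‖coordDeriv ζ p (extChartAt (𝓡∂ 2) p p) w‖ *
        |(coordDeriv ζ p (extChartAt (𝓡∂ 2) p p)).det|) ≤
      Filter.liminf (fun s => ∫⁻ q in V, ENNReal.ofReal (poissonDensity u s (u p) q) ∂(area u))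
        (𝓝[>] (0 : ℝ)) := by
  rw [← lintegral_indicator hΩ]
  refine (lintegral_le_liminf_of_rescaled volume (extChartAt (𝓡∂ 2) p p)
    (measurable_chartPoisson hu p hV.measurableSet)
    (c := fun s => s ^ (((k + 1 : ℕ) : ℝ)⁻¹)) (fun s hs => Real.rpow_pos_of_pos hs _)
    (.of_forall fun w => ?_)).trans (Filter.liminf_le_liminf ?_)
  · rw [finrank_euclideanSpace_fin]
    exact indicator_le (fun w hw =>
      h.ofReal_modelDensity_le_liminf hu (hV.mem_nhds hpV) (hinward w hw)) w
  · filter_upwards [self_mem_nhdsWithin] with s hs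
    exact lintegral_chartPoisson_le hu p hV.measurableSet hs

end HasLocalForm

lemma IsBranchedImmersion.exists_density_ge_of_isInteriorPoint (hu : IsBranchedImmersion u)
    (hp : (𝓡∂ 2).IsInteriorPoint p) (hV : IsOpen V) (hpV : p ∈ V) :
    ∃ k : ℕ, (¬ Function.Injective (du u p) → 1 ≤ k) ∧ ENNReal.ofReal ((k + 1) * Real.pi) ≤
      Filter.liminf (fun s => ∫⁻ q in V, ENNReal.ofReal (poissonDensity u s (u p) q) ∂(area u))
        (𝓝[>] (0 : ℝ)) := by
  obtain ⟨k, L, ζ, h, hk⟩ := hu.exists_hasLocalForm p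
  refine ⟨k, hk, ?_⟩
  rw [← lintegral_modelDensity_comp k _ h.det_coordDeriv_ne_zero, ← setLIntegral_univ]
  exact h.setLIntegral_modelDensity_le_liminf hu.contMDiff hV hpV .univ fun w _ =>
    isInward_of_isInteriorPoint hp w

lemma IsBranchedImmersion.pi_le_two_mul_density_of_isBoundaryPoint (hu : IsBranchedImmersion u)
    (hp : (𝓡∂ 2).IsBoundaryPoint p) (hV : IsOpen V) (hpV : p ∈ V) :
    ENNReal.ofReal Real.pi ≤ 2 * Filter.liminf (fun s =>
      ∫⁻ q in V, ENNReal.ofReal (poissonDensity u s (u p) q) ∂(area u)) (𝓝[>] (0 : ℝ)) := by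
  obtain ⟨k, L, ζ, h, -⟩ := hu.exists_hasLocalForm p
  set A := coordDeriv ζ p (extChartAt (𝓡∂ 2) p p)
  let ℓ : Euc 2 →L[ℝ] ℝ := EuclideanSpace.proj 0
  have hℓ : ℓ ≠ 0 := fun h0 => by
    simpa [ℓ] using DFunLike.congr_fun h0 (EuclideanSpace.single 0 1)
  calc ENNReal.ofReal Real.pi ≤ ENNReal.ofReal ((k + 1) * Real.pi) :=
        ENNReal.ofReal_le_ofReal (le_mul_of_one_le_left Real.pi_nonneg (by simp))
    _ = ∫⁻ w, ENNReal.ofReal (modelDensity k ‖A w‖ * |A.det|) :=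
        (lintegral_modelDensity_comp k A h.det_coordDeriv_ne_zero).symm
    _ = 2 * ∫⁻ w in {w | 0 < ℓ w}, ENNReal.ofReal (modelDensity k ‖A w‖ * |A.det|) :=
        lintegral_eq_two_mul_setLIntegral_of_even volume hℓ fun w => by rw [map_neg, norm_neg]
    _ ≤ _ := by
        gcongr
        exact h.setLIntegral_modelDensity_le_liminf hu.contMDiff hV hpV
          (measurableSet_lt measurable_const ℓ.measurable) fun w hw =>
            isInward_of_isBoundaryPoint hp hw

end LocalDensity

section Exponents

variable {p : ℝ≥0∞}

lemma two_lt_toReal (hp : 2 < p) (hp' : p ≠ ⊤) : 2 < p.toReal := by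
  simpa only [ENNReal.toReal_ofNat] using (ENNReal.toReal_lt_toReal ENNReal.ofNat_ne_top hp').2 hp

lemma one_le_constC (hp : 2 < p) : 1 ≤ constC p := by
  unfold constC
  split_ifs with hp'
  · exact le_rfl
  have h2 := two_lt_toReal hp hp'
  have hratio : 2 ≤ 2 * p.toReal / (p.toReal - 2) := by
    rw [le_div_iff₀ (by linarith)]
    linarith
  have hpow : 1 / 2 ≤ (2 / Real.pi) ^ (1 / p.toReal) :=
    calc 1 / 2 ≤ (2 / Real.pi) ^ (1 : ℝ) := by
          rw [Real.rpow_one, div_le_div_iff₀ two_pos Real.pi_pos]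
          linarith [Real.pi_le_four]
      _ ≤ _ := Real.rpow_le_rpow_of_exponent_ge (div_pos two_pos Real.pi_pos)
          ((div_le_one Real.pi_pos).2 Real.two_le_pi) ((div_le_one (by linarith)).2 (by linarith))
  calc (1 : ℝ) = 2 * (1 / 2) := by norm_num
    _ ≤ _ := mul_le_mul hratio hpow (by norm_num) (by linarith)

lemma expAlpha_eq (p : ℝ≥0∞) : expAlpha p = (1 / 2 - 1 / p.toReal) * 2 := by
  unfold expAlpha
  split_ifs with hp
  · simp [hp]
  · ring

lemma expAlpha_mem_Icc (hp : 2 < p) : expAlpha p ∈ Icc (0 : ℝ) 1 := by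
  unfold expAlpha
  split_ifs with hp'
  · exact right_mem_Icc.2 zero_le_one
  have h2 := two_lt_toReal hp hp'
  exact ⟨sub_nonneg.2 ((div_le_one (by linarith)).2 h2.le), sub_le_self _ (by positivity)⟩

end Exponents

section HolderInequality

variable {α E : Type*} [MeasurableSpace α] [NormedAddCommGroup E] {μ : Measure α} {H : α → E}

lemma sq_toReal_eLpNorm_two (hH : MemLp H 2 μ) :
    (eLpNorm H 2 μ).toReal ^ 2 = ∫ q, ‖H q‖ ^ 2 ∂μ := by
  have hnonneg : 0 ≤ ∫ q, ‖H q‖ ^ 2 ∂μ := integral_nonneg fun q => by positivity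
  rw [hH.eLpNorm_eq_integral_rpow_norm two_ne_zero ENNReal.ofNat_ne_top, ENNReal.toReal_ofNat]
  simp only [Real.rpow_ofNat]
  rw [ENNReal.toReal_ofReal (by positivity)]
  exact_mod_cast Real.rpow_inv_natCast_pow hnonneg two_ne_zero

lemma integral_norm_sq_le [IsFiniteMeasure μ] {p : ℝ≥0∞} (hp : 2 < p) (hH : MemLp H p μ) :
    ∫ q, ‖H q‖ ^ 2 ∂μ ≤ (eLpNorm H p μ).toReal ^ 2 * μ.real univ ^ expAlpha p := by
  have hexp : 0 ≤ 1 / 2 - 1 / p.toReal := by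
    linarith [(expAlpha_mem_Icc hp).1, expAlpha_eq p]
  have hholder := eLpNorm_le_eLpNorm_mul_rpow_measure_univ hp.le hH.1
  rw [ENNReal.toReal_ofNat] at hholder
  have hreal := ENNReal.toReal_mono (ENNReal.mul_ne_top hH.2.ne
    (ENNReal.rpow_ne_top_of_nonneg hexp (measure_ne_top μ univ))) hholder
  rw [ENNReal.toReal_mul, ← ENNReal.toReal_rpow] at hreal
  calc ∫ q, ‖H q‖ ^ 2 ∂μ = (eLpNorm H 2 μ).toReal ^ 2 :=
        (sq_toReal_eLpNorm_two (hH.mono_exponent hp.le)).symm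
    _ ≤ ((eLpNorm H p μ).toReal * μ.real univ ^ (1 / 2 - 1 / p.toReal)) ^ 2 :=
        pow_le_pow_left₀ ENNReal.toReal_nonneg hreal 2
    _ = _ := by
        rw [mul_pow, expAlpha_eq, Real.rpow_mul measureReal_nonneg, Real.rpow_ofNat]

end HolderInequality

section Energy

variable {n : ℕ} {M : Type*} [TopologicalSpace M] [ChartedSpace (EuclideanHalfSpace 2) M]
  {γ : ℝ → Euc n} {u H : M → Euc n}

omit [TopologicalSpace M] [ChartedSpace (EuclideanHalfSpace 2) M] in
lemma inv_four_mul_sq_le_poissonDensity {r : ℝ} (hr : 0 < r) {x : Euc n} {q : M}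
    (hq : ‖u q - x‖ ≤ r) : (4 * r ^ 2)⁻¹ ≤ poissonDensity u r x q := by
  have hdist : ‖u q - x‖ ^ 2 + r ^ 2 ≤ 2 * r ^ 2 := by
    linarith [pow_le_pow_left₀ (norm_nonneg _) hq 2]
  calc (4 * r ^ 2)⁻¹ = r ^ 2 / (2 * r ^ 2) ^ 2 := by
        field_simp
        norm_num
    _ ≤ poissonDensity u r x q := by
        unfold poissonDensity
        gcongr

variable [CompactSpace M]

omit [ChartedSpace (EuclideanHalfSpace 2) M] in
lemma norm_sub_le_extrinsicDiam (hu : Continuous u) (q q' : M) :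
    ‖u q - u q'‖ ≤ extrinsicDiam u := by
  rw [← dist_eq_norm]
  exact Metric.dist_le_diam_of_mem (isCompact_range hu).isBounded (mem_range_self q)
    (mem_range_self q')

lemma extrinsicDiam_pos (hu : Continuous u) (hγ : IsC1ClosedCurve γ)
    (himg : u '' ((𝓡∂ 2).boundary M) = range γ) : 0 < extrinsicDiam u := by
  have hne : γ 0 ≠ γ (1 / 2) := fun h => by
    simpa using hγ.injOn (by norm_num) (by norm_num) h
  obtain ⟨q, -, hq⟩ : γ 0 ∈ u '' ((𝓡∂ 2).boundary M) := himg ▸ mem_range_self _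
  obtain ⟨q', -, hq'⟩ : γ (1 / 2) ∈ u '' ((𝓡∂ 2).boundary M) := himg ▸ mem_range_self _
  rw [← hq, ← hq', ← sub_ne_zero] at hne
  exact (norm_pos_iff.2 hne).trans_le (norm_sub_le_extrinsicDiam hu q q')

variable [IsManifold (𝓡∂ 2) 1 M] [MeasurableSpace M] [BorelSpace M]

lemma area_div_sq_extrinsicDiam_le (hu : ContMDiff (𝓡∂ 2) 𝓘(ℝ, Euc n) 1 u)
    (hr : 0 < extrinsicDiam u) (q₀ : M) :
    (area u).real univ / extrinsicDiam u ^ 2 ≤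
      4 * ∫ q, poissonDensity u (extrinsicDiam u) (u q₀) q ∂(area u) := by
  have : IsFiniteMeasure (area u) := isFiniteMeasure_area hu
  have hlow := integral_mono (integrable_const ((4 * extrinsicDiam u ^ 2)⁻¹))
    (integrable_poissonDensity hr (u q₀) hu) fun q =>
      inv_four_mul_sq_le_poissonDensity hr (norm_sub_le_extrinsicDiam hu.continuous q q₀)
  rw [integral_const, smul_eq_mul] at hlow
  calc (area u).real univ / extrinsicDiam u ^ 2 =
        4 * ((area u).real univ * (4 * extrinsicDiam u ^ 2)⁻¹) := by field_simp
    _ ≤ _ := by gcongr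

-- Both factors on the right are invariant under scaling of `u`; the exponent of the area ratio lies
-- in `[0, 1]`, whence the maximum with `1`.
lemma integral_norm_sq_le_of_lt (hu : ContMDiff (𝓡∂ 2) 𝓘(ℝ, Euc n) 1 u)
    (hr : 0 < extrinsicDiam u) {p : ℝ≥0∞} (hp : 2 < p) (hH : MemLp H p (area u)) {δ : ℝ}
    (hδ : constC p * (eLpNorm H p (area u)).toReal * extrinsicDiam u ^ expAlpha p < δ) :
    ∫ q, ‖H q‖ ^ 2 ∂(area u) ≤
      δ ^ 2 * max 1 ((area u).real univ / extrinsicDiam u ^ 2) := by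
  have : IsFiniteMeasure (area u) := isFiniteMeasure_area hu
  set r := extrinsicDiam u
  set L := (eLpNorm H p (area u)).toReal
  set A := (area u).real univ
  set α := expAlpha p
  obtain ⟨hα0, hα1⟩ := expAlpha_mem_Icc hp
  have : 0 ≤ L := ENNReal.toReal_nonneg
  have hA : 0 ≤ A := measureReal_nonneg
  have hsmall : L * r ^ α ≤ δ :=
    calc L * r ^ α ≤ constC p * (L * r ^ α) :=
          le_mul_of_one_le_left (by positivity) (one_le_constC hp)
      _ ≤ δ := by linarith
  have hscale : A ^ α = (A / r ^ 2) ^ α * (r ^ α) ^ 2 := by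
    rw [Real.div_rpow hA (by positivity), Real.rpow_pow_comm hr.le,
      div_mul_cancel₀ _ (by positivity)]
  have hratio : (A / r ^ 2) ^ α ≤ max 1 (A / r ^ 2) :=
    calc (A / r ^ 2) ^ α ≤ max 1 (A / r ^ 2) ^ α :=
          Real.rpow_le_rpow (by positivity) (le_max_right _ _) hα0
      _ ≤ max 1 (A / r ^ 2) ^ (1 : ℝ) :=
          Real.rpow_le_rpow_of_exponent_le (le_max_left _ _) hα1
      _ = _ := Real.rpow_one _
  calc ∫ q, ‖H q‖ ^ 2 ∂(area u) ≤ L ^ 2 * A ^ α := integral_norm_sq_le hp hH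
    _ = (L * r ^ α) ^ 2 * (A / r ^ 2) ^ α := by
        rw [hscale]
        ring
    _ ≤ _ := by gcongr

namespace IsBranchedImmersion

variable (hu : IsBranchedImmersion u) (hγ : IsC1ClosedCurve γ)
  (hinj : InjOn u ((𝓡∂ 2).boundary M)) (himg : u '' ((𝓡∂ 2).boundary M) = range γ)
  (hdiv : DivergenceIdentity u H)
include hu hγ hinj himg hdiv

lemma two_mul_integral_poissonDensity_le (hH : MemLp H 2 (area u)) {V : NNReal}
    (hV : totalCurvature γ ≤ V) {s : ℝ} (hs : 0 < s) (x : Euc n) :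
    2 * ∫ q, poissonDensity u s x q ∂(area u) ≤
      1 / 8 * (∫ q, ‖H q‖ ^ 2 ∂(area u)) + V - ∫ t in (0 : ℝ)..1, coneDefect γ s x t := by
  linarith [BranchedSurface.two_mul_integral_poissonDensity_le hs x hu.contMDiff hdiv hH,
    integral_inner_radialField_conormal_le hu hγ hinj himg hs x,
    integral_fluxSpeed_le hγ.contDiff hγ.deriv_ne_zero hγ.periodic hV hs x]

lemma area_div_sq_le (hH : MemLp H 2 (area u)) {V : NNReal} (hV : totalCurvature γ ≤ V) :
    (area u).real univ / extrinsicDiam u ^ 2 ≤ 1 / 4 * (∫ q, ‖H q‖ ^ 2 ∂(area u)) + 2 * V := by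
  have hr := extrinsicDiam_pos hu.contMDiff.continuous hγ himg
  obtain ⟨q₀, -, -⟩ : γ 0 ∈ u '' ((𝓡∂ 2).boundary M) := himg ▸ mem_range_self _
  linarith [hu.two_mul_integral_poissonDensity_le hγ hinj himg hdiv hH hV hr (u q₀),
    integral_coneDefect_nonneg γ (extrinsicDiam u) (u q₀),
    area_div_sq_extrinsicDiam_le hu.contMDiff hr q₀]

lemma integral_norm_sq_le_of_small {V : NNReal} (hV : totalCurvature γ ≤ V) {δ : ℝ}
    (hδ2 : δ ^ 2 ≤ 1 / 4) {p : ℝ≥0∞} (hp : 2 < p) (hH : MemLp H p (area u))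
    (hδ : constC p * (eLpNorm H p (area u)).toReal * extrinsicDiam u ^ expAlpha p < δ) :
    ∫ q, ‖H q‖ ^ 2 ∂(area u) ≤ δ ^ 2 * max 1 (3 * V : ℝ) := by
  have : IsFiniteMeasure (area u) := isFiniteMeasure_area hu.contMDiff
  have hr := extrinsicDiam_pos hu.contMDiff.continuous hγ himg
  have hsmall := integral_norm_sq_le_of_lt hu.contMDiff hr hp hH hδ
  have harea := hu.area_div_sq_le hγ hinj himg hdiv (hH.mono_exponent hp.le) hV
  set a := (area u).real univ / extrinsicDiam u ^ 2
  have hbound : max 1 a ≤ max 1 (3 * V : ℝ) := by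
    rcases max_cases 1 a with ⟨hmax, -⟩ | ⟨hmax, ha⟩
    · exact hmax.trans_le (le_max_left _ _)
    · rw [hmax] at hsmall ⊢
      have : δ ^ 2 * a ≤ 1 / 4 * a := by gcongr
      exact le_max_of_le_right (by linarith)
  exact hsmall.trans (by gcongr)

end IsBranchedImmersion

end Energy

lemma isEmbedding_comp_coe_preimage {X Y : Type*} [TopologicalSpace X] [TopologicalSpace Y]
    [CompactSpace X] [T2Space Y] {f : X → Y} (hf : Continuous f) {T : Set Y}
    (hinj : InjOn f (f ⁻¹' T)) : IsEmbedding fun x : f ⁻¹' T => f x :=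
  IsEmbedding.subtypeVal.comp (IsClosedEmbedding.of_continuous_injective_isClosedMap
    hf.restrictPreimage (fun a b hab => Subtype.ext (hinj a.2 b.2 (congrArg Subtype.val hab)))
    (hf.isClosedMap.restrictPreimage T)).isEmbedding

section Embedding

variable {n : ℕ} {M : Type*} [TopologicalSpace M] [ChartedSpace (EuclideanHalfSpace 2) M]
  [IsManifold (𝓡∂ 2) 1 M] [CompactSpace M] [MeasurableSpace M] [BorelSpace M]
  {γ : ℝ → Euc n} {u H : M → Euc n}

section

variable (hu : ContMDiff (𝓡∂ 2) 𝓘(ℝ, Euc n) 1 u)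
include hu

lemma eventually_lt_setIntegral_poissonDensity {V : Set M} {x : Euc n} {b c : ℝ} (hc : c < b)
    (hb₀ : 0 < b) (hb : ENNReal.ofReal b ≤ Filter.liminf (fun s =>
      ∫⁻ q in V, ENNReal.ofReal (poissonDensity u s x q) ∂(area u)) (𝓝[>] (0 : ℝ))) :
    ∀ᶠ s in 𝓝[>] (0 : ℝ), c < ∫ q in V, poissonDensity u s x q ∂(area u) := by
  have hlt := Filter.eventually_lt_of_lt_liminf
    (((ENNReal.ofReal_lt_ofReal_iff hb₀).2 hc).trans_le hb)
  filter_upwards [hlt, self_mem_nhdsWithin] with s hs hs₀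
  rw [← ofReal_integral_eq_lintegral_ofReal (integrable_poissonDensity hs₀ x hu).restrict
    (.of_forall fun q => poissonDensity_nonneg u s x q)] at hs
  exact (ENNReal.ofReal_lt_ofReal_iff'.1 hs).1

lemma setIntegral_add_setIntegral_poissonDensity_le {V W : Set M} (hW : IsOpen W)
    (hVW : Disjoint V W) {s : ℝ} (hs : 0 < s) (x : Euc n) :
    (∫ q in V, poissonDensity u s x q ∂(area u)) + ∫ q in W, poissonDensity u s x q ∂(area u) ≤
      ∫ q, poissonDensity u s x q ∂(area u) := by
  have hint := integrable_poissonDensity hs x hu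
  rw [← setIntegral_union hVW hW.measurableSet hint.integrableOn hint.integrableOn]
  exact setIntegral_le_integral hint (.of_forall fun q => poissonDensity_nonneg u s x q)

end

namespace IsBranchedImmersion

variable (hu : IsBranchedImmersion u)
include hu

section LocalMass

variable {p : M} {V : Set M} {c : ℝ}

lemma eventually_lt_of_isInteriorPoint (hp : (𝓡∂ 2).IsInteriorPoint p) (hV : IsOpen V)
    (hpV : p ∈ V) (hc : c < Real.pi) :
    ∀ᶠ s in 𝓝[>] (0 : ℝ), c < ∫ q in V, poissonDensity u s (u p) q ∂(area u) := by
  obtain ⟨k, -, hk⟩ := hu.exists_density_ge_of_isInteriorPoint hp hV hpV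
  refine eventually_lt_setIntegral_poissonDensity hu.contMDiff hc Real.pi_pos
    (le_trans (ENNReal.ofReal_le_ofReal ?_) hk)
  exact le_mul_of_one_le_left Real.pi_nonneg (by simp)

lemma eventually_lt_of_not_injective (hp : (𝓡∂ 2).IsInteriorPoint p)
    (hdu : ¬ Function.Injective (du u p)) (hc : c < 2 * Real.pi) :
    ∀ᶠ s in 𝓝[>] (0 : ℝ), c < ∫ q, poissonDensity u s (u p) q ∂(area u) := by
  obtain ⟨k, hk1, hk⟩ := hu.exists_density_ge_of_isInteriorPoint hp isOpen_univ (mem_univ p)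
  have hk1' : (1 : ℝ) ≤ k := by exact_mod_cast hk1 hdu
  have hmul : 2 * Real.pi ≤ (k + 1) * Real.pi := by
    gcongr
    linarith
  simpa only [setIntegral_univ] using eventually_lt_setIntegral_poissonDensity hu.contMDiff hc
    Real.two_pi_pos (le_trans (ENNReal.ofReal_le_ofReal hmul) hk)

lemma eventually_lt_of_isBoundaryPoint (hp : (𝓡∂ 2).IsBoundaryPoint p) (hV : IsOpen V)
    (hpV : p ∈ V) (hc : c < Real.pi / 2) :
    ∀ᶠ s in 𝓝[>] (0 : ℝ), c < ∫ q in V, poissonDensity u s (u p) q ∂(area u) := by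
  refine eventually_lt_setIntegral_poissonDensity hu.contMDiff hc Real.pi_div_two_pos ?_
  rw [ENNReal.ofReal_div_of_pos two_pos, ENNReal.ofReal_ofNat]
  exact ENNReal.div_le_of_le_mul' (hu.pi_le_two_mul_density_of_isBoundaryPoint hp hV hpV)

end LocalMass

section

variable {W : ℝ} (hW : W < 4 * Real.pi)
include hW

lemma injective_du_of_isInteriorPoint
    (hmass : ∀ s, 0 < s → ∀ x, 2 * ∫ q, poissonDensity u s x q ∂(area u) ≤ W) {p : M}
    (hp : (𝓡∂ 2).IsInteriorPoint p) : Function.Injective (du u p) := by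
  by_contra hdu
  obtain ⟨s, hs, hs₀⟩ := ((hu.eventually_lt_of_not_injective hp hdu (c := W / 2)
    (by linarith)).and self_mem_nhdsWithin).exists
  linarith [hmass s hs₀ (u p)]

lemma injOn_interior [T2Space M]
    (hmass : ∀ s, 0 < s → ∀ x, 2 * ∫ q, poissonDensity u s x q ∂(area u) ≤ W) :
    InjOn u ((𝓡∂ 2).interior M) := by
  intro p hp q hq hpq
  by_contra hne
  obtain ⟨A, B, hA, hB, hpA, hqB, hAB⟩ := t2_separation hne
  have hmassA := hu.eventually_lt_of_isInteriorPoint hp hA hpA (c := W / 4) (by linarith)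
  have hmassB := hu.eventually_lt_of_isInteriorPoint hq hB hqB (c := W / 4) (by linarith)
  obtain ⟨s, ⟨hsA, hsB⟩, hs₀⟩ := ((hmassA.and hmassB).and self_mem_nhdsWithin).exists
  rw [← hpq] at hsB
  linarith [hmass s hs₀ (u p),
    setIntegral_add_setIntegral_poissonDensity_le hu.contMDiff hB hAB hs₀ (u p)]

-- At a boundary point met by the interior the surface contributes at least `2π + π` and the
-- boundary defect another `π`.
lemma notMem_range_of_isInteriorPoint [T2Space M] (hγ : IsC1ClosedCurve γ)
    (himg : u '' ((𝓡∂ 2).boundary M) = range γ)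
    (hmass : ∀ s, 0 < s → ∀ x, 2 * ∫ q, poissonDensity u s x q ∂(area u) ≤
      W - ∫ t in (0 : ℝ)..1, coneDefect γ s x t) {p : M} (hp : (𝓡∂ 2).IsInteriorPoint p) :
    u p ∉ range γ := by
  rintro ⟨t₀, ht₀⟩
  obtain ⟨q, hq, hqp⟩ : γ t₀ ∈ u '' ((𝓡∂ 2).boundary M) := himg ▸ mem_range_self _
  have hne : p ≠ q := by
    rintro rfl
    exact ((𝓡∂ 2).isInteriorPoint_iff_not_isBoundaryPoint p).1 hp hq
  obtain ⟨A, B, hA, hB, hpA, hqB, hAB⟩ := t2_separation hne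
  set e := (4 * Real.pi - W) / 16 with he
  have hmassA := hu.eventually_lt_of_isInteriorPoint hp hA hpA (c := Real.pi - e) (by linarith)
  have hmassB := hu.eventually_lt_of_isBoundaryPoint hq hB hqB (c := Real.pi / 2 - e)
    (by linarith)
  have hdefect := eventually_le_integral_coneDefect hγ.contDiff hγ.deriv_ne_zero hγ.periodic t₀
    (c := Real.pi - e) (by linarith)
  obtain ⟨s, ⟨⟨hsA, hsB⟩, hsγ⟩, hs₀⟩ :=
    (((hmassA.and hmassB).and hdefect).and self_mem_nhdsWithin).exists
  rw [hqp, ht₀] at hsB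
  rw [ht₀] at hsγ
  linarith [hmass s hs₀ (u p),
    setIntegral_add_setIntegral_poissonDensity_le hu.contMDiff hB hAB hs₀ (u p)]

end

theorem interiorEmbedded_of_energy_lt [T2Space M] (hγ : IsC1ClosedCurve γ)
    (hinj : InjOn u ((𝓡∂ 2).boundary M)) (himg : u '' ((𝓡∂ 2).boundary M) = range γ)
    (hdiv : DivergenceIdentity u H) (hH : MemLp H 2 (area u)) {V : NNReal}
    (hV : totalCurvature γ ≤ V) (hlt : 1 / 8 * (∫ q, ‖H q‖ ^ 2 ∂(area u)) + V < 4 * Real.pi) :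
    InteriorEmbedded u := by
  have hmono := fun s (hs : 0 < s) x =>
    hu.two_mul_integral_poissonDensity_le hγ hinj himg hdiv hH hV hs x
  have hmass := fun s (hs : 0 < s) x =>
    (hmono s hs x).trans (sub_le_self _ (integral_coneDefect_nonneg γ s x))
  have hinterior : (𝓡∂ 2).interior M = u ⁻¹' (range γ)ᶜ := by
    ext p
    refine ⟨fun hp => hu.notMem_range_of_isInteriorPoint hlt hγ himg hmono hp, fun hp => ?_⟩
    rw [← ModelWithCorners.compl_boundary]
    exact fun hb => hp (himg ▸ mem_image_of_mem u hb)
  refine ⟨fun p hp => hu.injective_du_of_isInteriorPoint hlt hmass hp, ?_⟩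
  have hinjOn := hu.injOn_interior hlt hmass
  rw [hinterior] at hinjOn ⊢
  exact isEmbedding_comp_coe_preimage hu.contMDiff.continuous hinjOn

end IsBranchedImmersion

end Embedding

end BranchedSurface

end

open BranchedSurface in
theorem corollary3p3_general {n : ℕ} {M : Type*} [TopologicalSpace M] [T2Space M] [CompactSpace M]
    [ChartedSpace (EuclideanHalfSpace 2) M] [IsManifold (𝓡∂ 2) 1 M] [MeasurableSpace M]
    [BorelSpace M] {ε : ℝ} (hε₀ : 0 < ε) (hε₂ : ε ≤ 2) {p : ℝ≥0∞} (hp : 2 < p) {γ : ℝ → Euc n}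
    {u H : M → Euc n} (hγ : IsC1ClosedCurve γ)
    (hV : totalCurvature γ ≤ ENNReal.ofReal ((4 - ε) * Real.pi)) (hu : IsBranchedImmersion u)
    (hinj : InjOn u ((𝓡∂ 2).boundary M)) (himg : u '' ((𝓡∂ 2).boundary M) = range γ)
    (hdiv : DivergenceIdentity u H) (hH : MemLp H p (area u))
    (hδ : constC p * (eLpNorm H p (area u)).toReal * extrinsicDiam u ^ expAlpha p < ε / 4) :
    InteriorEmbedded u := by
  have : IsFiniteMeasure (area u) := isFiniteMeasure_area hu.contMDiff
  have hcoe : ((Real.toNNReal ((4 - ε) * Real.pi) : NNReal) : ℝ) = (4 - ε) * Real.pi :=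
    Real.coe_toNNReal _ (mul_nonneg (by linarith) Real.pi_nonneg)
  have henergy := hu.integral_norm_sq_le_of_small hγ hinj himg hdiv hV
    (by nlinarith : (ε / 4) ^ 2 ≤ 1 / 4) hp hH hδ
  refine hu.interiorEmbedded_of_energy_lt hγ hinj himg hdiv (hH.mono_exponent hp.le) hV ?_
  rw [hcoe] at henergy ⊢
  have hmax : max 1 (3 * ((4 - ε) * Real.pi)) ≤ 12 * Real.pi :=
    max_le (by linarith [Real.pi_gt_three]) (by nlinarith [Real.pi_pos])
  calc 1 / 8 * (∫ q, ‖H q‖ ^ 2 ∂(area u)) + (4 - ε) * Real.pi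
      ≤ 1 / 8 * ((ε / 4) ^ 2 * (12 * Real.pi)) + (4 - ε) * Real.pi := by
        gcongr
        exact henergy.trans (by gcongr)
    _ < 4 * Real.pi := by nlinarith [mul_pos hε₀ Real.pi_pos]

theorem corollary3p3 (ε : ℝ) (hε₀ : 0 < ε) (hε₂ : ε ≤ 2) :
    ∃ δ : ℝ, 0 < δ ∧ δ < 1 ∧
      ∀ (n : ℕ) (p : ℝ≥0∞) (M : Type*) [TopologicalSpace M] [T2Space M] [CompactSpace M]
        [ChartedSpace (EuclideanHalfSpace 2) M] [IsManifold (𝓡∂ 2) ∞ M]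
        [MeasurableSpace M] [BorelSpace M]
        (γ : ℝ → BranchedSurface.Euc n) (u H : M → BranchedSurface.Euc n),
        2 < p →
        BranchedSurface.IsC1ClosedCurve γ →
        BranchedSurface.totalCurvature γ ≤ ENNReal.ofReal ((4 - ε) * Real.pi) →
        BranchedSurface.IsBranchedImmersion u →
        InjOn u ((𝓡∂ 2).boundary M) →
        u '' ((𝓡∂ 2).boundary M) = range γ →
        BranchedSurface.DivergenceIdentity u H →
        MemLp H p (BranchedSurface.area u) →
        BranchedSurface.constC p * (eLpNorm H p (BranchedSurface.area u)).toReal *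
          BranchedSurface.extrinsicDiam u ^ BranchedSurface.expAlpha p < δ →
        BranchedSurface.InteriorEmbedded u := by
  refine ⟨ε / 4, by linarith, by linarith, ?_⟩
  intro n p M _ _ _ _ _ _ _ γ u H hp hγ hV hu hinj himg hdiv hH hδ
  have : IsManifold (𝓡∂ 2) 1 M := IsManifold.of_le (n := ∞) (by simp)
  exact corollary3p3_general hε₀ hε₂ hp hγ hV hu hinj himg hdiv hH hδ
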